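/- Let $N\in\{2,3\}$, let $\Omega\subset\mathbb R^N$ be open, let $V\in C^2(\Omega,\mathbb R)$ have only isolated critical points, and let $\alpha_2=\begin{pmatrix}0&-1\\1&0\end{pmatrix}$, $\alpha_3=\begin{pmatrix}\alpha_2&0\\0&0\end{pmatrix}$. If $N=3$, write $\widetilde q=(x,y)$ for $q=(x,y,z)$, put $\widetilde\Omega=\{(x,y):(x,y,0)\in\Omega\}$ and $\widetilde V(x,y)=V(x,y,0)$ on $\widetilde\Omega$, and assume moreover that $\frac{\partial V}{\partial z}(x,y,0)=0$ on $\widetilde\Omega$ and that every critical point $q_0$ of $V$ has the form $q_0=(\widetilde q_0,0)$ and satisfies $\beta_3:=\frac{\partial^2V}{\partial z^2}(q_0)>0$. The system $\ddot q-2\alpha_N\dot q+V'(q)=0$ is equivalent to the Hamiltonian system with Hamiltonian $$H(p,q)=\tfrac12|p|^2+\langle p,\alpha_Nq\rangle+V(q)-\tfrac12\langle q,\alpha_N^2q\rangle ,\qquad (p,q)\in\mathbb R^N\times\Omega .$$ For a critical point $q_0$ of $V$ put $u_0=(-\alpha_Nq_0,q_0)$, $A=H''(u_0)$, $J_N=\begin{pmatrix}0&-I_N\\I_N&0\end{pmatrix}$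 and $$S_T=\begin{pmatrix}-\frac T{2\pi}A&-J_N\\J_N&-\frac T{2\pi}A\end{pmatrix}\qquad(T>0).$$ Let $m^-(S)$ be the number of negative eigenvalues of the symmetric matrix $S$, counted with multiplicity, and let $i_B(x_0,f)$ be the Brouwer index of the isolated zero $x_0$ of $f$. The bifurcation number of $(T,q_0)$ is $$\gamma_N(T,q_0)=i_B(u_0,H')\,\lim_{\epsilon\searrow0}\frac{m^-(S_{T+\epsilon})-m^-(S_{T-\epsilon})}2 .$$ Let $\beta_1,\beta_2$ be the eigenvalues, with multiplicity, of $V''(q_0)$ if $N=2$ and of $\widetilde V''(\widetilde q_0)$ if $N=3$. In the plane of pairs $(\beta_1,\beta_2)$ let $C=\{\beta_1\beta_2=0\}$ be the union of the coordinate axes, let $$\mathcal R_0=\{\beta_1<0,\ \beta_2<0,\ \beta_1+\beta_2<\max(-4,-2-(\beta_1-\beta_2)^2/8)\},$$ let $\mathcal R_1,\mathcal R_2,\mathcal R_4$ be the open first, second and fourth quadrants, and let $$\mathcal R_3=\{\beta_1<0,\ \beta_2<0,\ \beta_1+\beta_2>\max(-4,-2-(\beta_1-\beta_2)^2/8)\}.$$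 Put $$T_\pm(\beta_1,\beta_2)=2\pi\sqrt2\Bigl(\beta_1+\beta_2+4\mp2\sqrt2\sqrt{\beta_1+\beta_2+2+(\beta_1-\beta_2)^2/8}\Bigr)^{-1/2};$$ this is used for $T_-$ on $\mathcal R_1\cup\mathcal R_2\cup\mathcal R_3\cup\mathcal R_4\cup(C\setminus\partial\mathcal R_0)$ and for $T_+$ on $\mathcal R_1\cup\mathcal R_3$. Then, for every $T>0$ and every critical point $q_0$ of $V$, the limit that defines $\gamma_N(T,q_0)$ exists, and the following formulas hold. If $N=2$, $$\gamma_2(T,q_0)=\begin{cases}-1&\text{if }(\beta_1,\beta_2)\in\mathcal R_2\cup\mathcal R_4,\ T=T_-(\beta_1,\beta_2),\\ 1&\text{if }(\beta_1,\beta_2)\in\mathcal R_1\cup\mathcal R_3,\ T=T_-(\beta_1,\beta_2),\\ i_B(q_0,V')&\text{if }(\beta_1,\beta_2)\in C\setminus\partial\mathcal R_0,\ T=T_-(\beta_1,\beta_2),\\ 1&\text{if }(\beta_1,\beta_2)\in\mathcal R_1,\ T=T_+(\beta_1,\beta_2),\\ -1&\text{if }(\beta_1,\beta_2)\in\mathcal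 R_3,\ T=T_+(\beta_1,\beta_2),\\ 0&\text{otherwise.}\end{cases}$$ If $N=3$, with $\gamma_2(T,\widetilde q_0)$ denoting the bifurcation number for the planar potential $\widetilde V$, $$\gamma_3(T,q_0)=\begin{cases}\gamma_2(T,\widetilde q_0)-1&\text{if }(\beta_1,\beta_2)\in\mathcal R_2\cup\mathcal R_4,\ T=2\pi/\sqrt{\beta_3},\\ \gamma_2(T,\widetilde q_0)+1&\text{if }(\beta_1,\beta_2)\in(\overline{\mathcal R_0}\setminus C)\cup\mathcal R_1\cup\mathcal R_3,\ T=2\pi/\sqrt{\beta_3},\\ \gamma_2(T,\widetilde q_0)+i_B(\widetilde q_0,\widetilde V')&\text{if }(\beta_1,\beta_2)\in C,\ T=2\pi/\sqrt{\beta_3},\\ \gamma_2(T,\widetilde q_0)&\text{if }T\ne2\pi/\sqrt{\beta_3}.\end{cases}$$ -/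

import Mathlib

open Filter Topology Set
open scoped ContDiff Matrix

noncomputable section

/-! Euclidean preliminaries -/

/-- The Hessian matrix of `f` at `x`, with respect to the canonical basis. -/
def hessianMatrix {ι : Type*} [Fintype ι] [DecidableEq ι] (f : EuclideanSpace ℝ ι → ℝ)
    (x : EuclideanSpace ℝ ι) : Matrix ι ι ℝ :=
  Matrix.of fun i j =>
    fderiv ℝ (fun y => fderiv ℝ f y) x (EuclideanSpace.single i 1) (EuclideanSpace.single j 1)

/-- The Morse index of a real symmetric matrix: the number of its negative eigenvalues, counted
with multiplicity. -/
def morseIndex {ι : Type*} [Fintype ι] [DecidableEq ι] (S : Matrix ι ι ℝ) : ℕ :=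
  S.charpoly.roots.countP (· < 0)

/-! The Brouwer index of an isolated zero of a continuous map, by regular smooth approximation -/

/-- `g` is admissible for computing the degree of `f` on the ball of radius `r` around `x₀`: it is
smooth, it is so close to `f` on the sphere that the segment from `f x` to `g x` avoids `0`, and all
its zeros in the ball are nondegenerate. -/
structure IsRegularApprox {ι : Type*} [Fintype ι]
    (f : EuclideanSpace ℝ ι → EuclideanSpace ℝ ι) (x₀ : EuclideanSpace ℝ ι) (r : ℝ)
    (g : EuclideanSpace ℝ ι → EuclideanSpace ℝ ι) : Prop where
  smooth : ContDiff ℝ ∞ g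
  close : ∀ x ∈ Metric.sphere x₀ r, ‖g x - f x‖ < ‖f x‖
  regular : ∀ x ∈ Metric.closedBall x₀ r, g x = 0 → (fderiv ℝ g x).det ≠ 0

/-- The sum of the signs of the Jacobian determinants of `g` at its zeros in the open ball. -/
def signedZeroCount {ι : Type*} [Fintype ι]
    (g : EuclideanSpace ℝ ι → EuclideanSpace ℝ ι) (x₀ : EuclideanSpace ℝ ι) (r : ℝ) : ℤ :=
  ∑ᶠ x ∈ {x | x ∈ Metric.ball x₀ r ∧ g x = 0}, (SignType.sign (fderiv ℝ g x).det : ℤ)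

/-- `d` is the Brouwer degree of `f` on every sufficiently small ball around `x₀`. -/
def HasBrouwerIndex {ι : Type*} [Fintype ι] (x₀ : EuclideanSpace ℝ ι)
    (f : EuclideanSpace ℝ ι → EuclideanSpace ℝ ι) (d : ℤ) : Prop :=
  ∀ᶠ r in 𝓝[>] (0 : ℝ), (∃ g, IsRegularApprox f x₀ r g) ∧
    ∀ g, IsRegularApprox f x₀ r g → signedZeroCount g x₀ r = d

theorem HasBrouwerIndex.unique {ι : Type*} [Fintype ι] {x₀ : EuclideanSpace ℝ ι}
    {f : EuclideanSpace ℝ ι → EuclideanSpace ℝ ι} {d d' : ℤ}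
    (h : HasBrouwerIndex x₀ f d) (h' : HasBrouwerIndex x₀ f d') : d = d' := by
  obtain ⟨r, ⟨⟨g, hg⟩, h1⟩, -, h2⟩ := (Filter.Eventually.and h h').exists
  rw [← h1 g hg, ← h2 g hg]

open Classical in
/-- The Brouwer index `i_B(x₀, f)` of the isolated zero `x₀` of the map `f`, continuous
near `x₀`. -/
def brouwerIndex {ι : Type*} [Fintype ι] (x₀ : EuclideanSpace ℝ ι)
    (f : EuclideanSpace ℝ ι → EuclideanSpace ℝ ι) : ℤ :=
  if h : ∃ d, HasBrouwerIndex x₀ f d then h.choose else 0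

theorem HasBrouwerIndex.brouwerIndex_eq {ι : Type*} [Fintype ι] {x₀ : EuclideanSpace ℝ ι}
    {f : EuclideanSpace ℝ ι → EuclideanSpace ℝ ι} {d : ℤ}
    (h : HasBrouwerIndex x₀ f d) : brouwerIndex x₀ f = d := by
  have hex : ∃ d, HasBrouwerIndex x₀ f d := ⟨d, h⟩
  rw [brouwerIndex, dif_pos hex]
  exact hex.choose_spec.unique h

/-! Bifurcation numbers of a Hamiltonian system `u' = J H'(u)` on `ℝᴺ × ℝᴺ`. The coordinates of
`u = (p, q)` are indexed by `Fin N ⊕ Fin N`, and `Matrix.J` is the block matrix `(0, -1; 1, 0)`. -/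

/-- The symmetric matrix `S_T` built from `A = H''(u₀)`. -/
def szulkinMatrix {N : ℕ} (A : Matrix (Fin N ⊕ Fin N) (Fin N ⊕ Fin N) ℝ) (T : ℝ) :
    Matrix ((Fin N ⊕ Fin N) ⊕ (Fin N ⊕ Fin N)) ((Fin N ⊕ Fin N) ⊕ (Fin N ⊕ Fin N)) ℝ :=
  Matrix.fromBlocks (-((T / (2 * Real.pi)) • A)) (-(Matrix.J (Fin N) ℝ))
    (Matrix.J (Fin N) ℝ) (-((T / (2 * Real.pi)) • A))

/-- Half the increment of the Morse index of `S` from `T - ε` to `T + ε`. -/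
def morseJump {N : ℕ} (H : EuclideanSpace ℝ (Fin N ⊕ Fin N) → ℝ) (T : ℝ)
    (u₀ : EuclideanSpace ℝ (Fin N ⊕ Fin N)) (ε : ℝ) : ℝ :=
  ((morseIndex (szulkinMatrix (hessianMatrix H u₀) (T + ε)) : ℝ)
    - (morseIndex (szulkinMatrix (hessianMatrix H u₀) (T - ε)) : ℝ)) / 2

/-- The bifurcation number `γ_H(T, u₀)`. -/
def bifurcationNumber {N : ℕ} (H : EuclideanSpace ℝ (Fin N ⊕ Fin N) → ℝ) (T : ℝ)
    (u₀ : EuclideanSpace ℝ (Fin N ⊕ Fin N)) : ℝ :=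
  (brouwerIndex u₀ (gradient H) : ℝ) * limUnder (𝓝[>] (0 : ℝ)) (morseJump H T u₀)

/-! The Hamiltonian of a Newtonian system with Coriolis force -/

def alpha2 : Matrix (Fin 2) (Fin 2) ℝ := !![0, -1; 1, 0]

def alpha3 : Matrix (Fin 3) (Fin 3) ℝ := !![0, -1, 0; 1, 0, 0; 0, 0, 0]

/-- `W(q) = V(q) - ⟨q, α² q⟩ / 2`. -/
def amendedPotential {N : ℕ} (α : Matrix (Fin N) (Fin N) ℝ) (V : EuclideanSpace ℝ (Fin N) → ℝ)
    (q : EuclideanSpace ℝ (Fin N)) : ℝ :=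
  V q - 1 / 2 * inner ℝ q (Matrix.toEuclideanLin (α * α) q)

def momentumPart {N : ℕ} (u : EuclideanSpace ℝ (Fin N ⊕ Fin N)) : EuclideanSpace ℝ (Fin N) :=
  WithLp.toLp 2 fun i => u (Sum.inl i)

def positionPart {N : ℕ} (u : EuclideanSpace ℝ (Fin N ⊕ Fin N)) : EuclideanSpace ℝ (Fin N) :=
  WithLp.toLp 2 fun i => u (Sum.inr i)

/-- `H(p, q) = |p|² / 2 + ⟨p, α q⟩ + W(q)`. -/
def coriolisHamiltonian {N : ℕ} (α : Matrix (Fin N) (Fin N) ℝ)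
    (V : EuclideanSpace ℝ (Fin N) → ℝ) (u : EuclideanSpace ℝ (Fin N ⊕ Fin N)) : ℝ :=
  1 / 2 * ‖momentumPart u‖ ^ 2
    + inner ℝ (momentumPart u) (Matrix.toEuclideanLin α (positionPart u))
    + amendedPotential α V (positionPart u)

/-- The equilibrium `u₀ = (-α q₀, q₀)` of the Hamiltonian system. -/
def phaseEquilibrium {N : ℕ} (α : Matrix (Fin N) (Fin N) ℝ) (q₀ : EuclideanSpace ℝ (Fin N)) :
    EuclideanSpace ℝ (Fin N ⊕ Fin N) :=
  WithLp.toLp 2 (Sum.elim (fun i => -(Matrix.toEuclideanLin α q₀) i) (fun i => q₀ i))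

def gamma2 (V : EuclideanSpace ℝ (Fin 2) → ℝ) (T : ℝ) (q₀ : EuclideanSpace ℝ (Fin 2)) : ℝ :=
  bifurcationNumber (coriolisHamiltonian alpha2 V) T (phaseEquilibrium alpha2 q₀)

def gamma3 (V : EuclideanSpace ℝ (Fin 3) → ℝ) (T : ℝ) (q₀ : EuclideanSpace ℝ (Fin 3)) : ℝ :=
  bifurcationNumber (coriolisHamiltonian alpha3 V) T (phaseEquilibrium alpha3 q₀)

/-! Standing assumptions -/

/-- The assumptions on the effective potential in the planar case. -/
structure PlanarSystem (Ω : Set (EuclideanSpace ℝ (Fin 2)))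
    (V : EuclideanSpace ℝ (Fin 2) → ℝ) : Prop where
  isOpen : IsOpen Ω
  contDiffOn : ContDiffOn ℝ 2 V Ω
  isolated : ∀ q ∈ Ω, gradient V q = 0 → ∀ᶠ q' in 𝓝[≠] q, gradient V q' ≠ 0

/-- `(x, y) ↦ (x, y, 0)`. -/
def planeEmbedding (w : EuclideanSpace ℝ (Fin 2)) : EuclideanSpace ℝ (Fin 3) :=
  !₂[w 0, w 1, 0]

/-- `(x, y, z) ↦ (x, y)`. -/
def planeProjection (q : EuclideanSpace ℝ (Fin 3)) : EuclideanSpace ℝ (Fin 2) :=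
  !₂[q 0, q 1]

/-- The planar potential `(x, y) ↦ V(x, y, 0)`. -/
def planarRestriction (V : EuclideanSpace ℝ (Fin 3) → ℝ) (w : EuclideanSpace ℝ (Fin 2)) : ℝ :=
  V (planeEmbedding w)

/-- The assumptions on the effective potential in the spatial case. -/
structure SpatialSystem (Ω : Set (EuclideanSpace ℝ (Fin 3)))
    (V : EuclideanSpace ℝ (Fin 3) → ℝ) : Prop where
  isOpen : IsOpen Ω
  contDiffOn : ContDiffOn ℝ 2 V Ω
  isolated : ∀ q ∈ Ω, gradient V q = 0 → ∀ᶠ q' in 𝓝[≠] q, gradient V q' ≠ 0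
  planar_invariant : ∀ w, planeEmbedding w ∈ Ω → gradient V (planeEmbedding w) 2 = 0
  planar_equilibria : ∀ q ∈ Ω, gradient V q = 0 → q 2 = 0
  vertical_attraction : ∀ q ∈ Ω, gradient V q = 0 → 0 < hessianMatrix V q 2 2

/-! The regions of the plane of eigenvalues `(β₁, β₂)` -/

def axesC : Set (ℝ × ℝ) := {b | b.2 = 0} ∪ {b | b.1 = 0}

def region0 : Set (ℝ × ℝ) :=
  {b | b.1 < 0 ∧ b.2 < 0 ∧ b.1 + b.2 < max (-4) (-2 - (b.1 - b.2) ^ 2 / 8)}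

def region1 : Set (ℝ × ℝ) := {b | 0 < b.1 ∧ 0 < b.2}

def region2 : Set (ℝ × ℝ) := {b | b.1 < 0 ∧ 0 < b.2}

def region3 : Set (ℝ × ℝ) :=
  {b | b.1 < 0 ∧ b.2 < 0 ∧ max (-4) (-2 - (b.1 - b.2) ^ 2 / 8) < b.1 + b.2}

def region4 : Set (ℝ × ℝ) := {b | 0 < b.1 ∧ b.2 < 0}

/-- `T₋(β₁, β₂)`. -/
def periodMinus (b : ℝ × ℝ) : ℝ :=
  2 * Real.pi * √2 *
    (b.1 + b.2 + 4 + 2 * √2 * √(b.1 + b.2 + 2 + (b.1 - b.2) ^ 2 / 8)) ^ (-1 / 2 : ℝ)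

/-- `T₊(β₁, β₂)`. -/
def periodPlus (b : ℝ × ℝ) : ℝ :=
  2 * Real.pi * √2 *
    (b.1 + b.2 + 4 - 2 * √2 * √(b.1 + b.2 + 2 + (b.1 - b.2) ^ 2 / 8)) ^ (-1 / 2 : ℝ)

end

/-! The bifurcation number is a Brouwer index times a jump of a Morse index, and the two factors are
computed separately.

Index. Since `α` is antisymmetric, H = |p + αq|²/2 + V(q) (`coriolisHamiltonian_eq`). Thus H' is a
suspension of V', and both have the same index (`brouwerIndex_suspension`,
`brouwerIndex_gradient_coriolisHamiltonian`). At a nondegenerate planar critical point this index is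
the sign of β₁β₂. In space, V' is deformed near q₀ to the field (Ṽ'(x, y), z), so its index is that
of Ṽ' (`brouwerIndex_gradient_planarRestriction`). All of this rests on the homotopy invariance of
the signed count of zeros (`signedZeroCount_eq_of_segment`), which has an analytic proof: the count
is ∫ χ φ(g) det Dg for φ concentrated near 0, and along a homotopy the integrand changes by χ times
a divergence.

Jump. A congruence splits off the momenta, which contribute the constant 2N to the Morse index
(`morseIndex_szulkinMatrix`). For N = 2 what remains is the real form of a Hermitian 2×2 matrix, so
its two eigenvalues count twice. With w = (2π/T)², their product and sum are positive multiples of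
D(w) = w² − (β₁ + β₂ + 4)w + β₁β₂ and θ(w) = 2w − (β₁ + β₂). The index is 2 where D < 0; where D > 0
it is 0 or 4, according to the sign of θ. It therefore jumps exactly at the simple positive roots of
D: the larger root is the frequency of T₋, the smaller one that of T₊. `planarCount_jump` matches
these roots with the regions.

For N = 3 the vertical direction adds the double eigenvalue τ⁻¹ − τβ₃, with τ = T/2π. It makes the
halved index jump by 1 at T = 2π/√β₃, so γ₃ and γ₂ differ there by the index of the planar field. -/

/-! ### Determinants of families of vectors. -/

section VolumeForm

variable {ι : Type*} [Fintype ι]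

open Classical in
/-- The determinant of a family of vectors in the canonical basis. -/
noncomputable def volForm (ι : Type*) [Fintype ι] :
    ContinuousMultilinearMap ℝ (fun _ : ι => EuclideanSpace ℝ ι) ℝ where
  toMultilinearMap := (EuclideanSpace.basisFun ι ℝ).toBasis.det.toMultilinearMap
  cont := by
    change Continuous fun v => (EuclideanSpace.basisFun ι ℝ).toBasis.det v
    simp only [Module.Basis.det_apply]
    refine Continuous.matrix_det (continuous_matrix fun i j => ?_)
    simp only [Module.Basis.toMatrix_apply, OrthonormalBasis.coe_toBasis_repr_apply,
      EuclideanSpace.basisFun_repr]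
    fun_prop

open Classical in
theorem volForm_apply (v : ι → EuclideanSpace ℝ ι) :
    volForm ι v = (EuclideanSpace.basisFun ι ℝ).toBasis.det v := rfl

open Classical in
theorem volForm_comp_basis (L : EuclideanSpace ℝ ι →L[ℝ] EuclideanSpace ℝ ι) :
    volForm ι (fun i => L (EuclideanSpace.single i 1)) = L.det := by
  have h := (EuclideanSpace.basisFun ι ℝ).toBasis.det_comp (L : EuclideanSpace ℝ ι →ₗ[ℝ] _)
    (EuclideanSpace.basisFun ι ℝ).toBasis
  rw [Module.Basis.det_self, mul_one] at h
  rw [volForm_apply, ContinuousLinearMap.det, ← h]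
  congr 1

open Classical in
theorem volForm_update_update_swap (v : ι → EuclideanSpace ℝ ι) {i j : ι} (hij : i ≠ j)
    (a b : EuclideanSpace ℝ ι) :
    volForm ι (Function.update (Function.update v i a) j b) =
      - volForm ι (Function.update (Function.update v i b) j a) := by
  have h := AlternatingMap.map_swap (EuclideanSpace.basisFun ι ℝ).toBasis.det
    (Function.update (Function.update v i b) j a) hij
  simp only [volForm_apply]
  rw [← h]
  congr 1
  ext l : 1
  by_cases hi : l = i
  · subst hi; simp [hij]
  by_cases hj : l = j
  · subst hj; simp [hij]
  simp [Equiv.swap_apply_of_ne_of_ne hi hj, hi, hj]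

open Classical in
/-- Cramer's rule, paired with a linear functional. -/
theorem sum_apply_mul_volForm_update (f : EuclideanSpace ℝ ι →L[ℝ] ℝ)
    (v : ι → EuclideanSpace ℝ ι) (k : EuclideanSpace ℝ ι) :
    ∑ i, f (v i) * volForm ι (Function.update v i k) = f k * volForm ι v := by
  set b := (EuclideanSpace.basisFun ι ℝ).toBasis
  have hvec : ∑ i, volForm ι (Function.update v i k) • v i = volForm ι v • k := by
    apply b.repr.injective
    ext j
    have h := congrFun (Matrix.mulVec_cramer (b.toMatrix v) (b.repr k)) j
    simp only [Matrix.mulVec, dotProduct, Matrix.cramer_apply, Pi.smul_apply, smul_eq_mul,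
      ← Module.Basis.toMatrix_update, ← Module.Basis.det_apply] at h
    simp only [map_sum, map_smul, Finsupp.coe_finsetSum, Finset.sum_apply, Finsupp.smul_apply,
      smul_eq_mul, volForm_apply]
    rw [← h]
    exact Finset.sum_congr rfl fun i _ => by rw [mul_comm, Module.Basis.toMatrix_apply]
  have := congrArg f hvec
  simp only [map_sum, map_smul, smul_eq_mul] at this
  rw [mul_comm (f k), ← this]
  exact Finset.sum_congr rfl fun i _ => mul_comm _ _

end VolumeForm

/-! ### The Piola identity. -/

section Divergence

variable {ι : Type*} [Fintype ι]

/-- The columns of the Jacobian matrix. -/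
noncomputable def partials (h : EuclideanSpace ℝ ι → EuclideanSpace ℝ ι) (x : EuclideanSpace ℝ ι) :
    ι → EuclideanSpace ℝ ι := by
  classical exact fun l => fderiv ℝ h x (EuclideanSpace.single l 1)

theorem volForm_partials (h : EuclideanSpace ℝ ι → EuclideanSpace ℝ ι) (x : EuclideanSpace ℝ ι) :
    volForm ι (partials h x) = (fderiv ℝ h x).det := volForm_comp_basis _

open Classical in
theorem hasFDerivAt_volForm {v : ι → EuclideanSpace ℝ ι → EuclideanSpace ℝ ι}
    {v' : ι → EuclideanSpace ℝ ι →L[ℝ] EuclideanSpace ℝ ι} {x : EuclideanSpace ℝ ι}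
    (hv : ∀ i, HasFDerivAt (v i) (v' i) x) :
    HasFDerivAt (fun y => volForm ι fun i => v i y)
      (∑ i, ((volForm ι).toContinuousLinearMap (fun j => v j x) i) ∘L (v' i)) x :=
  HasFDerivAt.multilinear_comp _ hv

open Classical in
/-- The divergence of `φ(h) · cof(Dh) k`: the Piola identity. -/
theorem sum_fderiv_volForm_update {h k : EuclideanSpace ℝ ι → EuclideanSpace ℝ ι}
    {φ : EuclideanSpace ℝ ι → ℝ} (hh : ContDiff ℝ ∞ h) (hk : ContDiff ℝ ∞ k)
    (hφ : ContDiff ℝ ∞ φ) (x : EuclideanSpace ℝ ι) :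
    ∑ i, fderiv ℝ (fun y => φ (h y) * volForm ι (Function.update (partials h y) i (k y))) x
        (EuclideanSpace.single i 1) =
      fderiv ℝ φ (h x) (k x) * volForm ι (partials h x) +
        φ (h x) * ∑ i, volForm ι (Function.update (partials h x) i (partials k x i)) := by
  have hdh : Differentiable ℝ h := hh.differentiable (by simp)
  have hdk : Differentiable ℝ k := hk.differentiable (by simp)
  have hdφ : Differentiable ℝ φ := hφ.differentiable (by simp)
  have hd2 : Differentiable ℝ (fderiv ℝ h) :=
    (hh.fderiv_right (m := 1) (by norm_cast)).differentiable (by simp)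
  let e : ι → EuclideanSpace ℝ ι := fun i => EuclideanSpace.single i 1
  let D2 : ι → ι → EuclideanSpace ℝ ι := fun i l => fderiv ℝ (fderiv ℝ h) x (e i) (e l)
  have hsymm : ∀ i l, D2 i l = D2 l i := fun i l =>
    (hh.contDiffAt.isSymmSndFDerivAt (by simp; norm_cast)) (e i) (e l)
  have hvol : ∀ i, HasFDerivAt (fun y => volForm ι (Function.update (partials h y) i (k y)))
      (∑ l, ((volForm ι).toContinuousLinearMap (Function.update (partials h x) i (k x)) l) ∘L
        (if l = i then fderiv ℝ k x else (fderiv ℝ (fderiv ℝ h) x).flip (e l))) x := by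
    intro i
    have hv : ∀ l, HasFDerivAt (fun y => Function.update (partials h y) i (k y) l)
        (if l = i then fderiv ℝ k x else (fderiv ℝ (fderiv ℝ h) x).flip (e l)) x := by
      intro l
      by_cases hl : l = i
      · subst hl
        simpa using (hdk x).hasFDerivAt
      · simp only [Function.update_of_ne hl, if_neg hl, partials]
        have := ((hd2 x).hasFDerivAt).clm_apply (hasFDerivAt_const (e l) x)
        refine this.congr_fderiv ?_
        ext v
        simp
    exact hasFDerivAt_volForm hv
  have hterm : ∀ i, fderiv ℝ (fun y => φ (h y) *
        volForm ι (Function.update (partials h y) i (k y))) x (e i) =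
      fderiv ℝ φ (h x) (partials h x i) * volForm ι (Function.update (partials h x) i (k x)) +
      φ (h x) * (volForm ι (Function.update (partials h x) i (partials k x i)) +
        ∑ l, if l = i then 0 else
          volForm ι (Function.update (Function.update (partials h x) i (k x)) l (D2 i l))) := by
    intro i
    have h1 : HasFDerivAt (fun y => φ (h y)) ((fderiv ℝ φ (h x)).comp (fderiv ℝ h x)) x :=
      (hdφ (h x)).hasFDerivAt.comp x (hdh x).hasFDerivAt
    rw [(h1.fun_mul (hvol i)).fderiv]
    simp only [add_apply, smul_apply, smul_eq_mul,
      sum_apply, ContinuousLinearMap.comp_apply,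
      ContinuousMultilinearMap.toContinuousLinearMap_apply]
    rw [add_comm]
    congr 1
    · rw [mul_comm]; rfl
    · congr 1
      rw [← Finset.add_sum_erase _ _ (Finset.mem_univ i),
        ← Finset.add_sum_erase _ _ (Finset.mem_univ i)]
      simp only [if_true, zero_add]
      congr 1
      · simp [partials, e]
      · refine Finset.sum_congr rfl fun l hl => ?_
        have hl : l ≠ i := by simpa using hl
        simp [hl, D2]
  rw [Finset.sum_congr rfl fun i _ => hterm i, Finset.sum_add_distrib,
    sum_apply_mul_volForm_update, ← Finset.mul_sum, Finset.sum_add_distrib]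
  suffices hz : ∑ i, ∑ l, (if l = i then 0 else
      volForm ι (Function.update (Function.update (partials h x) i (k x)) l (D2 i l))) = 0 by
    rw [hz, add_zero]
  set F : ι → ι → ℝ := fun i l => if l = i then 0 else
      volForm ι (Function.update (Function.update (partials h x) i (k x)) l (D2 i l)) with hF
  -- `F` collects the terms with second derivatives of `h`. Exchanging two columns changes the sign
  -- of the determinant while mixed derivatives are symmetric, so these terms cancel in pairs.
  have hanti : ∀ i l, F i l = - F l i := by
    intro i l
    by_cases hl : l = i
    · subst hl; simp [F]
    · simp only [hF, if_neg hl, if_neg (Ne.symm hl)]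
      rw [volForm_update_update_swap _ (Ne.symm hl), Function.update_comm (Ne.symm hl), hsymm]
  have h1 : ∑ i, ∑ l, F i l = - ∑ i, ∑ l, F i l := by
    conv_lhs => rw [Finset.sum_comm]
    rw [← Finset.sum_neg_distrib]
    refine Finset.sum_congr rfl fun i _ => ?_
    rw [← Finset.sum_neg_distrib]
    exact Finset.sum_congr rfl fun l _ => hanti l i
  linarith

-- The derivative in `t` is exactly the divergence found in `sum_fderiv_volForm_update` for h = g +
-- t k. This is what makes the degree integral constant along a homotopy.
open Classical in
theorem hasDerivAt_mul_volForm_partials {g k : EuclideanSpace ℝ ι → EuclideanSpace ℝ ι}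
    {φ : EuclideanSpace ℝ ι → ℝ} (hg : ContDiff ℝ ∞ g) (hk : ContDiff ℝ ∞ k)
    (hφ : ContDiff ℝ ∞ φ) (x : EuclideanSpace ℝ ι) (t : ℝ) :
    HasDerivAt (fun s : ℝ => φ (g x + s • k x) * volForm ι (partials (g + s • k) x))
      (fderiv ℝ φ (g x + t • k x) (k x) * volForm ι (partials (g + t • k) x) +
        φ (g x + t • k x) *
          ∑ i, volForm ι (Function.update (partials (g + t • k) x) i (partials k x i))) t := by
  have hdg : Differentiable ℝ g := hg.differentiable (by simp)
  have hdk : Differentiable ℝ k := hk.differentiable (by simp)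
  have hdφ : Differentiable ℝ φ := hφ.differentiable (by simp)
  have hpart : ∀ s : ℝ, partials (g + s • k) x = fun i => partials g x i + s • partials k x i := by
    intro s
    ext i : 1
    simp only [partials]
    rw [fderiv_add (hdg x) ((hdk x).const_smul s), fderiv_const_smul (hdk x)]
    rfl
  have hlin : ∀ a b : EuclideanSpace ℝ ι, HasDerivAt (fun s : ℝ => a + s • b) b t := by
    intro a b
    simpa using ((hasDerivAt_id t).smul_const b).const_add a
  have h1 : HasDerivAt (fun s : ℝ => φ (g x + s • k x)) (fderiv ℝ φ (g x + t • k x) (k x)) t :=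
    (hdφ _).hasFDerivAt.comp_hasDerivAt t (hlin _ _)
  have h2 : HasDerivAt (fun s : ℝ => volForm ι (partials (g + s • k) x))
      (∑ i, volForm ι (Function.update (partials (g + t • k) x) i (partials k x i))) t := by
    have := (HasFDerivAt.multilinear_comp (volForm ι)
      (g := fun i (s : ℝ) => partials g x i + s • partials k x i)
      (fun i => (hlin (partials g x i) (partials k x i)).hasFDerivAt)).hasDerivAt
    simp only [hpart]
    refine this.congr_deriv ?_
    simp
  exact h1.mul h2

end Divergence

/-! ### Invariance of the degree integral along affine homotopies. -/

section DegreeIntegral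

variable {ι : Type*} [Fintype ι]

theorem partials_add_smul {g k : EuclideanSpace ℝ ι → EuclideanSpace ℝ ι}
    (hg : ContDiff ℝ ∞ g) (hk : ContDiff ℝ ∞ k) (t : ℝ) (x : EuclideanSpace ℝ ι) :
    partials (g + t • k) x = fun i => partials g x i + t • partials k x i := by
  have hdg : Differentiable ℝ g := hg.differentiable (by simp)
  have hdk : Differentiable ℝ k := hk.differentiable (by simp)
  ext i : 1
  simp only [partials]
  rw [fderiv_add (hdg x) ((hdk x).const_smul t), fderiv_const_smul (hdk x)]
  rfl

theorem contDiff_partials {g : EuclideanSpace ℝ ι → EuclideanSpace ℝ ι} (hg : ContDiff ℝ ∞ g)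
    (i : ι) : ContDiff ℝ ∞ fun x => partials g x i := by
  simp only [partials]
  exact (hg.fderiv_right (m := ∞) (by simp)).clm_apply contDiff_const

theorem continuous_volForm_partials {g : EuclideanSpace ℝ ι → EuclideanSpace ℝ ι}
    (hg : ContDiff ℝ ∞ g) : Continuous fun x => volForm ι (partials g x) :=
  (volForm ι).cont.comp (continuous_pi fun i => (contDiff_partials hg i).continuous)

/-- The integral `∫ χ · φ(g) · det Dg`, which computes a degree when `φ` is concentrated
near `0`. -/
noncomputable def degreeIntegral (χ φ : EuclideanSpace ℝ ι → ℝ)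
    (g : EuclideanSpace ℝ ι → EuclideanSpace ℝ ι) : ℝ :=
  ∫ x, χ x * (φ (g x) * volForm ι (partials g x))

-- Differentiation under the integral sign yields the integral of χ times a divergence. Integration
-- by parts moves the derivative to χ, and `hz` makes the products ∂ᵢχ · φ(h) vanish.
open Classical in
theorem degreeIntegral_add_eq {χ φ : EuclideanSpace ℝ ι → ℝ}
    {g k : EuclideanSpace ℝ ι → EuclideanSpace ℝ ι} (hg : ContDiff ℝ ∞ g) (hk : ContDiff ℝ ∞ k)
    (hχ : ContDiff ℝ ∞ χ) (hφ : ContDiff ℝ ∞ φ) (hχc : HasCompactSupport χ)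
    (hz : ∀ t ∈ Icc (0 : ℝ) 1, ∀ x, φ (g x + t • k x) = 0 ∨ fderiv ℝ χ x = 0) :
    degreeIntegral χ φ (g + k) = degreeIntegral χ φ g := by
  let F : ℝ → EuclideanSpace ℝ ι → ℝ := fun t x =>
    χ x * (φ (g x + t • k x) * volForm ι (partials (g + t • k) x))
  let F' : ℝ → EuclideanSpace ℝ ι → ℝ := fun t x =>
    χ x * (fderiv ℝ φ (g x + t • k x) (k x) * volForm ι (partials (g + t • k) x) +
        φ (g x + t • k x) *
          ∑ i, volForm ι (Function.update (partials (g + t • k) x) i (partials k x i)))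
  have hpg : ∀ i, Continuous fun p : ℝ × EuclideanSpace ℝ ι => partials g p.2 i := fun i =>
    (contDiff_partials hg i).continuous.comp continuous_snd
  have hpk : ∀ i, Continuous fun p : ℝ × EuclideanSpace ℝ ι => partials k p.2 i := fun i =>
    (contDiff_partials hk i).continuous.comp continuous_snd
  have hgc := hg.continuous
  have hkc := hk.continuous
  have hχcont := hχ.continuous
  have hφc := hφ.continuous
  have hφ' : Continuous (fderiv ℝ φ) := hφ.continuous_fderiv (by simp)
  have hh : Continuous fun p : ℝ × EuclideanSpace ℝ ι => g p.2 + p.1 • k p.2 := by fun_prop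
  have hpart : Continuous fun p : ℝ × EuclideanSpace ℝ ι =>
      (fun i => partials g p.2 i + p.1 • partials k p.2 i : ι → EuclideanSpace ℝ ι) :=
    continuous_pi fun i => (hpg i).add (continuous_fst.smul (hpk i))
  have hF : Continuous (Function.uncurry F) := by
    simp only [F, Function.uncurry_def, partials_add_smul hg hk]
    exact (hχcont.comp continuous_snd).mul
      ((hφc.comp hh).mul ((volForm ι).cont.comp hpart))
  have hF' : Continuous (Function.uncurry F') := by
    simp only [F', Function.uncurry_def, partials_add_smul hg hk]
    refine (hχcont.comp continuous_snd).mul (Continuous.add ?_ ?_)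
    · exact ((hφ'.comp hh).clm_apply (hkc.comp continuous_snd)).mul ((volForm ι).cont.comp hpart)
    · refine (hφc.comp hh).mul (continuous_finsetSum _ fun i _ => ?_)
      exact (volForm ι).cont.comp (hpart.update i (hpk i))
  have hFx : ∀ t, Continuous (F t) := fun t => hF.comp (Continuous.prodMk_right t)
  have hF'x : ∀ t, Continuous (F' t) := fun t => hF'.comp (Continuous.prodMk_right t)
  have hderiv : ∀ t, HasDerivAt (fun t => ∫ x, F t x) (∫ x, F' t x) t := by
    intro t
    obtain ⟨C, hC⟩ := (isCompact_Icc (a := t - 1) (b := t + 1)).prod hχc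
      |>.exists_bound_of_continuousOn hF'.continuousOn
    refine (hasDerivAt_integral_of_dominated_loc_of_deriv_le
      (bound := (tsupport χ).indicator fun _ => C)
      (Icc_mem_nhds (by linarith : t - 1 < t) (by linarith : t < t + 1))
      (Eventually.of_forall fun s => (hFx s).aestronglyMeasurable)
      ((hFx t).integrable_of_hasCompactSupport hχc.mul_right)
      (hF'x t).aestronglyMeasurable ?_ ?_ ?_).2
    · refine Eventually.of_forall fun x s hs => ?_
      by_cases hx : x ∈ tsupport χ
      · rw [indicator_of_mem hx]
        exact hC (s, x) ⟨hs, hx⟩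
      · rw [indicator_of_notMem hx]
        simp [F', image_eq_zero_of_notMem_tsupport hx]
    · exact (MeasureTheory.integrable_indicator_iff (isClosed_tsupport χ).measurableSet).2
        (MeasureTheory.integrableOn_const hχc.measure_lt_top.ne)
    · refine Eventually.of_forall fun x s _ => ?_
      exact (hasDerivAt_mul_volForm_partials hg hk hφ x s).const_mul (χ x)
  have hzero : ∀ t ∈ Icc (0 : ℝ) 1, ∫ x, F' t x = 0 := by
    intro t ht
    have hht : ContDiff ℝ ∞ (g + t • k) := hg.add (hk.const_smul t)
    -- The vector field with components `W i` is φ(h) cof(Dh) k; its divergence is the integrand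
    -- without χ.
    let W : ι → EuclideanSpace ℝ ι → ℝ := fun i y => φ ((g + t • k) y) *
      volForm ι (Function.update (partials (g + t • k) y) i (k y))
    have hW : ∀ i, ContDiff ℝ ∞ (W i) := by
      intro i
      refine (hφ.comp hht).mul ((volForm ι).contDiff.comp (contDiff_pi.2 fun l => ?_))
      by_cases hl : l = i
      · subst hl; simpa using hk
      · simpa [hl] using contDiff_partials hht l
    have hFW : F' t = fun x => ∑ i, χ x * fderiv ℝ (W i) x (EuclideanSpace.single i 1) := by
      ext x
      rw [← Finset.mul_sum, sum_fderiv_volForm_update hht hk hφ x]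
      rfl
    have hWc : ∀ i, Continuous fun x => fderiv ℝ (W i) x (EuclideanSpace.single i 1) :=
      fun i => ((hW i).continuous_fderiv (by simp)).clm_apply continuous_const
    have hint : ∀ i, MeasureTheory.Integrable
        (fun x => χ x * fderiv ℝ (W i) x (EuclideanSpace.single i 1)) := fun i =>
      (hχcont.mul (hWc i)).integrable_of_hasCompactSupport hχc.mul_right
    simp only [hFW]
    rw [MeasureTheory.integral_finsetSum _ fun i _ => hint i]
    refine Finset.sum_eq_zero fun i _ => ?_
    have hχ0 : ∀ x, fderiv ℝ χ x (EuclideanSpace.single i 1) * W i x = 0 := by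
      intro x
      rcases hz t ht x with h | h
      · have : W i x = 0 := by simp [W, h]
        rw [this, mul_zero]
      · simp [h]
    rw [integral_mul_fderiv_eq_neg_fderiv_mul_of_integrable]
    · simp [hχ0]
    · simp [hχ0]
    · exact hint i
    · exact (hχcont.mul (hW i).continuous).integrable_of_hasCompactSupport hχc.mul_right
    · exact fun x _ => hχ.differentiable (by simp) x
    · exact fun x _ => (hW i).differentiable (by simp) x
  have hconst := constant_of_has_deriv_right_zero (a := 0) (b := 1)
    (f := fun t => ∫ x, F t x) (fun t _ => (hderiv t).continuousAt.continuousWithinAt)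
    (fun t ht => by
      have := (hderiv t).hasDerivWithinAt (s := Ici t)
      rwa [hzero t (Ico_subset_Icc_self ht)] at this) 1 (by simp)
  simpa [F, degreeIntegral] using hconst

end DegreeIntegral

/-! ### The degree integral counts regular zeros with sign. -/

section Counting

variable {ι : Type*} [Fintype ι]

theorem exists_isOpen_injOn_of_det_ne_zero {g : EuclideanSpace ℝ ι → EuclideanSpace ℝ ι}
    (hg : ContDiff ℝ ∞ g) {x : EuclideanSpace ℝ ι} (hx : (fderiv ℝ g x).det ≠ 0) :
    ∃ U, IsOpen U ∧ x ∈ U ∧ InjOn g U ∧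
      ∀ y ∈ U, SignType.sign (fderiv ℝ g y).det = SignType.sign (fderiv ℝ g x).det := by
  let e := (fderiv ℝ g x).toContinuousLinearEquivOfDetNeZero hx
  have hd : HasStrictFDerivAt g (e : EuclideanSpace ℝ ι →L[ℝ] EuclideanSpace ℝ ι) x :=
    hg.contDiffAt.hasStrictFDerivAt (by simp)
  have hcont : Continuous fun y => (fderiv ℝ g y).det := by
    simpa only [← volForm_partials] using continuous_volForm_partials hg
  have hsign : ∀ᶠ y in 𝓝 x, SignType.sign (fderiv ℝ g y).det = SignType.sign (fderiv ℝ g x).det :=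
    hcont.continuousAt ((continuousAt_sign_of_ne_zero hx).eventually
      (p := fun s => s = SignType.sign (fderiv ℝ g x).det) (by simp [nhds_discrete]))
  obtain ⟨V, hV, hVo, hxV⟩ := eventually_nhds_iff.1 hsign
  let P := hd.toOpenPartialHomeomorph g
  exact ⟨P.source ∩ V, P.open_source.inter hVo, ⟨hd.mem_toOpenPartialHomeomorph_source, hxV⟩,
    P.injOn.mono inter_subset_left, fun y hy => hV y hy.2⟩

theorem image_mem_nhds_of_det_ne_zero {g : EuclideanSpace ℝ ι → EuclideanSpace ℝ ι}
    (hg : ContDiff ℝ ∞ g) {x : EuclideanSpace ℝ ι} (hx : (fderiv ℝ g x).det ≠ 0)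
    {U : Set (EuclideanSpace ℝ ι)} (hU : U ∈ 𝓝 x) : g '' U ∈ 𝓝 (g x) := by
  let e := (fderiv ℝ g x).toContinuousLinearEquivOfDetNeZero hx
  have hd : HasStrictFDerivAt g (e : EuclideanSpace ℝ ι →L[ℝ] EuclideanSpace ℝ ι) x :=
    hg.contDiffAt.hasStrictFDerivAt (by simp)
  rw [← hd.map_nhds_eq_of_equiv]
  exact image_mem_map hU

theorem finite_zeros_of_regular {g : EuclideanSpace ℝ ι → EuclideanSpace ℝ ι}
    (hg : ContDiff ℝ ∞ g) {K : Set (EuclideanSpace ℝ ι)} (hK : IsCompact K)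
    (hreg : ∀ x ∈ K, g x = 0 → (fderiv ℝ g x).det ≠ 0) : {x | x ∈ K ∧ g x = 0}.Finite := by
  have hZ : IsCompact {x | x ∈ K ∧ g x = 0} :=
    hK.inter_right (isClosed_singleton.preimage hg.continuous)
  have hloc : ∀ x ∈ {x | x ∈ K ∧ g x = 0}, ∃ U ∈ 𝓝 x, InjOn g U ∧ x ∈ U := by
    intro x hx
    obtain ⟨U, hU, hxU, hinj, -⟩ := exists_isOpen_injOn_of_det_ne_zero hg (hreg x hx.1 hx.2)
    exact ⟨U, hU.mem_nhds hxU, hinj, hxU⟩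
  choose! U hU hinj hmem using hloc
  obtain ⟨t, ht, hcov⟩ := hZ.elim_nhds_subcover U hU
  refine t.finite_toSet.subset fun x hx => ?_
  obtain ⟨y, hy, hxy⟩ := mem_iUnion₂.1 (hcov hx)
  have hyZ := ht y hy
  have : x = y := hinj y hyZ hxy (hmem y hyZ) (hx.2.trans hyZ.2.symm)
  exact this ▸ hy

/-- If φ is concentrated near 0, the integrand lives in disjoint neighbourhoods of the zeros, where
χ = 1, `g` is injective and the Jacobian has constant sign. The change of variables turns each piece
into that sign times ∫ φ = 1. -/
theorem exists_degreeIntegral_eq_signedZeroCount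
    {g : EuclideanSpace ℝ ι → EuclideanSpace ℝ ι} (hg : ContDiff ℝ ∞ g)
    {x₀ : EuclideanSpace ℝ ι} {r r' : ℝ} (hr : r' < r)
    (hreg : ∀ x ∈ Metric.closedBall x₀ r, g x = 0 → (fderiv ℝ g x).det ≠ 0)
    (hz : ∀ x ∈ Metric.closedBall x₀ r, g x = 0 → x ∈ Metric.ball x₀ r')
    {χ : EuclideanSpace ℝ ι → ℝ} (hχ₁ : ∀ x ∈ Metric.ball x₀ r', χ x = 1)
    (hχ₀ : ∀ x ∉ Metric.closedBall x₀ r, χ x = 0) :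
    ∃ ε₀ > 0, ∀ φ : EuclideanSpace ℝ ι → ℝ, Continuous φ → (∀ y, ε₀ ≤ ‖y‖ → φ y = 0) →
      ∫ y, φ y = 1 → degreeIntegral χ φ g = signedZeroCount g x₀ r := by
  classical
  set Z := {x | x ∈ Metric.closedBall x₀ r ∧ g x = 0} with hZdef
  have hZfin : Z.Finite := finite_zeros_of_regular hg (isCompact_closedBall x₀ r) hreg
  have hZ' : {x | x ∈ Metric.ball x₀ r ∧ g x = 0} = Z := by
    ext x
    exact ⟨fun h => ⟨Metric.ball_subset_closedBall h.1, h.2⟩,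
      fun h => ⟨Metric.ball_subset_ball hr.le (hz x h.1 h.2), h.2⟩⟩
  obtain ⟨S, hS, hSdisj⟩ := hZfin.t2_separation
  have hloc : ∀ x ∈ Z, ∃ U, IsOpen U ∧ x ∈ U ∧ U ⊆ S x ∩ Metric.ball x₀ r' ∧ InjOn g U ∧
      ∀ y ∈ U, SignType.sign (fderiv ℝ g y).det = SignType.sign (fderiv ℝ g x).det := by
    intro x hx
    obtain ⟨U, hU, hxU, hinj, hsign⟩ := exists_isOpen_injOn_of_det_ne_zero hg (hreg x hx.1 hx.2)
    refine ⟨U ∩ (S x ∩ Metric.ball x₀ r'), hU.inter ((hS x).2.inter Metric.isOpen_ball),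
      ⟨hxU, (hS x).1, hz x hx.1 hx.2⟩, inter_subset_right, hinj.mono inter_subset_left,
      fun y hy => hsign y hy.1⟩
  choose! U hUo hxU hUS hUinj hUsign using hloc
  have hK : IsCompact (Metric.closedBall x₀ r \ ⋃ x ∈ Z, U x) :=
    (isCompact_closedBall x₀ r).diff (isOpen_biUnion hUo)
  -- Below `ε₁`, no point of the ball outside the chosen neighbourhoods is mapped to where φ ≠ 0.
  have hε₁ : ∃ ε₁ > 0, ∀ x ∈ Metric.closedBall x₀ r \ ⋃ x ∈ Z, U x, ε₁ ≤ ‖g x‖ := by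
    rcases (Metric.closedBall x₀ r \ ⋃ x ∈ Z, U x).eq_empty_or_nonempty with he | hne
    · exact ⟨1, one_pos, by simp [he]⟩
    · obtain ⟨y, hy, hmin⟩ := hK.exists_isMinOn hne hg.continuous.norm.continuousOn
      refine ⟨‖g y‖, norm_pos_iff.2 fun h0 => hy.2 ?_, fun x hx => hmin hx⟩
      exact mem_biUnion (⟨hy.1, h0⟩ : y ∈ Z) (hxU y ⟨hy.1, h0⟩)
  obtain ⟨ε₁, hε₁, hmin⟩ := hε₁
  -- Below `ε₂`, the image of each neighbourhood contains all points where φ ≠ 0, so each zero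
  -- receives the full integral of φ.
  have hε₂ : ∃ ε₂ > 0, ∀ x ∈ Z, Metric.ball (0 : EuclideanSpace ℝ ι) ε₂ ⊆ g '' U x := by
    have h1 : ⋂ x ∈ Z, g '' U x ∈ 𝓝 (0 : EuclideanSpace ℝ ι) := by
      refine (biInter_mem hZfin).2 fun x hx => ?_
      have := image_mem_nhds_of_det_ne_zero hg (hreg x hx.1 hx.2) ((hUo x hx).mem_nhds (hxU x hx))
      rwa [hx.2] at this
    obtain ⟨ε₂, h, hsub⟩ := Metric.mem_nhds_iff.1 h1
    exact ⟨ε₂, h, fun x hx => hsub.trans (biInter_subset_of_mem hx)⟩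
  obtain ⟨ε₂, hε₂, himg⟩ := hε₂
  refine ⟨min ε₁ ε₂, lt_min hε₁ hε₂, fun φ hφ hφ0 hφ1 => ?_⟩
  let f : EuclideanSpace ℝ ι → ℝ := fun x => χ x * (φ (g x) * volForm ι (partials g x))
  have hf : ∀ x ∉ ⋃ z ∈ hZfin.toFinset, U z, f x = 0 := by
    intro x hx
    by_cases hxr : x ∈ Metric.closedBall x₀ r
    · have : ε₁ ≤ ‖g x‖ := hmin x ⟨hxr, by simpa using hx⟩
      simp [f, hφ0 _ ((min_le_left _ _).trans this)]
    · simp [f, hχ₀ x hxr]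
  have hpiece : ∀ z ∈ Z, (∫ x in U z, f x) = (SignType.sign (fderiv ℝ g z).det : ℝ) ∧
      MeasureTheory.IntegrableOn f (U z) := by
    intro z hzZ
    have hd : ∀ x ∈ U z, HasFDerivWithinAt g (fderiv ℝ g x) (U z) x := fun x _ =>
      (hg.differentiable (by simp) x).hasFDerivAt.hasFDerivWithinAt
    have hmeas := (hUo z hzZ).measurableSet
    have heq : ∀ x ∈ U z, f x = (SignType.sign (fderiv ℝ g z).det : ℝ) *
        (|(fderiv ℝ g x).det| • φ (g x)) := by
      intro x hx
      simp only [f, hχ₁ x (hUS z hzZ hx).2, volForm_partials, smul_eq_mul, one_mul]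
      rw [← hUsign z hzZ x hx, mul_comm (φ _), ← mul_assoc, sign_mul_abs]
    have hφint : MeasureTheory.Integrable φ := hφ.integrable_of_hasCompactSupport
      (HasCompactSupport.intro (isCompact_closedBall 0 (min ε₁ ε₂)) fun y hy =>
        hφ0 y (by rw [mem_closedBall_zero_iff, not_le] at hy; exact hy.le))
    constructor
    · rw [MeasureTheory.setIntegral_congr_fun hmeas heq, MeasureTheory.integral_const_mul,
        ← MeasureTheory.integral_image_eq_integral_abs_det_fderiv_smul _ hmeas hd (hUinj z hzZ),
        MeasureTheory.setIntegral_eq_integral_of_forall_compl_eq_zero, hφ1, mul_one]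
      intro y hy
      refine hφ0 y ((min_le_right _ _).trans ?_)
      by_contra hlt
      exact hy (himg z hzZ (by simpa using hlt))
    · rw [MeasureTheory.integrableOn_congr_fun heq hmeas]
      refine MeasureTheory.Integrable.const_mul ?_ _
      exact (MeasureTheory.integrableOn_image_iff_integrableOn_abs_det_fderiv_smul _ hmeas hd
        (hUinj z hzZ) φ).1 hφint.integrableOn
  have hmemZ : ∀ {z}, z ∈ hZfin.toFinset → z ∈ Z := fun h => by simpa using h
  have h1 : degreeIntegral χ φ g = ∑ z ∈ hZfin.toFinset, ∫ x in U z, f x := by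
    rw [← MeasureTheory.integral_biUnion_finset _
      (fun z hz => (hUo z (hmemZ hz)).measurableSet) ?_ fun z hz => (hpiece z (hmemZ hz)).2,
      MeasureTheory.setIntegral_eq_integral_of_forall_compl_eq_zero hf]
    · rfl
    · intro a ha b hb hab
      exact (hSdisj (hmemZ ha) (hmemZ hb) hab).mono
        ((hUS a (hmemZ ha)).trans inter_subset_left) ((hUS b (hmemZ hb)).trans inter_subset_left)
  rw [h1, signedZeroCount, hZ', finsum_mem_eq_finite_toFinset_sum _ hZfin, Int.cast_sum]
  exact Finset.sum_congr rfl fun z hz => by rw [(hpiece z (hmemZ hz)).1]; simp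

end Counting

/-! ### Homotopy invariance and well-definedness of the Brouwer index. -/

section BrouwerIndex

variable {ι : Type*} [Fintype ι]

theorem IsCompact.exists_pos_le_norm {X F : Type*} [TopologicalSpace X] [NormedAddCommGroup F]
    {K : Set X} (hK : IsCompact K) {f : X → F} (hf : ContinuousOn f K) (h0 : ∀ x ∈ K, f x ≠ 0) :
    ∃ ε > 0, ∀ x ∈ K, ε ≤ ‖f x‖ := by
  rcases K.eq_empty_or_nonempty with rfl | hne
  · exact ⟨1, one_pos, by simp⟩
  · obtain ⟨y, hy, hmin⟩ := hK.exists_isMinOn hne hf.norm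
    exact ⟨‖f y‖, norm_pos_iff.2 (h0 y hy), fun x hx => hmin hx⟩

theorem IsCompact.exists_pos_lt_forall_lt {X : Type*} [TopologicalSpace X] {K : Set X}
    (hK : IsCompact K) {r : ℝ} (hr : 0 < r) {f : X → ℝ} (hf : ContinuousOn f K)
    (hlt : ∀ x ∈ K, f x < r) : ∃ r', 0 < r' ∧ r' < r ∧ ∀ x ∈ K, f x < r' := by
  rcases K.eq_empty_or_nonempty with rfl | hne
  · exact ⟨r / 2, by linarith, by linarith, by simp⟩
  · obtain ⟨y, hy, hmax⟩ := hK.exists_isMaxOn hne hf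
    have h1 := hlt y hy
    have h2 : f y < (max 0 (f y) + r) / 2 := by
      have := le_max_right 0 (f y)
      linarith
    have h3 : max 0 (f y) < r := max_lt hr h1
    have h4 := le_max_left 0 (f y)
    exact ⟨(max 0 (f y) + r) / 2, by linarith, by linarith,
      fun x hx => (isMaxOn_iff.1 hmax x hx).trans_lt h2⟩

/-- Both counts are values of one degree integral at the ends of the homotopy. By compactness all
zeros of the homotopy stay in a smaller ball; χ is 1 there, and in the annulus where χ varies the
homotopy stays away from the support of φ. -/
theorem signedZeroCount_eq_of_segment {g₀ g₁ : EuclideanSpace ℝ ι → EuclideanSpace ℝ ι}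
    (hg₀ : ContDiff ℝ ∞ g₀) (hg₁ : ContDiff ℝ ∞ g₁) {x₀ : EuclideanSpace ℝ ι} {r : ℝ} (hr : 0 < r)
    (hreg₀ : ∀ x ∈ Metric.closedBall x₀ r, g₀ x = 0 → (fderiv ℝ g₀ x).det ≠ 0)
    (hreg₁ : ∀ x ∈ Metric.closedBall x₀ r, g₁ x = 0 → (fderiv ℝ g₁ x).det ≠ 0)
    (hseg : ∀ t ∈ Icc (0 : ℝ) 1, ∀ x ∈ Metric.sphere x₀ r, g₀ x + t • (g₁ x - g₀ x) ≠ 0) :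
    signedZeroCount g₀ x₀ r = signedZeroCount g₁ x₀ r := by
  let h : ℝ × EuclideanSpace ℝ ι → EuclideanSpace ℝ ι := fun p => g₀ p.2 + p.1 • (g₁ p.2 - g₀ p.2)
  have hc₀ := hg₀.continuous
  have hc₁ := hg₁.continuous
  have hh : Continuous h := by fun_prop
  have hr' : ∃ r', 0 < r' ∧ r' < r ∧ ∀ t ∈ Icc (0 : ℝ) 1, ∀ x ∈ Metric.closedBall x₀ r,
      h (t, x) = 0 → x ∈ Metric.ball x₀ r' := by
    have hZ : IsCompact ((Icc (0 : ℝ) 1 ×ˢ Metric.closedBall x₀ r) ∩ h ⁻¹' {0}) :=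
      (isCompact_Icc.prod (isCompact_closedBall x₀ r)).inter_right (isClosed_singleton.preimage hh)
    obtain ⟨r', h1, h2, h3⟩ := hZ.exists_pos_lt_forall_lt hr (f := fun p => dist p.2 x₀)
      (by fun_prop) fun p hp => lt_of_le_of_ne hp.1.2 fun heq => hseg p.1 hp.1.1 p.2 heq hp.2
    exact ⟨r', h1, h2, fun t ht x hx h0 => h3 (t, x) ⟨⟨ht, hx⟩, h0⟩⟩
  obtain ⟨r', hr'0, hr'r, hzero⟩ := hr'
  obtain ⟨ε₁, hε₁, hmin⟩ := ((isCompact_Icc (a := (0 : ℝ)) (b := 1)).prod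
    ((isCompact_closedBall x₀ r).diff Metric.isOpen_ball)).exists_pos_le_norm
    (f := h) (K := Icc (0 : ℝ) 1 ×ˢ (Metric.closedBall x₀ r \ Metric.ball x₀ r'))
    hh.continuousOn fun p hp h0 => hp.2.2 (hzero p.1 hp.1 p.2 hp.2.1 h0)
  let χ : ContDiffBump x₀ := ⟨r', r, hr'0, hr'r⟩
  have hχ₁ : ∀ x ∈ Metric.ball x₀ r', χ x = 1 := fun x hx =>
    χ.one_of_mem_closedBall (Metric.ball_subset_closedBall hx)
  have hχ₀ : ∀ x ∉ Metric.closedBall x₀ r, χ x = 0 := fun x hx =>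
    χ.zero_of_le_dist (not_le.1 hx).le
  obtain ⟨εa, hεa, ha⟩ := exists_degreeIntegral_eq_signedZeroCount hg₀ hr'r hreg₀
    (fun x hx h0 => hzero 0 (by simp) x hx (by simp [h, h0])) hχ₁ hχ₀
  obtain ⟨εb, hεb, hb⟩ := exists_degreeIntegral_eq_signedZeroCount hg₁ hr'r hreg₁
    (fun x hx h0 => hzero 1 (by simp) x hx (by simp [h, h0])) hχ₁ hχ₀
  have hε : 0 < min ε₁ (min εa εb) := lt_min hε₁ (lt_min hεa hεb)
  -- One φ has to serve three purposes: vanish on the image of the annulus (`ε₁`) and count the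
  -- zeros of `g₀` (`εa`) and of `g₁` (`εb`).
  let ψ : ContDiffBump (0 : EuclideanSpace ℝ ι) := ⟨min ε₁ (min εa εb) / 2, min ε₁ (min εa εb),
    by linarith, by linarith⟩
  let φ := ψ.normed MeasureTheory.volume
  have hφ : ContDiff ℝ ∞ φ := ψ.contDiff_normed
  have hφ0 : ∀ y, min ε₁ (min εa εb) ≤ ‖y‖ → φ y = 0 := by
    intro y hy
    have : y ∉ Function.support φ := by
      rw [ψ.support_normed_eq]
      rw [mem_ball_zero_iff, not_lt]
      exact hy
    simpa using this
  have hφ1 : ∫ y, φ y = 1 := ψ.integral_normed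
  have h₀ := ha φ hφ.continuous
    (fun y hy => hφ0 y (((min_le_right _ _).trans (min_le_left _ _)).trans hy)) hφ1
  have h₁ := hb φ hφ.continuous
    (fun y hy => hφ0 y (((min_le_right _ _).trans (min_le_right _ _)).trans hy)) hφ1
  have hinv := degreeIntegral_add_eq hg₀ (hg₁.sub hg₀) χ.contDiff hφ χ.hasCompactSupport
    (fun t ht x => by
      by_cases hx : x ∈ Metric.ball x₀ r'
      · right
        have : (χ : EuclideanSpace ℝ ι → ℝ) =ᶠ[𝓝 x] fun _ => 1 := χ.eventuallyEq_one_of_mem_ball hx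
        rw [this.fderiv_eq, fderiv_fun_const, Pi.zero_apply]
      by_cases hx' : x ∈ Metric.closedBall x₀ r
      · left
        exact hφ0 _ ((min_le_left _ _).trans (hmin (t, x) ⟨ht, hx', hx⟩))
      · right
        have : (χ : EuclideanSpace ℝ ι → ℝ) =ᶠ[𝓝 x] fun _ => 0 := by
          filter_upwards [Metric.isClosed_closedBall.isOpen_compl.mem_nhds hx'] with y hy
          exact hχ₀ y hy
        rw [this.fderiv_eq, fderiv_fun_const, Pi.zero_apply])
  have hadd : (g₀ + fun x => g₁ x - g₀ x) = g₁ := add_sub_cancel g₀ g₁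
  rw [hadd, h₀, h₁] at hinv
  exact_mod_cast hinv.symm

/-- A continuous map on a compact set is approximated by smooth maps with regular zeros
(Sard's theorem). -/
theorem exists_smooth_regular_approx {f : EuclideanSpace ℝ ι → EuclideanSpace ℝ ι}
    {K : Set (EuclideanSpace ℝ ι)} (hK : IsCompact K) (hf : ContinuousOn f K) {η : ℝ}
    (hη : 0 < η) : ∃ g : EuclideanSpace ℝ ι → EuclideanSpace ℝ ι, ContDiff ℝ ∞ g ∧
      (∀ x ∈ K, ‖g x - f x‖ < η) ∧ ∀ x, g x = 0 → (fderiv ℝ g x).det ≠ 0 := by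
  -- Tietze extension to the whole space, followed by smoothing with error η/2.
  obtain ⟨F, hF⟩ := ContinuousMap.exists_restrict_eq hK.isClosed ⟨K.domRestrict f, hf.domRestrict⟩
  have hFf : ∀ x ∈ K, F x = f x := fun x hx => by
    have := congrArg (fun G => G ⟨x, hx⟩) hF
    simpa using this
  obtain ⟨g, hg, hgF, -⟩ := F.continuous.exists_contDiff_approx (⊤ : ℕ∞)
    (ε := fun _ => η / 2) continuous_const fun _ => by linarith
  have hsard : MeasureTheory.volume (g '' {x | (fderiv ℝ g x).det = 0}) = 0 :=
    MeasureTheory.addHaar_image_eq_zero_of_det_fderivWithin_eq_zero _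
      (fun x _ => (hg.differentiable (by simp) x).hasFDerivAt.hasFDerivWithinAt) fun x hx => hx
  -- The critical values form a null set, so some `y` of norm below η/2 is regular; subtracting it
  -- from `g` makes 0 a regular value.
  have hy : ∃ y ∈ Metric.ball (0 : EuclideanSpace ℝ ι) (η / 2),
      y ∉ g '' {x | (fderiv ℝ g x).det = 0} := by
    by_contra! hcon
    have hle := MeasureTheory.measure_mono (μ := MeasureTheory.volume) hcon
    rw [hsard] at hle
    exact absurd (Metric.measure_ball_pos MeasureTheory.volume (0 : EuclideanSpace ℝ ι)
      (by linarith : 0 < η / 2)) (not_lt.2 hle)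
  obtain ⟨y, hyb, hy⟩ := hy
  refine ⟨fun x => g x - y, hg.sub contDiff_const, fun x hx => ?_, fun x h0 hdet => hy ?_⟩
  · have h1 := hgF x
    rw [dist_eq_norm, hFf x hx] at h1
    have h2 : ‖y‖ < η / 2 := by simpa using hyb
    calc ‖g x - y - f x‖ = ‖(g x - f x) - y‖ := by congr 1; abel
      _ ≤ ‖g x - f x‖ + ‖y‖ := norm_sub_le _ _
      _ < η := by linarith
  · rw [fderiv_sub_const] at hdet
    exact ⟨x, hdet, sub_eq_zero.1 h0⟩

/-- On the sphere both approximations take values in the open ball of radius ‖f x‖ around f x, which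
is convex and omits 0. -/
theorem IsRegularApprox.signedZeroCount_eq {f g₀ g₁ : EuclideanSpace ℝ ι → EuclideanSpace ℝ ι}
    {x₀ : EuclideanSpace ℝ ι} {r : ℝ} (hr : 0 < r) (h₀ : IsRegularApprox f x₀ r g₀)
    (h₁ : IsRegularApprox f x₀ r g₁) : signedZeroCount g₀ x₀ r = signedZeroCount g₁ x₀ r := by
  refine signedZeroCount_eq_of_segment h₀.smooth h₁.smooth hr h₀.regular h₁.regular
    fun t ht x hx h => ?_
  have hmem := (convex_ball (f x) ‖f x‖).add_smul_sub_mem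
    (mem_ball_iff_norm.2 (h₀.close x hx)) (mem_ball_iff_norm.2 (h₁.close x hx)) ht
  rw [h] at hmem
  simp at hmem

theorem signedZeroCount_congr_radius {g : EuclideanSpace ℝ ι → EuclideanSpace ℝ ι}
    {x₀ : EuclideanSpace ℝ ι} {r R : ℝ} (hrR : r ≤ R)
    (h : ∀ x ∈ Metric.ball x₀ R, g x = 0 → x ∈ Metric.ball x₀ r) :
    signedZeroCount g x₀ r = signedZeroCount g x₀ R := by
  have : {x | x ∈ Metric.ball x₀ r ∧ g x = 0} = {x | x ∈ Metric.ball x₀ R ∧ g x = 0} := by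
    ext x
    exact ⟨fun hx => ⟨Metric.ball_subset_ball hrR hx.1, hx.2⟩, fun hx => ⟨h x hx.1 hx.2, hx.2⟩⟩
  rw [signedZeroCount, this, signedZeroCount]

/-- Confines the zeros of an approximation to the inner ball: in the annulus the error is too small
to cancel `f`. -/
theorem norm_sub_lt_of_annulus {f g : EuclideanSpace ℝ ι → EuclideanSpace ℝ ι}
    {x₀ : EuclideanSpace ℝ ι} {r R η : ℝ}
    (hη : ∀ x ∈ Metric.closedBall x₀ R \ Metric.ball x₀ r, η ≤ ‖f x‖)
    (hg : ∀ x ∈ Metric.closedBall x₀ R, ‖g x - f x‖ < η) :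
    ∀ x ∈ Metric.closedBall x₀ R, g x = 0 → x ∈ Metric.ball x₀ r := by
  intro x hx h0
  by_contra hxr
  have h1 := hg x hx
  rw [h0, zero_sub, norm_neg] at h1
  exact absurd h1 (not_lt.2 (hη x ⟨hx, hxr⟩))

/-- The Brouwer index of an isolated zero is computed on every ball that contains no other zero. -/
theorem signedZeroCount_eq_brouwerIndex {f : EuclideanSpace ℝ ι → EuclideanSpace ℝ ι}
    {x₀ : EuclideanSpace ℝ ι} {R : ℝ} (hf : ContinuousOn f (Metric.closedBall x₀ R))
    (hz : ∀ x ∈ Metric.closedBall x₀ R, f x = 0 → x = x₀) {r : ℝ} (hr : 0 < r) (hrR : r ≤ R)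
    {g : EuclideanSpace ℝ ι → EuclideanSpace ℝ ι} (hg : IsRegularApprox f x₀ r g) :
    signedZeroCount g x₀ r = brouwerIndex x₀ f := by
  have hR : 0 < R := hr.trans_le hrR
  -- One approximation serves both radii: its error is below the minimum of ‖f‖ on the annulus
  -- between the spheres, so none of its zeros lies there.
  have key : ∀ r, 0 < r → r ≤ R → ∃ g, IsRegularApprox f x₀ r g ∧ IsRegularApprox f x₀ R g ∧
      signedZeroCount g x₀ r = signedZeroCount g x₀ R := by
    intro r hr hrR
    obtain ⟨η, hη, hmin⟩ := ((isCompact_closedBall x₀ R).diff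
      (Metric.isOpen_ball (x := x₀) (ε := r))).exists_pos_le_norm (hf.mono sdiff_subset)
      fun x hx h0 => hx.2 (by rw [hz x hx.1 h0]; exact Metric.mem_ball_self hr)
    obtain ⟨g, hg, hgf, hreg⟩ := exists_smooth_regular_approx (isCompact_closedBall x₀ R) hf hη
    refine ⟨g, ⟨hg, fun x hx => ?_, fun x _ => hreg x⟩, ⟨hg, fun x hx => ?_, fun x _ => hreg x⟩,
      signedZeroCount_congr_radius hrR fun x hx =>
        norm_sub_lt_of_annulus hmin hgf x (Metric.ball_subset_closedBall hx)⟩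
    · have hx' : x ∈ Metric.closedBall x₀ R :=
        Metric.closedBall_subset_closedBall hrR (Metric.sphere_subset_closedBall hx)
      exact (hgf x hx').trans_le (hmin x ⟨hx', fun h => h.ne hx⟩)
    · exact (hgf x (Metric.sphere_subset_closedBall hx)).trans_le
        (hmin x ⟨Metric.sphere_subset_closedBall hx, fun h => (h.trans_le hrR).ne hx⟩)
  obtain ⟨gR, hgR, -, -⟩ := key R hR le_rfl
  have hall : ∀ r, 0 < r → r ≤ R → ∀ g, IsRegularApprox f x₀ r g →
      signedZeroCount g x₀ r = signedZeroCount gR x₀ R := by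
    intro r hr hrR g hg
    obtain ⟨g', h1, h2, h3⟩ := key r hr hrR
    rw [hg.signedZeroCount_eq hr h1, h3, h2.signedZeroCount_eq hR hgR]
  have hidx : HasBrouwerIndex x₀ f (signedZeroCount gR x₀ R) := by
    filter_upwards [Ioc_mem_nhdsGT hR] with r hr
    obtain ⟨g', h1, -, -⟩ := key r hr.1 hr.2
    exact ⟨⟨g', h1⟩, hall r hr.1 hr.2⟩
  rw [hidx.brouwerIndex_eq]
  exact hall r hr hrR g hg

/-- The homotopy is bounded away from 0 on the sphere by some η. Smooth approximations of both ends
within η are joined by a segment that still avoids 0 there, so the smooth case applies. -/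
theorem brouwerIndex_eq_of_segment {f₀ f₁ : EuclideanSpace ℝ ι → EuclideanSpace ℝ ι}
    {x₀ : EuclideanSpace ℝ ι} {R : ℝ} (hR : 0 < R)
    (hf₀ : ContinuousOn f₀ (Metric.closedBall x₀ R))
    (hf₁ : ContinuousOn f₁ (Metric.closedBall x₀ R))
    (hz : ∀ t ∈ Icc (0 : ℝ) 1, ∀ x ∈ Metric.closedBall x₀ R,
      f₀ x + t • (f₁ x - f₀ x) = 0 → x = x₀) :
    brouwerIndex x₀ f₀ = brouwerIndex x₀ f₁ := by
  have hsub : Metric.sphere x₀ R ⊆ Metric.closedBall x₀ R := Metric.sphere_subset_closedBall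
  have hz₀ : ∀ x ∈ Metric.closedBall x₀ R, f₀ x = 0 → x = x₀ := fun x hx h =>
    hz 0 (by simp) x hx (by simpa using h)
  have hz₁ : ∀ x ∈ Metric.closedBall x₀ R, f₁ x = 0 → x = x₀ := fun x hx h =>
    hz 1 (by simp) x hx (by simpa using h)
  have hmaps : MapsTo Prod.snd (Icc (0 : ℝ) 1 ×ˢ Metric.sphere x₀ R) (Metric.closedBall x₀ R) :=
    fun p hp => hsub hp.2
  obtain ⟨η, hη, hmin⟩ := ((isCompact_Icc (a := (0 : ℝ)) (b := 1)).prod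
    (isCompact_sphere x₀ R)).exists_pos_le_norm
    (f := fun p : ℝ × EuclideanSpace ℝ ι => f₀ p.2 + p.1 • (f₁ p.2 - f₀ p.2))
    (by
      have h0 := hf₀.comp continuousOn_snd hmaps
      have h1 := hf₁.comp continuousOn_snd hmaps
      exact h0.add (continuousOn_fst.smul (h1.sub h0)))
    fun p hp h0 => by
      have := hz p.1 hp.1 p.2 (hsub hp.2) h0
      have h2 := hp.2
      rw [this] at h2
      simp [hR.ne] at h2
  obtain ⟨g₀, hg₀, hgf₀, hreg₀⟩ := exists_smooth_regular_approx (isCompact_closedBall x₀ R) hf₀ hη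
  obtain ⟨g₁, hg₁, hgf₁, hreg₁⟩ := exists_smooth_regular_approx (isCompact_closedBall x₀ R) hf₁ hη
  have hA₀ : IsRegularApprox f₀ x₀ R g₀ := ⟨hg₀, fun x hx => (hgf₀ x (hsub hx)).trans_le
    (by simpa using hmin (0, x) ⟨by simp, hx⟩), fun x _ => hreg₀ x⟩
  have hA₁ : IsRegularApprox f₁ x₀ R g₁ := ⟨hg₁, fun x hx => (hgf₁ x (hsub hx)).trans_le
    (by simpa using hmin (1, x) ⟨by simp, hx⟩), fun x _ => hreg₁ x⟩
  rw [← signedZeroCount_eq_brouwerIndex hf₀ hz₀ hR le_rfl hA₀,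
    ← signedZeroCount_eq_brouwerIndex hf₁ hz₁ hR le_rfl hA₁]
  refine signedZeroCount_eq_of_segment hg₀ hg₁ hR hA₀.regular hA₁.regular fun t ht x hx h => ?_
  -- The error of the interpolated map interpolates the two errors, hence stays below η.
  have hmem := (convex_ball (0 : EuclideanSpace ℝ ι) η).add_smul_sub_mem
    (mem_ball_zero_iff.2 (hgf₀ x (hsub hx))) (mem_ball_zero_iff.2 (hgf₁ x (hsub hx))) ht
  have heq : g₀ x - f₀ x + t • (g₁ x - f₁ x - (g₀ x - f₀ x)) =
      - (f₀ x + t • (f₁ x - f₀ x)) := by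
    rw [← sub_eq_zero]
    calc _ = g₀ x + t • (g₁ x - g₀ x) := by module
      _ = 0 := h
  rw [heq, mem_ball_zero_iff, norm_neg] at hmem
  exact absurd hmem (not_lt.2 (hmin (t, x) ⟨ht, hx⟩))

end BrouwerIndex

/-! ### The index of a nondegenerate zero and of a suspension. -/

section BrouwerIndexComputation

variable {ι κ : Type*} [Fintype ι] [Fintype κ]

/-- Near x₀ the segment joins `f` to its linearisation without creating zeros, and the linearisation
is its own regular approximation, with x₀ as its only zero. -/
theorem brouwerIndex_eq_sign_det {f : EuclideanSpace ℝ ι → EuclideanSpace ℝ ι}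
    {x₀ : EuclideanSpace ℝ ι} {R : ℝ} (hR : 0 < R) (hf : ContinuousOn f (Metric.closedBall x₀ R))
    (h0 : f x₀ = 0) {L : EuclideanSpace ℝ ι →L[ℝ] EuclideanSpace ℝ ι} (hd : HasFDerivAt f L x₀)
    (hL : L.det ≠ 0) : brouwerIndex x₀ f = SignType.sign L.det := by
  let e := L.toContinuousLinearEquivOfDetNeZero hL
  let g : EuclideanSpace ℝ ι → EuclideanSpace ℝ ι := fun x => L (x - x₀)
  have hg : ContDiff ℝ ∞ g := L.contDiff.comp (contDiff_id.sub contDiff_const)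
  have hgd : ∀ x, fderiv ℝ g x = L := fun x =>
    (L.hasFDerivAt.comp x ((hasFDerivAt_id x).sub_const x₀)).fderiv
  set C := ‖(e.symm : EuclideanSpace ℝ ι →L[ℝ] EuclideanSpace ℝ ι)‖
  have hC : 0 ≤ C := norm_nonneg _
  have hlow : ∀ v, ‖v‖ ≤ C * ‖L v‖ := fun v => by
    have h := (e.symm : EuclideanSpace ℝ ι →L[ℝ] EuclideanSpace ℝ ι).le_opNorm (e v)
    rw [ContinuousLinearEquiv.coe_coe, e.symm_apply_apply] at h
    exact h
  have hinj : ∀ v, L v = 0 → v = 0 := fun v hv => by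
    have := hlow v
    rw [hv, norm_zero, mul_zero] at this
    exact norm_le_zero_iff.1 this
  -- `C` is the norm of the inverse of `L`; with this constant any zero of the homotopy satisfies ‖x
  -- − x₀‖ ≤ ‖x − x₀‖ / 2.
  have hlo := hd.isLittleO.def (c := 1 / (2 * (C + 1))) (by positivity)
  obtain ⟨δ, hδ, hball⟩ := Metric.eventually_nhds_iff_ball.1 hlo
  set r := min R (δ / 2)
  have hr : 0 < r := lt_min hR (by linarith)
  have hrδ : ∀ x ∈ Metric.closedBall x₀ r, x ∈ Metric.ball x₀ δ := fun x hx =>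
    lt_of_le_of_lt (le_trans hx (min_le_right _ _)) (half_lt_self hδ)
  have hfr := hf.mono (Metric.closedBall_subset_closedBall (min_le_left R (δ / 2)))
  have hgz : ∀ x, g x = 0 → x = x₀ := fun x hx => sub_eq_zero.1 (hinj _ hx)
  rw [brouwerIndex_eq_of_segment hr hfr hg.continuous.continuousOn,
    ← signedZeroCount_eq_brouwerIndex (g := g) hg.continuous.continuousOn
      (R := r) (fun x _ hx => hgz x hx) hr le_rfl ⟨hg, fun x hx => ?_, fun x _ _ => by rwa [hgd]⟩]
  · have hset : {x | x ∈ Metric.ball x₀ r ∧ g x = 0} = {x₀} := by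
      ext x
      constructor
      · exact fun hx => hgz x hx.2
      · rintro rfl
        exact ⟨Metric.mem_ball_self hr, by simp [g]⟩
    rw [signedZeroCount, hset, finsum_mem_singleton, hgd]
  · rw [sub_self, norm_zero, norm_pos_iff]
    intro hx0
    rw [hgz x hx0] at hx
    simp [hr.ne] at hx
  · intro t ht x hx hxt
    have h1 := hball x (hrδ x hx)
    rw [h0, sub_zero] at h1
    have h2 : L (x - x₀) = (t - 1) • (f x - L (x - x₀)) := by
      rw [← sub_eq_zero, ← hxt]
      simp only [g]
      module
    have h3 : ‖L (x - x₀)‖ ≤ ‖f x - L (x - x₀)‖ := by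
      conv_lhs => rw [h2]
      rw [norm_smul, Real.norm_eq_abs]
      have : |t - 1| ≤ 1 := abs_le.2 ⟨by linarith [ht.1], by linarith [ht.2]⟩
      nlinarith [norm_nonneg (f x - L (x - x₀))]
    have h4 : ‖x - x₀‖ ≤ ‖x - x₀‖ / 2 := by
      calc ‖x - x₀‖ ≤ C * ‖L (x - x₀)‖ := hlow _
        _ ≤ (C + 1) * (1 / (2 * (C + 1)) * ‖x - x₀‖) :=
          mul_le_mul (by linarith) (h3.trans h1) (norm_nonneg _) (by linarith)
        _ = ‖x - x₀‖ / 2 := by field_simp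
    exact sub_eq_zero.1 (norm_le_zero_iff.1 (by linarith))

/-- If `u ↦ A u + B (f (π u))` is a suspension of `f`, both maps have the same Brouwer index. -/
theorem brouwerIndex_suspension
    {A : EuclideanSpace ℝ κ →L[ℝ] EuclideanSpace ℝ κ}
    {B : EuclideanSpace ℝ ι →L[ℝ] EuclideanSpace ℝ κ}
    {π : EuclideanSpace ℝ κ →L[ℝ] EuclideanSpace ℝ ι}
    {s : EuclideanSpace ℝ ι →L[ℝ] EuclideanSpace ℝ κ}
    (hAB : ∀ u y, A u + B y = 0 → u = s (π u) ∧ y = 0) (hA : ∀ q, A (s q) = 0)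
    (hπ : ∀ q, π (s q) = q)
    (hdet : ∀ L : EuclideanSpace ℝ ι →L[ℝ] EuclideanSpace ℝ ι,
      (A + B.comp (L.comp π)).det = L.det)
    {f : EuclideanSpace ℝ ι → EuclideanSpace ℝ ι} {q₀ : EuclideanSpace ℝ ι} {R : ℝ} (hR : 0 < R)
    (hf : ContinuousOn f (Metric.closedBall q₀ R))
    (hz : ∀ q ∈ Metric.closedBall q₀ R, f q = 0 → q = q₀) :
    brouwerIndex (s q₀) (fun u => A u + B (f (π u))) = brouwerIndex q₀ f := by
  have hπn : ∀ {r : ℝ}, ∀ u ∈ Metric.closedBall (s q₀) (r / (‖π‖ + 1)),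
      π u ∈ Metric.closedBall q₀ r := by
    intro r u hu
    rw [mem_closedBall_iff_norm] at hu ⊢
    have hpos : 0 < ‖π‖ + 1 := by positivity
    calc ‖π u - q₀‖ = ‖π (u - s q₀)‖ := by rw [map_sub, hπ]
      _ ≤ ‖π‖ * ‖u - s q₀‖ := π.le_opNorm _
      _ ≤ (‖π‖ + 1) * ‖u - s q₀‖ := by nlinarith [norm_nonneg (u - s q₀)]
      _ ≤ (‖π‖ + 1) * (r / (‖π‖ + 1)) := by gcongr
      _ = r := by field_simp
  -- `π` maps the ball of radius `R₂` into the one of radius `R`, and `s` maps the ball of radius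
  -- `ρ` back into that of radius `R₂`. The summands 1 avoid division by zero.
  set R₂ := R / (‖π‖ + 1)
  have hR₂ : 0 < R₂ := by positivity
  set ρ := min R (R₂ / (‖s‖ + 1))
  have hρ : 0 < ρ := by positivity
  have hs : ∀ q ∈ Metric.ball q₀ ρ, s q ∈ Metric.ball (s q₀) R₂ := by
    intro q hq
    rw [mem_ball_iff_norm] at hq ⊢
    have hpos : 0 < ‖s‖ + 1 := by positivity
    calc ‖s q - s q₀‖ = ‖s (q - q₀)‖ := by rw [map_sub]
      _ ≤ ‖s‖ * ‖q - q₀‖ := s.le_opNorm _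
      _ ≤ (‖s‖ + 1) * ‖q - q₀‖ := by nlinarith [norm_nonneg (q - q₀)]
      _ < (‖s‖ + 1) * (R₂ / (‖s‖ + 1)) :=
        mul_lt_mul_of_pos_left (hq.trans_le (min_le_right _ _)) hpos
      _ = R₂ := by field_simp
  let F : EuclideanSpace ℝ κ → EuclideanSpace ℝ κ := fun u => A u + B (f (π u))
  have hF : ContinuousOn F (Metric.closedBall (s q₀) R₂) :=
    A.continuous.continuousOn.add (B.continuous.comp_continuousOn
      (hf.comp π.continuous.continuousOn fun u hu => hπn u hu))
  have hFz : ∀ u ∈ Metric.closedBall (s q₀) R₂, F u = 0 → u = s q₀ := by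
    intro u hu h
    obtain ⟨h1, h2⟩ := hAB _ _ h
    rw [h1, hz _ (hπn u hu) h2]
  obtain ⟨η₁, hη₁, hmin₁⟩ := ((isCompact_closedBall q₀ R).diff
    (Metric.isOpen_ball (x := q₀) (ε := ρ))).exists_pos_le_norm (hf.mono sdiff_subset)
    fun x hx h0 => hx.2 (by rw [hz x hx.1 h0]; exact Metric.mem_ball_self hρ)
  obtain ⟨η₂, hη₂, hmin₂⟩ := (isCompact_sphere (s q₀) R₂).exists_pos_le_norm
    (hF.mono Metric.sphere_subset_closedBall) fun x hx h0 => by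
      rw [hFz x (Metric.sphere_subset_closedBall hx) h0] at hx
      simp [hR₂.ne] at hx
  obtain ⟨g, hg, hgf, hreg⟩ := exists_smooth_regular_approx (isCompact_closedBall q₀ R) hf
    (η := min η₁ (η₂ / (‖B‖ + 1))) (by positivity)
  have hgz := norm_sub_lt_of_annulus hmin₁ fun x hx => (hgf x hx).trans_le (min_le_left _ _)
  -- The suspension of a regular approximation of `f` is one of `F`: `s` carries the zeros of `g` to
  -- those of `G` by `hAB`, `hA` and `hπ`, and `hdet` equates the Jacobians.
  let G : EuclideanSpace ℝ κ → EuclideanSpace ℝ κ := fun u => A u + B (g (π u))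
  have hG : ContDiff ℝ ∞ G := A.contDiff.add (B.contDiff.comp (hg.comp π.contDiff))
  have hGd : ∀ u, (fderiv ℝ G u).det = (fderiv ℝ g (π u)).det := by
    intro u
    rw [← hdet]
    congr 1
    exact (A.hasFDerivAt.add (B.hasFDerivAt.comp u
      ((hg.differentiable (by simp) (π u)).hasFDerivAt.comp u π.hasFDerivAt))).fderiv
  have happ : IsRegularApprox F (s q₀) R₂ G := by
    refine ⟨hG, fun u hu => ?_, fun u hu h => by
      rw [hGd]; exact hreg _ (hAB _ _ h).2⟩
    have hu' := hgf _ (hπn u (Metric.sphere_subset_closedBall hu))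
    have hpos : 0 < ‖B‖ + 1 := by positivity
    calc ‖G u - F u‖ = ‖B (g (π u) - f (π u))‖ := by
          rw [map_sub]; congr 1; simp only [G, F]; abel
      _ ≤ ‖B‖ * ‖g (π u) - f (π u)‖ := B.le_opNorm _
      _ ≤ (‖B‖ + 1) * ‖g (π u) - f (π u)‖ := by nlinarith [norm_nonneg (g (π u) - f (π u))]
      _ < (‖B‖ + 1) * (η₂ / (‖B‖ + 1)) :=
        mul_lt_mul_of_pos_left (hu'.trans_le (min_le_right _ _)) hpos
      _ = η₂ := by field_simp
      _ ≤ ‖F u‖ := hmin₂ u hu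
  have happ' : IsRegularApprox f q₀ R g := by
    refine ⟨hg, fun x hx => ?_, fun x _ => hreg x⟩
    exact (hgf x (Metric.sphere_subset_closedBall hx)).trans_le ((min_le_left _ _).trans
      (hmin₁ x ⟨Metric.sphere_subset_closedBall hx, fun h =>
        (lt_of_lt_of_le h (min_le_left _ _)).ne hx⟩))
  rw [← signedZeroCount_eq_brouwerIndex hf hz hR le_rfl happ']
  change brouwerIndex (s q₀) F = _
  rw [← signedZeroCount_eq_brouwerIndex hF hFz hR₂ le_rfl happ]
  symm
  refine finsum_mem_eq_of_bijOn s ⟨fun q hq => ?_, ?_, fun u hu => ?_⟩ fun q _ => by rw [hGd, hπ]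
  · refine ⟨hs q (hgz q (Metric.ball_subset_closedBall hq.1) hq.2), ?_⟩
    simp [G, hA, hπ, hq.2]
  · intro a _ b _ hab
    rw [← hπ a, hab, hπ]
  · obtain ⟨h1, h2⟩ := hAB _ _ hu.2
    refine ⟨π u, ⟨?_, h2⟩, h1.symm⟩
    exact Metric.ball_subset_ball (min_le_left _ _)
      (hgz _ (hπn u (Metric.ball_subset_closedBall hu.1)) h2)

end BrouwerIndexComputation

/-! ### Morse indices and the law of inertia. -/

section MorseIndex

variable {ι κ : Type*} [Fintype ι] [DecidableEq ι] [Fintype κ] [DecidableEq κ]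

theorem Matrix.IsHermitian.morseIndex_eq_card {S : Matrix ι ι ℝ} (hS : S.IsHermitian) :
    morseIndex S = Fintype.card {i // hS.eigenvalues i < 0} := by
  rw [morseIndex, hS.roots_charpoly_eq_eigenvalues, Multiset.countP_map, Fintype.card_subtype]
  rfl

/-- For real diagonal matrices, congruence does not increase the number of negative entries. -/
theorem card_neg_le_card_neg_of_diagonal_congr {d : ι → ℝ} {d' : κ → ℝ} (W : Matrix ι κ ℝ)
    (h : Matrix.diagonal d' = Wᵀ * Matrix.diagonal d * W) :
    Fintype.card {j // d' j < 0} ≤ Fintype.card {i // d i < 0} := by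
  let E : ({j // d' j < 0} → ℝ) →ₗ[ℝ] (κ → ℝ) :=
    { toFun := fun c j => if hj : d' j < 0 then c ⟨j, hj⟩ else 0
      map_add' := fun a b => by ext j; by_cases hj : d' j < 0 <;> simp [hj]
      map_smul' := fun a b => by ext j; by_cases hj : d' j < 0 <;> simp [hj] }
  -- Extend by zero, apply `W`, keep the coordinates with d < 0. On the kernel the form of `d` is
  -- nonnegative, whereas the form of `d'` is negative definite on the extended vectors; as the two
  -- agree, the kernel is trivial.
  let f : ({j // d' j < 0} → ℝ) →ₗ[ℝ] ({i // d i < 0} → ℝ) :=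
    (LinearMap.funLeft ℝ ℝ Subtype.val).comp (W.mulVecLin.comp E)
  have hf : Function.Injective f := by
    rw [← LinearMap.ker_eq_bot, LinearMap.ker_eq_bot']
    intro c hc
    have hW : ∀ i, d i < 0 → (W *ᵥ E c) i = 0 := fun i hi => congrFun hc ⟨i, hi⟩
    have hquad : ∑ j, d' j * (E c j) ^ 2 = ∑ i, d i * ((W *ᵥ E c) i) ^ 2 := by
      have h1 : E c ⬝ᵥ (Matrix.diagonal d' *ᵥ E c) =
          (W *ᵥ E c) ⬝ᵥ (Matrix.diagonal d *ᵥ (W *ᵥ E c)) := by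
        rw [h, ← Matrix.mulVec_mulVec, ← Matrix.mulVec_mulVec, Matrix.dotProduct_mulVec,
          Matrix.vecMul_transpose]
      simp only [dotProduct, Matrix.mulVec_diagonal] at h1
      convert h1 using 2 <;> ring
    have hle : ∀ j, d' j * (E c j) ^ 2 ≤ 0 := by
      intro j
      by_cases hj : d' j < 0
      · exact mul_nonpos_of_nonpos_of_nonneg hj.le (sq_nonneg _)
      · simp [E, hj]
    have hge : 0 ≤ ∑ i, d i * ((W *ᵥ E c) i) ^ 2 := by
      refine Finset.sum_nonneg fun i _ => ?_
      by_cases hi : d i < 0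
      · simp [hW i hi]
      · exact mul_nonneg (not_lt.1 hi) (sq_nonneg _)
    have hsum : ∑ j, d' j * (E c j) ^ 2 = 0 :=
      le_antisymm (Finset.sum_nonpos fun j _ => hle j) (hquad ▸ hge)
    ext ⟨j, hj⟩
    have h0 := (Finset.sum_eq_zero_iff_of_nonpos fun j _ => hle j).1 hsum j (Finset.mem_univ j)
    rcases mul_eq_zero.1 h0 with h0 | h0
    · exact absurd h0 hj.ne
    · simpa [E, hj] using h0
  simpa using LinearMap.finrank_le_finrank_of_injective hf

/-- Orthogonal diagonalisation of both matrices reduces this to the diagonal case; `P` need not be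
invertible. -/
theorem morseIndex_congr_le {S : Matrix ι ι ℝ} {S' : Matrix κ κ ℝ} (hS : S.IsHermitian)
    (hS' : S'.IsHermitian) (P : Matrix ι κ ℝ) (h : S' = Pᵀ * S * P) :
    morseIndex S' ≤ morseIndex S := by
  rw [hS.morseIndex_eq_card, hS'.morseIndex_eq_card]
  let U : Matrix ι ι ℝ := hS.eigenvectorUnitary.1
  let U' : Matrix κ κ ℝ := hS'.eigenvectorUnitary.1
  have hUs : S = U * Matrix.diagonal hS.eigenvalues * Uᵀ := by
    conv_lhs => rw [hS.spectral_theorem]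
    rfl
  have hUs' : S' = U' * Matrix.diagonal hS'.eigenvalues * U'ᵀ := by
    conv_lhs => rw [hS'.spectral_theorem]
    rfl
  have hU'1 : U'ᵀ * U' = 1 := Unitary.coe_star_mul_self hS'.eigenvectorUnitary
  refine card_neg_le_card_neg_of_diagonal_congr (Uᵀ * P * U') ?_
  calc Matrix.diagonal hS'.eigenvalues
      = (U'ᵀ * U') * Matrix.diagonal hS'.eigenvalues * (U'ᵀ * U') := by rw [hU'1]; simp
    _ = U'ᵀ * S' * U' := by
      conv_rhs => rw [hUs']
      simp only [Matrix.mul_assoc]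
    _ = U'ᵀ * (Pᵀ * (U * Matrix.diagonal hS.eigenvalues * Uᵀ) * P) * U' := by rw [h, ← hUs]
    _ = _ := by simp only [Matrix.transpose_mul, Matrix.transpose_transpose, Matrix.mul_assoc]

/-- Sylvester's law of inertia for the Morse index. -/
theorem morseIndex_congr {S : Matrix ι ι ℝ} {S' : Matrix κ κ ℝ} (hS : S.IsHermitian)
    (hS' : S'.IsHermitian) (P : Matrix ι κ ℝ) (Q : Matrix κ ι ℝ) (hPQ : P * Q = 1)
    (h : S' = Pᵀ * S * P) : morseIndex S' = morseIndex S := by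
  refine le_antisymm (morseIndex_congr_le hS hS' P h) (morseIndex_congr_le hS' hS Q ?_)
  calc S = (P * Q)ᵀ * S * (P * Q) := by rw [hPQ]; simp
    _ = Qᵀ * S' * Q := by rw [h]; simp only [Matrix.transpose_mul, Matrix.mul_assoc]

theorem morseIndex_submatrix_equiv (e : κ ≃ ι) (S : Matrix ι ι ℝ) :
    morseIndex (S.submatrix e e) = morseIndex S := by
  have := Matrix.charpoly_reindex e.symm S
  rw [Matrix.reindex_apply, Equiv.symm_symm] at this
  rw [morseIndex, this, morseIndex]

theorem morseIndex_fromBlocks_zero (A : Matrix ι ι ℝ) (D : Matrix κ κ ℝ) :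
    morseIndex (Matrix.fromBlocks A 0 0 D) = morseIndex A + morseIndex D := by
  rw [morseIndex, Matrix.charpoly_fromBlocks_zero₁₂, Polynomial.roots_mul
    (mul_ne_zero A.charpoly_monic.ne_zero D.charpoly_monic.ne_zero), Multiset.countP_add]
  rfl

theorem morseIndex_smul_one (c : ℝ) :
    morseIndex (c • (1 : Matrix ι ι ℝ)) = if c < 0 then Fintype.card ι else 0 := by
  rw [morseIndex, Matrix.smul_one_eq_diagonal, Matrix.charpoly_diagonal, Finset.prod_const,
    Polynomial.roots_pow, Polynomial.roots_X_sub_C, Multiset.countP_nsmul,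
    ← Multiset.cons_zero]
  by_cases hc : c < 0 <;> simp [hc, -Multiset.cons_zero]

end MorseIndex

/-! ### Elimination of the momenta. -/

section SzulkinMatrix

/-- The Hessian of `|p + α q|² / 2 + ⟨q, B q⟩ / 2`. -/
def coriolisHessian {N : ℕ} (α B : Matrix (Fin N) (Fin N) ℝ) :
    Matrix (Fin N ⊕ Fin N) (Fin N ⊕ Fin N) ℝ :=
  Matrix.fromBlocks 1 α αᵀ (αᵀ * α + B)

/-- The part of the Szulkin matrix that is left after elimination of the momenta. -/
noncomputable def reducedMatrix {N : ℕ} (α B : Matrix (Fin N) (Fin N) ℝ) (τ : ℝ) :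
    Matrix (Fin N ⊕ Fin N) (Fin N ⊕ Fin N) ℝ :=
  Matrix.fromBlocks (τ⁻¹ • 1 - τ • B) ((2 : ℝ) • α) (-((2 : ℝ) • α)) (τ⁻¹ • 1 - τ • B)

theorem isHermitian_szulkinMatrix {N : ℕ} {A : Matrix (Fin N ⊕ Fin N) (Fin N ⊕ Fin N) ℝ}
    (hA : Aᵀ = A) (T : ℝ) : (szulkinMatrix A T).IsHermitian := by
  rw [szulkinMatrix, Matrix.isHermitian_fromBlocks_iff]
  simp only [Matrix.IsHermitian, Matrix.conjTranspose_eq_transpose_of_trivial,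
    Matrix.transpose_neg, Matrix.transpose_smul, hA, Matrix.J_transpose, neg_neg, and_self]

/-- Completing squares in the momenta: replacing p by p − αq + τ⁻¹q' and p' by p' − αq' − τ⁻¹q
leaves −τ on the momenta, hence 2N negative eigenvalues, and the reduced matrix on (q, q'). The
matrix `P` is this substitution and `Q` its inverse. -/
theorem morseIndex_szulkinMatrix {N : ℕ} {α B : Matrix (Fin N) (Fin N) ℝ} (hα : αᵀ = -α)
    (hB : Bᵀ = B) {T : ℝ} (hT : 0 < T) :
    morseIndex (szulkinMatrix (coriolisHessian α B) T) =
      2 * N + morseIndex (reducedMatrix α B (T / (2 * Real.pi))) := by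
  set τ := T / (2 * Real.pi) with hτdef
  have hτ : 0 < τ := by positivity
  have hτ0 := hτ.ne'
  let M : Matrix (Fin N) (Fin N) ℝ := τ⁻¹ • 1 - τ • B
  let Z : Matrix (Fin N ⊕ Fin N) (Fin N ⊕ Fin N) ℝ := Matrix.fromBlocks (-τ • 1) 0 0 M
  let S' := Matrix.fromBlocks Z (Matrix.fromBlocks 0 0 0 ((2 : ℝ) • α))
    (Matrix.fromBlocks 0 0 0 (-((2 : ℝ) • α))) Z
  let P : Matrix ((Fin N ⊕ Fin N) ⊕ (Fin N ⊕ Fin N)) ((Fin N ⊕ Fin N) ⊕ (Fin N ⊕ Fin N)) ℝ :=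
    Matrix.fromBlocks (Matrix.fromBlocks 1 (-α) 0 1) (Matrix.fromBlocks 0 (τ⁻¹ • 1) 0 0)
      (Matrix.fromBlocks 0 (-(τ⁻¹ • 1)) 0 0) (Matrix.fromBlocks 1 (-α) 0 1)
  let Q : Matrix ((Fin N ⊕ Fin N) ⊕ (Fin N ⊕ Fin N)) ((Fin N ⊕ Fin N) ⊕ (Fin N ⊕ Fin N)) ℝ :=
    Matrix.fromBlocks (Matrix.fromBlocks 1 α 0 1) (Matrix.fromBlocks 0 (-(τ⁻¹ • 1)) 0 0)
      (Matrix.fromBlocks 0 (τ⁻¹ • 1) 0 0) (Matrix.fromBlocks 1 α 0 1)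
  have hPQ : P * Q = 1 := by
    simp [P, Q, Matrix.fromBlocks_multiply, Matrix.fromBlocks_add, ← Matrix.fromBlocks_one]
  have hcoriolis : (coriolisHessian α B)ᵀ = coriolisHessian α B := by
    simp [coriolisHessian, Matrix.fromBlocks_transpose, hB]
  have hS' : S'.IsHermitian := by
    simp [S', Z, M, Matrix.IsHermitian, Matrix.conjTranspose_eq_transpose_of_trivial,
      Matrix.fromBlocks_transpose, hα, hB]
  have hcongr : S' = Pᵀ * szulkinMatrix (coriolisHessian α B) T * P := by
    simp only [S', P, Z, M, szulkinMatrix, coriolisHessian, Matrix.J, ← hτdef,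
      Matrix.fromBlocks_multiply, Matrix.fromBlocks_transpose, Matrix.fromBlocks_add,
      Matrix.fromBlocks_smul, Matrix.fromBlocks_neg, Matrix.transpose_one, Matrix.transpose_zero,
      Matrix.transpose_neg, Matrix.transpose_smul, hα]
    congr 2 <;> simp [mul_add, smul_smul, hτ0] <;> try module
  rw [← morseIndex_congr (isHermitian_szulkinMatrix hcoriolis T) hS' P Q hPQ hcongr]
  -- Reordering (p, q, p', q') as (p, p', q, q') makes the matrix block diagonal.
  have hre : S' = (Matrix.fromBlocks (Matrix.fromBlocks (-τ • 1) 0 0 (-τ • 1)) 0 0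
      (reducedMatrix α B τ)).submatrix (Equiv.sumSumSumComm (Fin N) (Fin N) (Fin N) (Fin N))
        (Equiv.sumSumSumComm (Fin N) (Fin N) (Fin N) (Fin N)) := by
    ext ((i | i) | (i | i)) ((j | j) | (j | j)) <;> rfl
  rw [hre, morseIndex_submatrix_equiv, morseIndex_fromBlocks_zero, morseIndex_fromBlocks_zero,
    morseIndex_smul_one, if_pos (by linarith), Fintype.card_fin, two_mul]

end SzulkinMatrix

/-! ### Eigenvalues of the reduced matrix. -/

section PlanarReduction

/-- With M the diagonal block, this is the real form of the Hermitian matrix M − 2iα₂, whose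
determinant is ab − |c + 2i|² = ab − c² − 4; every eigenvalue is doubled, whence the square. -/
theorem charpoly_fromBlocks_hermitian_fin_two (a b c : ℝ) :
    (Matrix.fromBlocks !![a, c; c, b] ((2 : ℝ) • alpha2) (-((2 : ℝ) • alpha2))
      !![a, c; c, b]).charpoly =
    (Polynomial.X ^ 2 - Polynomial.C (a + b) * Polynomial.X
      + Polynomial.C (a * b - c ^ 2 - 4)) ^ 2 := by
  have hre : Matrix.reindex finSumFinEquiv finSumFinEquiv
      (Matrix.fromBlocks !![a, c; c, b] ((2 : ℝ) • alpha2) (-((2 : ℝ) • alpha2))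
        !![a, c; c, b]) = !![a, c, 0, -2; c, b, 2, 0; 0, 2, a, c; -2, 0, c, b] := by
    ext i j
    fin_cases i <;> fin_cases j <;> simp [finSumFinEquiv, alpha2, Fin.addCases]
  rw [← Matrix.charpoly_reindex finSumFinEquiv, hre, Matrix.charpoly, Matrix.det_succ_row_zero]
  simp [Matrix.charmatrix_apply, Fin.sum_univ_succ, Matrix.det_fin_three, Fin.succAbove,
    Matrix.submatrix_apply]
  have h4 : (Polynomial.C 4 : Polynomial ℝ) = Polynomial.C 2 ^ 2 := by
    rw [← Polynomial.C_pow]; norm_num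
  rw [h4]
  ring

theorem morseIndex_fromBlocks_hermitian_fin_two (a b c : ℝ) : ∃ r₁ r₂ : ℝ,
    r₁ + r₂ = a + b ∧ r₁ * r₂ = a * b - c ^ 2 - 4 ∧
    morseIndex (Matrix.fromBlocks !![a, c; c, b] ((2 : ℝ) • alpha2) (-((2 : ℝ) • alpha2))
      !![a, c; c, b]) = 2 * ((if r₁ < 0 then 1 else 0) + (if r₂ < 0 then 1 else 0)) := by
  set D := (a - b) ^ 2 + 4 * c ^ 2 + 16
  have hD : 0 ≤ D := by positivity
  have hsq := Real.sq_sqrt hD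
  set r₁ := (a + b + √D) / 2 with h₁
  set r₂ := (a + b - √D) / 2 with h₂
  have hsum : r₁ + r₂ = a + b := by rw [h₁, h₂]; ring
  have hprod : r₁ * r₂ = a * b - c ^ 2 - 4 := by
    rw [h₁, h₂]; linear_combination (-1 / 4) * hsq
  refine ⟨r₁, r₂, hsum, hprod, ?_⟩
  have hfac : (Polynomial.X ^ 2 - Polynomial.C (a + b) * Polynomial.X
      + Polynomial.C (a * b - c ^ 2 - 4)) ^ 2 =
      ((({r₁, r₂} : Multiset ℝ).map fun r => Polynomial.X - Polynomial.C r).prod) ^ 2 := by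
    rw [← hsum, ← hprod]
    simp only [Multiset.insert_eq_cons, Multiset.map_cons, Multiset.map_singleton,
      Multiset.prod_cons, Multiset.prod_singleton, map_add, map_mul]
    ring
  rw [morseIndex, charpoly_fromBlocks_hermitian_fin_two, hfac, Polynomial.roots_pow,
    Polynomial.roots_multiset_prod_X_sub_C, Multiset.countP_nsmul, Multiset.insert_eq_cons,
    Multiset.countP_cons, ← Multiset.cons_zero, Multiset.countP_cons, Multiset.countP_zero]
  ring

theorem trace_det_of_charpoly_roots {B : Matrix (Fin 2) (Fin 2) ℝ} {β₁ β₂ : ℝ}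
    (h : B.charpoly.roots = {β₁, β₂}) : B.trace = β₁ + β₂ ∧ B.det = β₁ * β₂ := by
  have hsplit : B.charpoly.Splits := by
    rw [Polynomial.splits_iff_card_roots, h, Matrix.charpoly_natDegree_eq_dim]
    rfl
  constructor
  · rw [Matrix.trace_eq_sum_roots_charpoly_of_splits hsplit, h]
    simp
  · rw [Matrix.det_eq_prod_roots_charpoly_of_splits hsplit, h]
    simp

/-- The Morse index of the reduced matrix in terms of `w = τ⁻²`. -/
theorem morseIndex_reducedMatrix_alpha2 {B : Matrix (Fin 2) (Fin 2) ℝ} (hB : Bᵀ = B) {β₁ β₂ : ℝ}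
    (h : B.charpoly.roots = {β₁, β₂}) {τ w : ℝ} (hτ : 0 < τ) (hw : w * τ ^ 2 = 1) :
    (w ^ 2 - (β₁ + β₂ + 4) * w + β₁ * β₂ < 0 → morseIndex (reducedMatrix alpha2 B τ) = 2) ∧
    (0 < w ^ 2 - (β₁ + β₂ + 4) * w + β₁ * β₂ → 0 < 2 * w - (β₁ + β₂) →
      morseIndex (reducedMatrix alpha2 B τ) = 0) ∧
    (0 < w ^ 2 - (β₁ + β₂ + 4) * w + β₁ * β₂ → 2 * w - (β₁ + β₂) < 0 →
      morseIndex (reducedMatrix alpha2 B τ) = 4) := by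
  obtain ⟨htr, hdet⟩ := trace_det_of_charpoly_roots h
  rw [Matrix.trace_fin_two] at htr
  rw [Matrix.det_fin_two] at hdet
  have hsymm : B 1 0 = B 0 1 := congrFun (congrFun hB 0) 1
  rw [hsymm] at hdet
  have hinv : τ⁻¹ = w * τ := by field_simp; linear_combination -hw
  have hM : reducedMatrix alpha2 B τ = Matrix.fromBlocks
      !![τ⁻¹ - τ * B 0 0, -(τ * B 0 1); -(τ * B 0 1), τ⁻¹ - τ * B 1 1] ((2 : ℝ) • alpha2)
      (-((2 : ℝ) • alpha2)) !![τ⁻¹ - τ * B 0 0, -(τ * B 0 1); -(τ * B 0 1), τ⁻¹ - τ * B 1 1] := by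
    have : τ⁻¹ • (1 : Matrix (Fin 2) (Fin 2) ℝ) - τ • B =
        !![τ⁻¹ - τ * B 0 0, -(τ * B 0 1); -(τ * B 0 1), τ⁻¹ - τ * B 1 1] := by
      ext i j
      fin_cases i <;> fin_cases j <;> simp [hsymm]
    rw [reducedMatrix, this]
  obtain ⟨r₁, r₂, hsum, hprod, hidx⟩ := morseIndex_fromBlocks_hermitian_fin_two
    (τ⁻¹ - τ * B 0 0) (τ⁻¹ - τ * B 1 1) (-(τ * B 0 1))
  rw [hM, hidx]
  -- Up to the positive factors τ and τ², sum and product of the eigenvalues are the polynomials of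
  -- the statement, so their signs decide the index.
  have hsum' : r₁ + r₂ = τ * (2 * w - (β₁ + β₂)) := by
    rw [hsum, hinv, ← htr]; ring
  have hprod' : r₁ * r₂ = τ ^ 2 * (w ^ 2 - (β₁ + β₂ + 4) * w + β₁ * β₂) := by
    rw [hprod, hinv, ← htr, ← hdet]
    linear_combination (4 : ℝ) * hw
  have hτ2 : 0 < τ ^ 2 := by positivity
  refine ⟨fun hD => ?_, fun hD hθ => ?_, fun hD hθ => ?_⟩
  · have hneg : r₁ * r₂ < 0 := hprod' ▸ mul_neg_of_pos_of_neg hτ2 hD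
    rcases mul_neg_iff.1 hneg with ⟨h1, h2⟩ | ⟨h1, h2⟩
    · simp [h1.le, h2]
    · simp [h1, h2.le]
  · have hpos : 0 < r₁ * r₂ := hprod' ▸ mul_pos hτ2 hD
    have hs : 0 < r₁ + r₂ := hsum' ▸ mul_pos hτ hθ
    rcases mul_pos_iff.1 hpos with ⟨h1, h2⟩ | ⟨h1, h2⟩
    · simp [h1.le, h2.le]
    · linarith
  · have hpos : 0 < r₁ * r₂ := hprod' ▸ mul_pos hτ2 hD
    have hs : r₁ + r₂ < 0 := hsum' ▸ mul_neg_of_pos_of_neg hτ hθ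
    rcases mul_pos_iff.1 hpos with ⟨h1, h2⟩ | ⟨h1, h2⟩
    · linarith
    · simp [h1, h2]

/-- The Coriolis matrix does not act on the vertical coordinate and `B` does not couple it to the
plane, so the two vertical coordinates split off as a scalar block. -/
theorem morseIndex_reducedMatrix_alpha3 {B : Matrix (Fin 3) (Fin 3) ℝ}
    (h02 : B 0 2 = 0) (h12 : B 1 2 = 0) (h20 : B 2 0 = 0) (h21 : B 2 1 = 0) (τ : ℝ) :
    morseIndex (reducedMatrix alpha3 B τ) =
      morseIndex (reducedMatrix alpha2 !![B 0 0, B 0 1; B 1 0, B 1 1] τ) +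
        if τ⁻¹ - τ * B 2 2 < 0 then 2 else 0 := by
  let e : (Fin 2 ⊕ Fin 2) ⊕ (Fin 1 ⊕ Fin 1) ≃ Fin 3 ⊕ Fin 3 :=
    (Equiv.sumSumSumComm (Fin 2) (Fin 2) (Fin 1) (Fin 1)).trans
      (Equiv.sumCongr finSumFinEquiv finSumFinEquiv)
  have hre : (reducedMatrix alpha3 B τ).submatrix e e =
      Matrix.fromBlocks (reducedMatrix alpha2 !![B 0 0, B 0 1; B 1 0, B 1 1] τ) 0 0
        ((τ⁻¹ - τ * B 2 2) • 1) := by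
    ext ((i | i) | (i | i)) ((j | j) | (j | j)) <;> fin_cases i <;> fin_cases j <;>
      simp [e, reducedMatrix, alpha2, alpha3, finSumFinEquiv, h02, h12, h20, h21,
        Fin.natAdd, Fin.castAdd]
  rw [← morseIndex_submatrix_equiv e, hre, morseIndex_fromBlocks_zero, morseIndex_smul_one]
  rfl

end PlanarReduction

/-! ### Velocity and position as linear maps on phase space. -/

section PhaseSpace

variable {N : ℕ}

/-- The matrix of a bilinear form or operator in the canonical basis has the same determinant. -/
theorem det_eq_det_inner {ι : Type*} [Fintype ι] [DecidableEq ι]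
    (L : EuclideanSpace ℝ ι →L[ℝ] EuclideanSpace ℝ ι) :
    L.det = (Matrix.of fun i j => inner ℝ (EuclideanSpace.single i (1 : ℝ))
      (L (EuclideanSpace.single j 1))).det := by
  rw [ContinuousLinearMap.det, ← LinearMap.det_toMatrix (EuclideanSpace.basisFun ι ℝ).toBasis]
  congr 1
  ext i j
  simp [LinearMap.toMatrix_apply, EuclideanSpace.inner_single_left]

/-- The real inner product as a continuous bilinear map. -/
noncomputable def innerCLM (E : Type*) [NormedAddCommGroup E] [InnerProductSpace ℝ E]
    [FiniteDimensional ℝ E] : E →L[ℝ] E →L[ℝ] ℝ :=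
  (innerₗ E).toContinuousBilinearMap

theorem innerCLM_apply {E : Type*} [NormedAddCommGroup E] [InnerProductSpace ℝ E]
    [FiniteDimensional ℝ E] (x y : E) : innerCLM E x y = inner ℝ x y := rfl

/-- `(p, q) ↦ p` as a continuous linear map. -/
noncomputable def momentumCLM (N : ℕ) :
    EuclideanSpace ℝ (Fin N ⊕ Fin N) →L[ℝ] EuclideanSpace ℝ (Fin N) :=
  LinearMap.toContinuousLinearMap
    { toFun := momentumPart
      map_add' := fun _ _ => rfl
      map_smul' := fun _ _ => rfl }

/-- `(p, q) ↦ q` as a continuous linear map. -/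
noncomputable def positionCLM (N : ℕ) :
    EuclideanSpace ℝ (Fin N ⊕ Fin N) →L[ℝ] EuclideanSpace ℝ (Fin N) :=
  LinearMap.toContinuousLinearMap
    { toFun := positionPart
      map_add' := fun _ _ => rfl
      map_smul' := fun _ _ => rfl }

/-- `(p, q) ↦ p + α q`. -/
noncomputable def velocityCLM (α : Matrix (Fin N) (Fin N) ℝ) :
    EuclideanSpace ℝ (Fin N ⊕ Fin N) →L[ℝ] EuclideanSpace ℝ (Fin N) :=
  momentumCLM N + (Matrix.toEuclideanLin α).toContinuousLinearMap.comp (positionCLM N)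

/-- `q ↦ (-α q, q)` as a continuous linear map. -/
noncomputable def equilibriumCLM (α : Matrix (Fin N) (Fin N) ℝ) :
    EuclideanSpace ℝ (Fin N) →L[ℝ] EuclideanSpace ℝ (Fin N ⊕ Fin N) :=
  LinearMap.toContinuousLinearMap
    { toFun := phaseEquilibrium α
      map_add' := fun a b => by
        ext (i | i)
        · simp [phaseEquilibrium, add_comm]
        · simp [phaseEquilibrium]
      map_smul' := fun c a => by
        ext (i | i) <;> simp [phaseEquilibrium] }

theorem positionCLM_apply (u : EuclideanSpace ℝ (Fin N ⊕ Fin N)) :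
    positionCLM N u = positionPart u := rfl

theorem velocityCLM_apply (α : Matrix (Fin N) (Fin N) ℝ)
    (u : EuclideanSpace ℝ (Fin N ⊕ Fin N)) :
    velocityCLM α u = momentumPart u + Matrix.toEuclideanLin α (positionPart u) := rfl

theorem equilibriumCLM_apply (α : Matrix (Fin N) (Fin N) ℝ) (q : EuclideanSpace ℝ (Fin N)) :
    equilibriumCLM α q = phaseEquilibrium α q := rfl

theorem positionPart_phaseEquilibrium (α : Matrix (Fin N) (Fin N) ℝ)
    (q : EuclideanSpace ℝ (Fin N)) : positionPart (phaseEquilibrium α q) = q := rfl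

theorem velocityCLM_phaseEquilibrium (α : Matrix (Fin N) (Fin N) ℝ)
    (q : EuclideanSpace ℝ (Fin N)) : velocityCLM α (phaseEquilibrium α q) = 0 := by
  rw [velocityCLM_apply, positionPart_phaseEquilibrium]
  ext i
  simp [momentumPart, phaseEquilibrium]

theorem eq_phaseEquilibrium_of_velocity_eq_zero {α : Matrix (Fin N) (Fin N) ℝ}
    {u : EuclideanSpace ℝ (Fin N ⊕ Fin N)} (h : velocityCLM α u = 0) :
    u = phaseEquilibrium α (positionPart u) := by
  rw [velocityCLM_apply] at h
  have h' := eq_neg_of_add_eq_zero_left h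
  ext (i | i)
  · simpa [momentumPart, phaseEquilibrium] using congrArg (fun w => w i) h'
  · rfl

/-- Antisymmetry gives −⟨q, α²q⟩ = |αq|², which is the term needed to complete the square. -/
theorem coriolisHamiltonian_eq {α : Matrix (Fin N) (Fin N) ℝ} (hα : αᵀ = -α)
    (V : EuclideanSpace ℝ (Fin N) → ℝ) (u : EuclideanSpace ℝ (Fin N ⊕ Fin N)) :
    coriolisHamiltonian α V u =
      1 / 2 * inner ℝ (velocityCLM α u) (velocityCLM α u) + V (positionCLM N u) := by
  have hadj : ∀ q, inner ℝ q (Matrix.toEuclideanLin (α * α) q) =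
      -inner ℝ (Matrix.toEuclideanLin α q) (Matrix.toEuclideanLin α q) := by
    intro q
    simp only [EuclideanSpace.inner_eq_star_dotProduct, star_trivial,
      Matrix.ofLp_toLpLin, Matrix.toLin'_apply, ← Matrix.mulVec_mulVec]
    rw [dotProduct_comm, Matrix.dotProduct_mulVec, ← Matrix.mulVec_transpose, hα,
      Matrix.neg_mulVec, neg_dotProduct]
  rw [coriolisHamiltonian, amendedPotential, hadj, velocityCLM_apply, positionCLM_apply,
    inner_add_add_self, ← real_inner_self_eq_norm_sq,
    real_inner_comm (momentumPart u) (Matrix.toEuclideanLin α (positionPart u))]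
  ring

theorem velocityCLM_single_inl (α : Matrix (Fin N) (Fin N) ℝ) (i : Fin N) :
    velocityCLM α (EuclideanSpace.single (Sum.inl i) 1) = EuclideanSpace.single i 1 := by
  ext j
  simp [velocityCLM_apply, momentumPart, positionPart, Matrix.mulVec, dotProduct]

theorem velocityCLM_single_inr (α : Matrix (Fin N) (Fin N) ℝ) (i : Fin N) :
    velocityCLM α (EuclideanSpace.single (Sum.inr i) 1) = WithLp.toLp 2 (α.col i) := by
  ext j
  simp [velocityCLM_apply, momentumPart, positionPart, Matrix.mulVec, dotProduct]

theorem positionCLM_single_inl (i : Fin N) :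
    positionCLM N (EuclideanSpace.single (Sum.inl i) 1) = 0 := by
  ext j
  simp [positionCLM_apply, positionPart]

theorem positionCLM_single_inr (i : Fin N) :
    positionCLM N (EuclideanSpace.single (Sum.inr i) 1) = EuclideanSpace.single i 1 := by
  ext j
  simp [positionCLM_apply, positionPart]

/-- Used both for the Hessian of H and for the differential of a suspension; in the latter case `b`
need not be symmetric. -/
theorem of_inner_velocity_add {α : Matrix (Fin N) (Fin N) ℝ}
    (b : EuclideanSpace ℝ (Fin N) →L[ℝ] EuclideanSpace ℝ (Fin N) →L[ℝ] ℝ) :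
    (Matrix.of fun i j : Fin N ⊕ Fin N =>
      inner ℝ (velocityCLM α (EuclideanSpace.single i 1))
        (velocityCLM α (EuclideanSpace.single j 1)) +
      b (positionCLM N (EuclideanSpace.single i 1)) (positionCLM N (EuclideanSpace.single j 1))) =
    coriolisHessian α (Matrix.of fun i j =>
      b (EuclideanSpace.single i 1) (EuclideanSpace.single j 1)) := by
  ext (i | i) (j | j)
  · simp [coriolisHessian, velocityCLM_single_inl, positionCLM_single_inl, Matrix.one_apply,
      EuclideanSpace.inner_single_left]
  · simp [coriolisHessian, velocityCLM_single_inl, velocityCLM_single_inr, positionCLM_single_inl,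
      EuclideanSpace.inner_single_left]
  · simp [coriolisHessian, velocityCLM_single_inl, velocityCLM_single_inr, positionCLM_single_inl,
      EuclideanSpace.inner_single_right]
  · simp [coriolisHessian, velocityCLM_single_inr, positionCLM_single_inr,
      EuclideanSpace.inner_eq_star_dotProduct, Matrix.mul_apply, dotProduct, mul_comm]

theorem det_coriolisHessian (α B : Matrix (Fin N) (Fin N) ℝ) :
    (coriolisHessian α B).det = B.det := by
  rw [coriolisHessian, Matrix.det_fromBlocks_one₁₁, add_sub_cancel_left]

end PhaseSpace

/-! ### Gradients and Hessians at critical points. -/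

section CriticalPoints

variable {ι : Type*} [Fintype ι]

theorem differentiableAt_fderiv_of_contDiffOn {Ω : Set (EuclideanSpace ℝ ι)}
    {V : EuclideanSpace ℝ ι → ℝ} (hΩ : IsOpen Ω) (hV : ContDiffOn ℝ 2 V Ω)
    {q : EuclideanSpace ℝ ι} (hq : q ∈ Ω) : DifferentiableAt ℝ (fderiv ℝ V) q :=
  ((hV.contDiffAt (hΩ.mem_nhds hq)).fderiv_right (m := 1) (by norm_num)).differentiableAt (by simp)

theorem hessianMatrix_transpose [DecidableEq ι] {Ω : Set (EuclideanSpace ℝ ι)}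
    {V : EuclideanSpace ℝ ι → ℝ} (hΩ : IsOpen Ω) (hV : ContDiffOn ℝ 2 V Ω)
    {q : EuclideanSpace ℝ ι} (hq : q ∈ Ω) : (hessianMatrix V q)ᵀ = hessianMatrix V q := by
  ext i j
  exact ((hV.contDiffAt (hΩ.mem_nhds hq)).isSymmSndFDerivAt (by simp)) _ _

theorem continuousOn_gradient {Ω : Set (EuclideanSpace ℝ ι)}
    {V : EuclideanSpace ℝ ι → ℝ} (hΩ : IsOpen Ω) (hV : ContDiffOn ℝ 2 V Ω) :
    ContinuousOn (gradient V) Ω := fun _ hq =>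
  ((InnerProductSpace.toDual ℝ _).symm.continuous.continuousAt.comp
    (differentiableAt_fderiv_of_contDiffOn hΩ hV hq).continuousAt).continuousWithinAt

theorem exists_isolating_ball {Ω : Set (EuclideanSpace ℝ ι)} {f : EuclideanSpace ℝ ι →
    EuclideanSpace ℝ ι} {q₀ : EuclideanSpace ℝ ι} (hΩ : IsOpen Ω) (hq₀ : q₀ ∈ Ω)
    (hiso : ∀ᶠ q in 𝓝[≠] q₀, f q ≠ 0) :
    ∃ R > 0, Metric.closedBall q₀ R ⊆ Ω ∧ ∀ q ∈ Metric.closedBall q₀ R, f q = 0 → q = q₀ := by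
  rw [eventually_nhdsWithin_iff] at hiso
  obtain ⟨R, hR, hball⟩ := Metric.eventually_nhds_iff_ball.1 (hiso.and (hΩ.eventually_mem hq₀))
  have hsub : ∀ q ∈ Metric.closedBall q₀ (R / 2), q ∈ Metric.ball q₀ R := fun q hq =>
    lt_of_le_of_lt hq (half_lt_self hR)
  refine ⟨R / 2, half_pos hR, fun q hq => (hball q (hsub q hq)).2, fun q hq h0 => ?_⟩
  by_contra hne
  exact (hball q (hsub q hq)).1 hne h0

theorem brouwerIndex_gradient_eq_sign [DecidableEq ι] {Ω : Set (EuclideanSpace ℝ ι)}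
    {V : EuclideanSpace ℝ ι → ℝ} (hΩ : IsOpen Ω) (hV : ContDiffOn ℝ 2 V Ω)
    {q₀ : EuclideanSpace ℝ ι} (hq₀ : q₀ ∈ Ω) (h0 : gradient V q₀ = 0)
    (hdet : (hessianMatrix V q₀).det ≠ 0) :
    brouwerIndex q₀ (gradient V) = SignType.sign (hessianMatrix V q₀).det := by
  obtain ⟨R, hR, hball⟩ := Metric.isOpen_iff.1 hΩ q₀ hq₀
  let D : (EuclideanSpace ℝ ι →L[ℝ] ℝ) →L[ℝ] EuclideanSpace ℝ ι :=
    LinearMap.toContinuousLinearMap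
      { toFun := (InnerProductSpace.toDual ℝ (EuclideanSpace ℝ ι)).symm
        map_add' := fun a b => map_add _ a b
        map_smul' := fun c a => by simp }
  let L : EuclideanSpace ℝ ι →L[ℝ] EuclideanSpace ℝ ι :=
    D.comp (fderiv ℝ (fderiv ℝ V) q₀)
  have hL : HasFDerivAt (gradient V) L q₀ :=
    D.hasFDerivAt.comp q₀
      (differentiableAt_fderiv_of_contDiffOn hΩ hV hq₀).hasFDerivAt
  have hLdet : L.det = (hessianMatrix V q₀).det := by
    rw [det_eq_det_inner, ← Matrix.det_transpose]
    congr 1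
    ext i j
    simp only [Matrix.transpose_apply, Matrix.of_apply, hessianMatrix]
    rw [real_inner_comm]
    exact InnerProductSpace.toDual_symm_apply
  rw [← hLdet] at hdet ⊢
  exact brouwerIndex_eq_sign_det (half_pos hR) ((continuousOn_gradient hΩ hV).mono
    ((Metric.closedBall_subset_ball (half_lt_self hR)).trans hball)) h0 hL hdet

end CriticalPoints

/-! ### The Hessian and the index of the Hamiltonian. -/

section CoriolisHamiltonian

variable {N : ℕ} {α : Matrix (Fin N) (Fin N) ℝ} {Ω : Set (EuclideanSpace ℝ (Fin N))}
  {V : EuclideanSpace ℝ (Fin N) → ℝ}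

theorem fderiv_coriolisHamiltonian (hα : αᵀ = -α) {u : EuclideanSpace ℝ (Fin N ⊕ Fin N)}
    (hV : DifferentiableAt ℝ V (positionCLM N u)) :
    fderiv ℝ (coriolisHamiltonian α V) u =
      (innerCLM _ (velocityCLM α u)).comp (velocityCLM α) +
        (fderiv ℝ V (positionCLM N u)).comp (positionCLM N) := by
  rw [funext (coriolisHamiltonian_eq hα V)]
  have h1 := (((velocityCLM α).hasFDerivAt (x := u)).inner ℝ
    (velocityCLM α).hasFDerivAt).const_mul (1 / 2 : ℝ)
  have h2 := hV.hasFDerivAt.comp u (positionCLM N).hasFDerivAt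
  refine (h1.add h2).fderiv.trans ?_
  ext v
  simp [fderivInnerCLM_apply, innerCLM_apply, real_inner_comm]
  ring

theorem hessianMatrix_coriolisHamiltonian (hα : αᵀ = -α) (hΩ : IsOpen Ω)
    (hV : ContDiffOn ℝ 2 V Ω) {q₀ : EuclideanSpace ℝ (Fin N)} (hq₀ : q₀ ∈ Ω) :
    hessianMatrix (coriolisHamiltonian α V) (phaseEquilibrium α q₀) =
      coriolisHessian α (hessianMatrix V q₀) := by
  set u₀ := phaseEquilibrium α q₀
  have hu₀ : positionCLM N u₀ = q₀ := rfl
  have hev : fderiv ℝ (coriolisHamiltonian α V) =ᶠ[𝓝 u₀] fun u =>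
      (innerCLM _ (velocityCLM α u)).comp (velocityCLM α) +
        (fderiv ℝ V (positionCLM N u)).comp (positionCLM N) := by
    filter_upwards [(positionCLM N).continuous.continuousAt.preimage_mem_nhds
      (hΩ.mem_nhds (hu₀.symm ▸ hq₀))] with u hu
    exact fderiv_coriolisHamiltonian hα
      ((hV.contDiffAt (hΩ.mem_nhds hu)).differentiableAt (by simp))
  have hd2 := (differentiableAt_fderiv_of_contDiffOn hΩ hV hq₀).hasFDerivAt
  rw [← hu₀] at hd2
  have h1 : HasFDerivAt (fun u => (innerCLM _ (velocityCLM α u)).comp (velocityCLM α)) _ u₀ :=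
    ((innerCLM _).hasFDerivAt.comp u₀ (velocityCLM α).hasFDerivAt).clm_comp
      (hasFDerivAt_const (velocityCLM α) u₀)
  have h2 : HasFDerivAt (fun u => (fderiv ℝ V (positionCLM N u)).comp (positionCLM N)) _ u₀ :=
    (hd2.comp u₀ (positionCLM N).hasFDerivAt).clm_comp (hasFDerivAt_const (positionCLM N) u₀)
  have hd := (hev.fderiv_eq.trans (h1.add h2).fderiv)
  refine Eq.trans ?_ (of_inner_velocity_add (fderiv ℝ (fderiv ℝ V) q₀))
  ext i j
  have hij := congrArg (fun F => F (EuclideanSpace.single i (1 : ℝ))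
    (EuclideanSpace.single j (1 : ℝ))) hd
  refine Eq.trans hij ?_
  simp [innerCLM_apply, hu₀]

/-- With v and π the velocity and position maps, H' = v*v + π* ∘ V' ∘ π. This is a suspension of V',
with q ↦ (−αq, q) as its section, because v vanishes exactly on the image of that section. -/
theorem brouwerIndex_gradient_coriolisHamiltonian (hα : αᵀ = -α) (hΩ : IsOpen Ω)
    (hV : ContDiffOn ℝ 2 V Ω) {q₀ : EuclideanSpace ℝ (Fin N)} (hq₀ : q₀ ∈ Ω)
    (hiso : ∀ᶠ q in 𝓝[≠] q₀, gradient V q ≠ 0) :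
    brouwerIndex (phaseEquilibrium α q₀) (gradient (coriolisHamiltonian α V)) =
      brouwerIndex q₀ (gradient V) := by
  obtain ⟨R, hR, hsub, hz⟩ := exists_isolating_ball hΩ hq₀ hiso
  let A := (velocityCLM α).adjoint.comp (velocityCLM α)
  let B := (positionCLM N).adjoint
  -- Pairing the equation with the equilibrium over `y`, where the velocity vanishes, leaves |y|² =
  -- 0; pairing it with `u` then leaves zero velocity.
  have hAB : ∀ u y, A u + B y = 0 → u = equilibriumCLM α (positionCLM N u) ∧ y = 0 := by
    intro u y h
    have h1 : inner ℝ (A u + B y) (equilibriumCLM α y) = 0 := by rw [h, inner_zero_left]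
    have hy : y = 0 := by
      simpa [A, B, inner_add_left, ContinuousLinearMap.adjoint_inner_left, equilibriumCLM_apply,
        velocityCLM_phaseEquilibrium, positionCLM_apply, positionPart_phaseEquilibrium] using h1
    refine ⟨eq_phaseEquilibrium_of_velocity_eq_zero ?_, hy⟩
    have h2 : inner ℝ (A u + B y) u = 0 := by rw [h, inner_zero_left]
    simpa [A, B, hy, ContinuousLinearMap.adjoint_inner_left] using h2
  have hdet : ∀ L : EuclideanSpace ℝ (Fin N) →L[ℝ] EuclideanSpace ℝ (Fin N),
      (A + B.comp (L.comp (positionCLM N))).det = L.det := by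
    intro L
    have h := of_inner_velocity_add (α := α) ((innerCLM _).flip.comp L).flip
    rw [det_eq_det_inner, det_eq_det_inner L, ← det_coriolisHessian α]
    refine Eq.trans (congrArg Matrix.det ?_) (congrArg Matrix.det h)
    ext i j
    simp [A, B, inner_add_right, ContinuousLinearMap.adjoint_inner_right, innerCLM_apply]
  have hkey := brouwerIndex_suspension hAB (fun q => by
    simp [A, equilibriumCLM_apply, velocityCLM_phaseEquilibrium]) (fun q => rfl) hdet hR
    ((continuousOn_gradient hΩ hV).mono hsub) hz
  rw [← hkey]
  have hgrad : ∀ u, positionCLM N u ∈ Ω → gradient (coriolisHamiltonian α V) u =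
      A u + B (gradient V (positionCLM N u)) := by
    intro u hu
    refine ext_inner_right ℝ fun v => ?_
    rw [gradient, InnerProductSpace.toDual_symm_apply, fderiv_coriolisHamiltonian hα
      ((hV.contDiffAt (hΩ.mem_nhds hu)).differentiableAt (by simp))]
    simp [A, B, inner_add_left, ContinuousLinearMap.adjoint_inner_left, gradient, innerCLM_apply]
  have hopen : IsOpen (positionCLM N ⁻¹' Metric.ball q₀ R) :=
    Metric.isOpen_ball.preimage (positionCLM N).continuous
  obtain ⟨ρ, hρ, hρsub⟩ := Metric.isOpen_iff.1 hopen (phaseEquilibrium α q₀)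
    (Metric.mem_ball_self hR)
  have hclosed : ∀ u ∈ Metric.closedBall (phaseEquilibrium α q₀) (ρ / 2),
      positionCLM N u ∈ Metric.closedBall q₀ R := fun u hu => Metric.ball_subset_closedBall
    (hρsub (Metric.closedBall_subset_ball (half_lt_self hρ) hu))
  have hcont : ContinuousOn (fun u => A u + B (gradient V (positionCLM N u)))
      (Metric.closedBall (phaseEquilibrium α q₀) (ρ / 2)) :=
    A.continuous.continuousOn.add (B.continuous.comp_continuousOn
      (((continuousOn_gradient hΩ hV).mono hsub).comp (positionCLM N).continuous.continuousOn
        hclosed))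
  have heq : EqOn (gradient (coriolisHamiltonian α V))
      (fun u => A u + B (gradient V (positionCLM N u)))
      (Metric.closedBall (phaseEquilibrium α q₀) (ρ / 2)) := fun u hu =>
    hgrad u (hsub (hclosed u hu))
  -- The formula for H' is available only over `Ω`. The homotopy between two maps that agree near
  -- the equilibrium carries the index over.
  refine brouwerIndex_eq_of_segment (half_pos hρ) (hcont.congr heq) hcont fun t _ u hu h => ?_
  rw [heq hu, sub_self, smul_zero, add_zero] at h
  obtain ⟨h1, h2⟩ := hAB _ _ h
  rw [h1, hz _ (hclosed u hu) h2]
  rfl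

end CoriolisHamiltonian

/-! ### From the spatial potential to its planar restriction. -/

section SpatialReduction

/-- `planeEmbedding` as a continuous linear map. -/
noncomputable def planeEmbeddingCLM : EuclideanSpace ℝ (Fin 2) →L[ℝ] EuclideanSpace ℝ (Fin 3) :=
  LinearMap.toContinuousLinearMap
    { toFun := planeEmbedding
      map_add' := fun a b => by ext i; fin_cases i <;> simp [planeEmbedding]
      map_smul' := fun c a => by ext i; fin_cases i <;> simp [planeEmbedding] }

/-- `planeProjection` as a continuous linear map. -/
noncomputable def planeProjectionCLM : EuclideanSpace ℝ (Fin 3) →L[ℝ] EuclideanSpace ℝ (Fin 2) :=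
  LinearMap.toContinuousLinearMap
    { toFun := planeProjection
      map_add' := fun a b => by ext i; fin_cases i <;> simp [planeProjection]
      map_smul' := fun c a => by ext i; fin_cases i <;> simp [planeProjection] }

/-- `(x, y, z) ↦ (0, 0, z)`. -/
noncomputable def verticalCLM : EuclideanSpace ℝ (Fin 3) →L[ℝ] EuclideanSpace ℝ (Fin 3) :=
  (EuclideanSpace.proj (2 : Fin 3)).smulRight (EuclideanSpace.single 2 1)

theorem planeEmbeddingCLM_apply (w : EuclideanSpace ℝ (Fin 2)) :
    planeEmbeddingCLM w = planeEmbedding w := rfl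

theorem planeProjectionCLM_apply (q : EuclideanSpace ℝ (Fin 3)) :
    planeProjectionCLM q = planeProjection q := rfl

theorem verticalCLM_apply (q : EuclideanSpace ℝ (Fin 3)) :
    verticalCLM q = q 2 • EuclideanSpace.single 2 1 := rfl

theorem planeProjection_planeEmbedding (w : EuclideanSpace ℝ (Fin 2)) :
    planeProjection (planeEmbedding w) = w := by
  ext i; fin_cases i <;> simp [planeProjection, planeEmbedding]

theorem planeEmbedding_planeProjection {q : EuclideanSpace ℝ (Fin 3)} (hq : q 2 = 0) :
    planeEmbedding (planeProjection q) = q := by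
  ext i; fin_cases i <;> simp [planeProjection, planeEmbedding, hq]

theorem inner_planeProjection (q : EuclideanSpace ℝ (Fin 3)) (w : EuclideanSpace ℝ (Fin 2)) :
    inner ℝ (planeProjection q) w = inner ℝ q (planeEmbedding w) := by
  simp [PiLp.inner_apply, Fin.sum_univ_succ, planeProjection, planeEmbedding]

theorem planeEmbedding_single (i : Fin 2) :
    planeEmbedding (EuclideanSpace.single i 1) = EuclideanSpace.single i.castSucc 1 := by
  ext j; fin_cases i <;> fin_cases j <;> simp [planeEmbedding]

variable {Ω : Set (EuclideanSpace ℝ (Fin 3))} {V : EuclideanSpace ℝ (Fin 3) → ℝ}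

theorem fderiv_planarRestriction (hΩ : IsOpen Ω) (hV : ContDiffOn ℝ 2 V Ω)
    {w : EuclideanSpace ℝ (Fin 2)} (hw : planeEmbedding w ∈ Ω) :
    fderiv ℝ (planarRestriction V) w = (fderiv ℝ V (planeEmbedding w)).comp planeEmbeddingCLM :=
  (((hV.contDiffAt (hΩ.mem_nhds hw)).differentiableAt (by simp)).hasFDerivAt.comp w
    planeEmbeddingCLM.hasFDerivAt).fderiv

theorem gradient_planarRestriction (hΩ : IsOpen Ω) (hV : ContDiffOn ℝ 2 V Ω)
    {w : EuclideanSpace ℝ (Fin 2)} (hw : planeEmbedding w ∈ Ω) :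
    gradient (planarRestriction V) w = planeProjection (gradient V (planeEmbedding w)) := by
  refine ext_inner_right ℝ fun v => ?_
  rw [inner_planeProjection, gradient, InnerProductSpace.toDual_symm_apply,
    fderiv_planarRestriction hΩ hV hw, gradient, InnerProductSpace.toDual_symm_apply]
  rfl

theorem gradient_apply_eq_fderiv {n : ℕ} (f : EuclideanSpace ℝ (Fin n) → ℝ)
    (x : EuclideanSpace ℝ (Fin n)) (i : Fin n) :
    gradient f x i = fderiv ℝ f x (EuclideanSpace.single i 1) := by
  have h : inner ℝ (gradient f x) (EuclideanSpace.single i 1) =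
      fderiv ℝ f x (EuclideanSpace.single i 1) := InnerProductSpace.toDual_symm_apply
  rw [← h, EuclideanSpace.inner_single_right]
  simp

theorem hessianMatrix_planarRestriction (hΩ : IsOpen Ω) (hV : ContDiffOn ℝ 2 V Ω)
    {w : EuclideanSpace ℝ (Fin 2)} (hw : planeEmbedding w ∈ Ω) (i j : Fin 2) :
    hessianMatrix (planarRestriction V) w i j =
      hessianMatrix V (planeEmbedding w) i.castSucc j.castSucc := by
  have hev : fderiv ℝ (planarRestriction V) =ᶠ[𝓝 w] fun y =>
      (fderiv ℝ V (planeEmbeddingCLM y)).comp planeEmbeddingCLM := by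
    filter_upwards [planeEmbeddingCLM.continuous.continuousAt.preimage_mem_nhds
      (hΩ.mem_nhds hw)] with y hy
    exact fderiv_planarRestriction hΩ hV hy
  have h2 : HasFDerivAt (fun y => (fderiv ℝ V (planeEmbeddingCLM y)).comp planeEmbeddingCLM) _ w :=
    (((differentiableAt_fderiv_of_contDiffOn hΩ hV hw).hasFDerivAt).comp w
      planeEmbeddingCLM.hasFDerivAt).clm_comp (hasFDerivAt_const planeEmbeddingCLM w)
  have hij := congrArg (fun F => F (EuclideanSpace.single i (1 : ℝ))
    (EuclideanSpace.single j (1 : ℝ))) (hev.fderiv_eq.trans h2.fderiv)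
  refine Eq.trans hij ?_
  simp [planeEmbeddingCLM_apply, planeEmbedding_single, hessianMatrix]

/-- As the vertical derivative vanishes on the plane, planar critical points are spatial ones, and
isolation is inherited. -/
theorem PlanarSystem.of_spatialSystem (h : SpatialSystem Ω V) :
    PlanarSystem (planeEmbedding ⁻¹' Ω) (planarRestriction V) where
  isOpen := h.isOpen.preimage planeEmbeddingCLM.continuous
  contDiffOn := h.contDiffOn.comp planeEmbeddingCLM.contDiff.contDiffOn fun _ hw => hw
  isolated := by
    have hgrad : ∀ w, planeEmbedding w ∈ Ω → gradient (planarRestriction V) w = 0 →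
        gradient V (planeEmbedding w) = 0 := by
      intro w hw h0
      rw [gradient_planarRestriction h.isOpen h.contDiffOn hw] at h0
      rw [← planeEmbedding_planeProjection (h.planar_invariant w hw), h0]
      exact planeEmbeddingCLM.map_zero
    intro w hw h0
    have hiso := h.isolated _ hw (hgrad w hw h0)
    rw [eventually_nhdsWithin_iff] at hiso ⊢
    filter_upwards [planeEmbeddingCLM.continuous.continuousAt.eventually hiso,
      planeEmbeddingCLM.continuous.continuousAt.preimage_mem_nhds (h.isOpen.mem_nhds hw)]
      with y hy hyΩ hne h0y
    refine hy (fun heq => hne ?_) (hgrad y hyΩ h0y)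
    rw [mem_singleton_iff, ← planeProjection_planeEmbedding y, ← planeProjection_planeEmbedding w]
    exact congrArg planeProjection heq

/-- The vertical derivative is identically zero on the plane; differentiate it along the plane. -/
theorem hessianMatrix_castSucc_two (h : SpatialSystem Ω V) {w : EuclideanSpace ℝ (Fin 2)}
    (hw : planeEmbedding w ∈ Ω) (i : Fin 2) :
    hessianMatrix V (planeEmbedding w) i.castSucc 2 = 0 := by
  have hev : (fun y => fderiv ℝ V (planeEmbeddingCLM y) (EuclideanSpace.single 2 1))
      =ᶠ[𝓝 w] fun _ => 0 := by
    filter_upwards [planeEmbeddingCLM.continuous.continuousAt.preimage_mem_nhds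
      (h.isOpen.mem_nhds hw)] with y hy
    rw [← gradient_apply_eq_fderiv]
    exact h.planar_invariant y hy
  have h2 : HasFDerivAt (fun y => fderiv ℝ V (planeEmbeddingCLM y) (EuclideanSpace.single 2 1))
      _ w :=
    (((differentiableAt_fderiv_of_contDiffOn h.isOpen h.contDiffOn hw).hasFDerivAt).comp w
      planeEmbeddingCLM.hasFDerivAt).clm_apply (hasFDerivAt_const (EuclideanSpace.single 2 1) w)
  have hi := congrArg (fun F => F (EuclideanSpace.single i (1 : ℝ)))
    (h2.fderiv.symm.trans hev.fderiv_eq)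
  simpa [planeEmbeddingCLM_apply, planeEmbedding_single, hessianMatrix] using hi

theorem continuousAt_hessianMatrix (hΩ : IsOpen Ω) (hV : ContDiffOn ℝ 2 V Ω)
    {q : EuclideanSpace ℝ (Fin 3)} (hq : q ∈ Ω) (i j : Fin 3) :
    ContinuousAt (fun x => hessianMatrix V x i j) q := by
  have h1 : ContDiffAt ℝ 1 (fderiv ℝ V) q :=
    (hV.contDiffAt (hΩ.mem_nhds hq)).fderiv_right (by norm_num)
  have h2 : ContinuousAt (fderiv ℝ (fderiv ℝ V)) q :=
    (h1.fderiv_right (m := 0) (by norm_num)).continuousAt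
  exact (h2.clm_apply continuousAt_const).clm_apply continuousAt_const

/-- Vertical attraction: near a planar equilibrium the vertical force is directed away from the
plane in the sense of the gradient. -/
theorem vertical_mul_gradient_pos (h : SpatialSystem Ω V) {q₀ : EuclideanSpace ℝ (Fin 3)} {r : ℝ}
    (h0 : q₀ 2 = 0) (hsub : Metric.closedBall q₀ r ⊆ Ω)
    (hpos : ∀ q ∈ Metric.closedBall q₀ r, 0 < hessianMatrix V q 2 2)
    {q : EuclideanSpace ℝ (Fin 3)} (hq : q ∈ Metric.closedBall q₀ r) (hq2 : q 2 ≠ 0) :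
    0 < q 2 * gradient V q 2 := by
  set c := planeEmbedding (planeProjection q) with hc
  have hqc : c + q 2 • EuclideanSpace.single (2 : Fin 3) (1 : ℝ) = q := by
    ext i; fin_cases i <;> simp [hc, planeEmbedding, planeProjection]
  -- Dropping the height does not increase the distance to `q₀`, which lies in the plane.
  have hcball : c ∈ Metric.closedBall q₀ r := by
    rw [mem_closedBall_iff_norm] at hq ⊢
    refine le_trans ?_ hq
    rw [EuclideanSpace.norm_eq, EuclideanSpace.norm_eq]
    refine Real.sqrt_le_sqrt ?_
    simp only [Fin.sum_univ_three]
    simp [hc, planeEmbedding, planeProjection, h0]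
    positivity
  let γ : ℝ → EuclideanSpace ℝ (Fin 3) := fun s => c + s • (q - c)
  have hγ : ∀ s ∈ Icc (0 : ℝ) 1, γ s ∈ Metric.closedBall q₀ r := fun s hs =>
    (convex_closedBall q₀ r).add_smul_sub_mem hcball hq hs
  have hγd : ∀ s, HasDerivAt γ (q 2 • EuclideanSpace.single (2 : Fin 3) (1 : ℝ)) s := by
    intro s
    have : q - c = q 2 • EuclideanSpace.single (2 : Fin 3) (1 : ℝ) := by
      conv_lhs => rw [← hqc]
      rw [add_sub_cancel_left]
    rw [← this]
    exact (((hasDerivAt_id s).smul_const (q - c)).const_add c).congr_deriv (one_smul _ _)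
  let φ : ℝ → ℝ := fun s => q 2 * fderiv ℝ V (γ s) (EuclideanSpace.single 2 1)
  have hφ : ∀ s ∈ Icc (0 : ℝ) 1, HasDerivAt φ ((q 2) ^ 2 * hessianMatrix V (γ s) 2 2) s := by
    intro s hs
    have hd := (differentiableAt_fderiv_of_contDiffOn h.isOpen h.contDiffOn
      (hsub (hγ s hs))).hasFDerivAt.comp_hasDerivAt s (hγd s)
    have hd2 := (hd.clm_apply
      (hasDerivAt_const s (EuclideanSpace.single (2 : Fin 3) (1 : ℝ)))).const_mul (q 2)
    refine hd2.congr_deriv ?_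
    simp [hessianMatrix]
    ring
  -- Mean value theorem on the vertical segment from the plane, where the vertical force vanishes,
  -- up to `q`.
  obtain ⟨s, hs, hslope⟩ := exists_hasDerivAt_eq_slope φ _ zero_lt_one
    (fun s hs => (hφ s hs).continuousAt.continuousWithinAt)
    fun s hs => hφ s (Ioo_subset_Icc_self hs)
  have hφ0 : φ 0 = 0 := by
    have : γ 0 = c := by simp [γ]
    simp only [φ, this, ← gradient_apply_eq_fderiv]
    rw [hc, h.planar_invariant _ (hc ▸ hsub hcball), mul_zero]
  have hφ1 : φ 1 = q 2 * gradient V q 2 := by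
    have : γ 1 = q := by simp [γ]
    simp only [φ, this, ← gradient_apply_eq_fderiv]
  rw [hφ0, hφ1, sub_zero, sub_zero, div_one] at hslope
  rw [← hslope]
  have := hpos _ (hγ s (Ioo_subset_Icc_self hs))
  positivity

/-- The field (Ṽ'(x, y), z) is a suspension of Ṽ'. The segment from V' to it has no zeros off the
plane, by vertical attraction, and on the plane both fields coincide. -/
theorem brouwerIndex_gradient_planarRestriction (h : SpatialSystem Ω V)
    {q₀ : EuclideanSpace ℝ (Fin 3)} (hq₀ : q₀ ∈ Ω) (hcrit : gradient V q₀ = 0) :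
    brouwerIndex q₀ (gradient V) =
      brouwerIndex (planeProjection q₀) (gradient (planarRestriction V)) := by
  have h0 := h.planar_equilibria q₀ hq₀ hcrit
  have hemb := planeEmbedding_planeProjection h0
  have hP := PlanarSystem.of_spatialSystem h
  have hw₀ : planeProjection q₀ ∈ planeEmbedding ⁻¹' Ω := by
    rw [mem_preimage, hemb]; exact hq₀
  have hcritw : gradient (planarRestriction V) (planeProjection q₀) = 0 := by
    rw [gradient_planarRestriction h.isOpen h.contDiffOn hw₀, hemb, hcrit]
    exact planeProjectionCLM.map_zero
  obtain ⟨R₂, hR₂, hsub₂, hz₂⟩ := exists_isolating_ball hP.isOpen hw₀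
    (hP.isolated _ hw₀ hcritw)
  have hsus := brouwerIndex_suspension (A := verticalCLM) (B := planeEmbeddingCLM)
    (π := planeProjectionCLM) (s := planeEmbeddingCLM)
    (fun u y huy => by
      have e0 := congrArg (fun v => v 0) huy
      have e1 := congrArg (fun v => v 1) huy
      have e2 := congrArg (fun v => v 2) huy
      simp [verticalCLM_apply, planeEmbeddingCLM_apply, planeEmbedding] at e0 e1 e2
      refine ⟨(planeEmbedding_planeProjection e2).symm, ?_⟩
      ext i; fin_cases i <;> simp [e0, e1])
    (fun q => by simp [verticalCLM_apply, planeEmbeddingCLM_apply, planeEmbedding])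
    (fun q => planeProjection_planeEmbedding q)
    (fun L => by
      rw [det_eq_det_inner, det_eq_det_inner L, Matrix.det_fin_three, Matrix.det_fin_two]
      have p0 : planeProjection (EuclideanSpace.single 0 1) = EuclideanSpace.single 0 1 := by
        ext i; fin_cases i <;> simp [planeProjection]
      have p1 : planeProjection (EuclideanSpace.single 1 1) = EuclideanSpace.single 1 1 := by
        ext i; fin_cases i <;> simp [planeProjection]
      have p2 : planeProjection (EuclideanSpace.single 2 1) = 0 := by
        ext i; fin_cases i <;> simp [planeProjection]
      simp [EuclideanSpace.inner_single_left, verticalCLM_apply, planeEmbeddingCLM_apply,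
        planeProjectionCLM_apply, planeEmbedding, p0, p1, p2])
    hR₂ ((continuousOn_gradient hP.isOpen hP.contDiffOn).mono hsub₂) hz₂
  rw [← hsus, planeEmbeddingCLM_apply, hemb]
  obtain ⟨R₁, hR₁, hsub₁, hz₁⟩ := exists_isolating_ball h.isOpen hq₀ (h.isolated _ hq₀ hcrit)
  have hnear : ∀ᶠ q in 𝓝 q₀, 0 < hessianMatrix V q 2 2 ∧
      planeProjectionCLM q ∈ Metric.ball (planeProjection q₀) R₂ :=
    ((continuousAt_hessianMatrix h.isOpen h.contDiffOn hq₀ 2 2).eventually_const_lt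
      (h.vertical_attraction q₀ hq₀ hcrit)).and
    (planeProjectionCLM.continuous.continuousAt.preimage_mem_nhds
      (Metric.isOpen_ball.mem_nhds (Metric.mem_ball_self hR₂)))
  obtain ⟨δ, hδ, hball⟩ := Metric.eventually_nhds_iff_ball.1 hnear
  set r := min R₁ (δ / 2)
  have hr : 0 < r := lt_min hR₁ (half_pos hδ)
  have hrδ : ∀ q ∈ Metric.closedBall q₀ r, q ∈ Metric.ball q₀ δ := fun q hq =>
    lt_of_le_of_lt (le_trans hq (min_le_right _ _)) (half_lt_self hδ)
  have hrR : Metric.closedBall q₀ r ⊆ Metric.closedBall q₀ R₁ :=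
    Metric.closedBall_subset_closedBall (min_le_left _ _)
  refine brouwerIndex_eq_of_segment hr ((continuousOn_gradient h.isOpen h.contDiffOn).mono
    (hrR.trans hsub₁)) ?_ fun t ht q hq heq => ?_
  · exact verticalCLM.continuous.continuousOn.add (planeEmbeddingCLM.continuous.comp_continuousOn
      (((continuousOn_gradient hP.isOpen hP.contDiffOn).mono hsub₂).comp
        planeProjectionCLM.continuous.continuousOn
        fun q hq => Metric.ball_subset_closedBall (hball q (hrδ q hq)).2))
  -- The vertical component multiplied by z is (1 − t) z ∂V/∂z + t z², which is positive when z ≠ 0.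
  · have hq2 : q 2 = 0 := by
      by_contra hne
      have hpos := vertical_mul_gradient_pos h h0 (hrR.trans hsub₁)
        (fun x hx => (hball x (hrδ x hx)).1) hq hne
      have e2 := congrArg (fun v => v 2) heq
      simp [verticalCLM_apply, planeEmbeddingCLM_apply, planeEmbedding] at e2
      have hsq : 0 < q 2 * q 2 := mul_self_pos.2 hne
      have hcomb : (1 - t) * (q 2 * gradient V q 2) + t * (q 2 * q 2) = 0 := by
        linear_combination (q 2) * e2
      rcases eq_or_lt_of_le ht.1 with rfl | ht0
      · linarith
      · nlinarith [mul_pos ht0 hsq, mul_nonneg (sub_nonneg.2 ht.2) hpos.le]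
    have hqe := planeEmbedding_planeProjection hq2
    have hqΩ : planeEmbedding (planeProjection q) ∈ Ω := by
      rw [hqe]; exact hsub₁ (hrR hq)
    have hsame : verticalCLM q + planeEmbeddingCLM
        (gradient (planarRestriction V) (planeProjectionCLM q)) = gradient V q := by
      have hg2 := h.planar_invariant _ hqΩ
      rw [verticalCLM_apply, hq2, zero_smul, zero_add, planeProjectionCLM_apply,
        gradient_planarRestriction h.isOpen h.contDiffOn hqΩ, planeEmbeddingCLM_apply,
        planeEmbedding_planeProjection hg2, hqe]
    rw [hsame, sub_self, smul_zero, add_zero] at heq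
    exact hz₁ q (hrR hq) heq

end SpatialReduction

/-! ### Critical frequencies, periods and regions. -/

section Frequencies

/-- `n` is the number of negative eigenvalues of the reduced planar matrix at the squared
frequency `w`, where that matrix is nondegenerate. -/
def IsPlanarCount (β₁ β₂ w : ℝ) (n : ℕ) : Prop :=
  (n = 2 ∧ w ^ 2 - (β₁ + β₂ + 4) * w + β₁ * β₂ < 0) ∨
  (n = 0 ∧ 0 < w ^ 2 - (β₁ + β₂ + 4) * w + β₁ * β₂ ∧ 0 < 2 * w - (β₁ + β₂)) ∨
  (n = 4 ∧ 0 < w ^ 2 - (β₁ + β₂ + 4) * w + β₁ * β₂ ∧ 2 * w - (β₁ + β₂) < 0)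

/-- Translates the periods T± into roots of the quadratic in w = (2π/T)². -/
theorem eq_mul_rpow_neg_half_iff {T x : ℝ} (hT : 0 < T) :
    T = 2 * Real.pi * √2 * x ^ (-1 / 2 : ℝ) ↔ x = 2 * (2 * Real.pi / T) ^ 2 := by
  have hpi := Real.pi_pos
  have h2 : √2 ^ 2 = (2 : ℝ) := Real.sq_sqrt (by norm_num)
  have hs2 : 0 < √2 := by positivity
  constructor
  · intro h
    have hx : 0 < x := by
      -- For x ≤ 0 the real power takes the default value 0, or a multiple of cos(π/2) = 0, so it
      -- cannot produce a positive period.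
      by_contra hx
      rcases (not_lt.1 hx).eq_or_lt with rfl | hx
      · rw [Real.zero_rpow (by norm_num), mul_zero] at h
        exact hT.ne' h
      · rw [Real.rpow_def_of_neg hx, show (-1 / 2 : ℝ) * Real.pi = -(Real.pi / 2) by ring,
          Real.cos_neg, Real.cos_pi_div_two, mul_zero, mul_zero] at h
        exact hT.ne' h
    rw [neg_div, Real.rpow_neg hx.le, ← Real.sqrt_eq_rpow] at h
    have hsx : 0 < √x := Real.sqrt_pos.2 hx
    have hsq : √x ^ 2 = x := Real.sq_sqrt hx.le
    rw [h]
    field_simp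
    rw [h2, hsq]
    ring
  · intro h
    have hx : 0 < x := by rw [h]; positivity
    have hsx : √x = √2 * (2 * Real.pi / T) := by
      rw [h, Real.sqrt_mul (by norm_num), Real.sqrt_sq (by positivity)]
    rw [neg_div, Real.rpow_neg hx.le, ← Real.sqrt_eq_rpow, hsx]
    field_simp

theorem eq_two_pi_div_sqrt_iff {T β : ℝ} (hT : 0 < T) (hβ : 0 < β) :
    T = 2 * Real.pi / √β ↔ (2 * Real.pi / T) ^ 2 = β := by
  have hpi := Real.pi_pos
  have hs : 0 < √β := Real.sqrt_pos.2 hβ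
  constructor
  · intro h
    have : 2 * Real.pi / T = √β := by rw [h]; field_simp
    rw [this, Real.sq_sqrt hβ.le]
  · intro h
    rw [← h, Real.sqrt_sq (by positivity)]
    field_simp

/-- The frequency decreases in the period: T + ε lies to the left of the critical frequency and T −
ε to its right. -/
theorem tendsto_frequency_add {T : ℝ} (hT : 0 < T) :
    Tendsto (fun ε => (2 * Real.pi / (T + ε)) ^ 2) (𝓝[>] 0) (𝓝[<] ((2 * Real.pi / T) ^ 2)) := by
  have hpi := Real.pi_pos
  refine tendsto_nhdsWithin_iff.2 ⟨?_, ?_⟩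
  · have hc : ContinuousAt (fun ε => (2 * Real.pi / (T + ε)) ^ 2) 0 :=
      (continuousAt_const.div (by fun_prop) (by simpa using hT.ne')).pow 2
    have := hc.tendsto
    rw [add_zero] at this
    exact this.mono_left nhdsWithin_le_nhds
  · filter_upwards [self_mem_nhdsWithin] with ε (hε : 0 < ε)
    have h1 : 2 * Real.pi / (T + ε) < 2 * Real.pi / T :=
      div_lt_div_of_pos_left (by positivity) hT (by linarith)
    exact pow_lt_pow_left₀ h1 (by positivity) two_ne_zero

theorem tendsto_frequency_sub {T : ℝ} (hT : 0 < T) :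
    Tendsto (fun ε => (2 * Real.pi / (T - ε)) ^ 2) (𝓝[>] 0) (𝓝[>] ((2 * Real.pi / T) ^ 2)) := by
  have hpi := Real.pi_pos
  refine tendsto_nhdsWithin_iff.2 ⟨?_, ?_⟩
  · have hc : ContinuousAt (fun ε => (2 * Real.pi / (T - ε)) ^ 2) 0 :=
      (continuousAt_const.div (by fun_prop) (by simpa using hT.ne')).pow 2
    have := hc.tendsto
    rw [sub_zero] at this
    exact this.mono_left nhdsWithin_le_nhds
  · filter_upwards [Ioo_mem_nhdsGT hT] with ε hε
    have h1 : 2 * Real.pi / T < 2 * Real.pi / (T - ε) :=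
      div_lt_div_of_pos_left (by positivity) (by linarith [hε.2]) (by linarith [hε.1])
    exact pow_lt_pow_left₀ h1 (by positivity) two_ne_zero

/-- These weak inequalities suffice to keep certain points of the axes off the frontier and to make
both eigenvalues negative on the closure off the axes. -/
theorem closure_region0_subset :
    closure region0 ⊆ {b : ℝ × ℝ | b.1 ≤ 0 ∧ b.2 ≤ 0 ∧
      (b.1 + b.2 + 4 ≤ 0 ∨ b.1 + b.2 + 2 + (b.1 - b.2) ^ 2 / 8 ≤ 0)} := by
  refine closure_minimal (fun b hb => ⟨hb.1.le, hb.2.1.le, ?_⟩) ?_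
  · rcases lt_max_iff.1 hb.2.2 with h | h
    · left; linarith
    · right; linarith
  · have h1 : IsClosed {b : ℝ × ℝ | b.1 ≤ 0} := isClosed_le (by fun_prop) (by fun_prop)
    have h2 : IsClosed {b : ℝ × ℝ | b.2 ≤ 0} := isClosed_le (by fun_prop) (by fun_prop)
    have h3 : IsClosed {b : ℝ × ℝ | b.1 + b.2 + 4 ≤ 0} := isClosed_le (by fun_prop) (by fun_prop)
    have h4 : IsClosed {b : ℝ × ℝ | b.1 + b.2 + 2 + (b.1 - b.2) ^ 2 / 8 ≤ 0} :=
      isClosed_le (by fun_prop) (by fun_prop)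
    exact h1.inter (h2.inter (h3.union h4))

/-- The number of negative eigenvalues of the reduced planar matrix on both sides of a
frequency. -/
theorem exists_isPlanarCount (β₁ β₂ : ℝ) {w₀ : ℝ} (hw₀ : 0 < w₀) : ∃ l r : ℕ,
    (∀ᶠ w in 𝓝[<] w₀, IsPlanarCount β₁ β₂ w l) ∧ (∀ᶠ w in 𝓝[>] w₀, IsPlanarCount β₁ β₂ w r) ∧
    (((w₀ ^ 2 - (β₁ + β₂ + 4) * w₀ + β₁ * β₂ ≠ 0 ∨ 2 * w₀ = β₁ + β₂ + 4) ∧ l = r) ∨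
      (w₀ ^ 2 - (β₁ + β₂ + 4) * w₀ + β₁ * β₂ = 0 ∧ β₁ + β₂ + 4 < 2 * w₀ ∧ l = 2 ∧ r = 0) ∨
      (w₀ ^ 2 - (β₁ + β₂ + 4) * w₀ + β₁ * β₂ = 0 ∧ 2 * w₀ < β₁ + β₂ + 4 ∧
        0 < 2 * w₀ - (β₁ + β₂) ∧ l = 0 ∧ r = 2) ∨
      (w₀ ^ 2 - (β₁ + β₂ + 4) * w₀ + β₁ * β₂ = 0 ∧ 2 * w₀ < β₁ + β₂ + 4 ∧
        2 * w₀ - (β₁ + β₂) < 0 ∧ l = 4 ∧ r = 2)) := by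
  have hDc : Continuous fun w : ℝ => w ^ 2 - (β₁ + β₂ + 4) * w + β₁ * β₂ := by fun_prop
  have hθc : Continuous fun w : ℝ => 2 * w - (β₁ + β₂) := by fun_prop
  have hθpos : 0 < 2 * w₀ - (β₁ + β₂) → ∀ᶠ w in 𝓝 w₀, 0 < 2 * w - (β₁ + β₂) := fun h =>
    hθc.continuousAt.eventually_const_lt h
  have hθneg : 2 * w₀ - (β₁ + β₂) < 0 → ∀ᶠ w in 𝓝 w₀, 2 * w - (β₁ + β₂) < 0 := fun h =>
    hθc.continuousAt.eventually_lt_const h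
  by_cases hD : w₀ ^ 2 - (β₁ + β₂ + 4) * w₀ + β₁ * β₂ = 0
  -- The other root of the quadratic is β₁ + β₂ + 4 − w₀, by Vieta.
  · have hfac : ∀ w : ℝ, w ^ 2 - (β₁ + β₂ + 4) * w + β₁ * β₂ =
        (w - w₀) * (w - (β₁ + β₂ + 4 - w₀)) := fun w => by linear_combination hD
    have hlt : ∀ᶠ w in 𝓝[<] w₀, w < w₀ := self_mem_nhdsWithin
    have hgt : ∀ᶠ w in 𝓝[>] w₀, w₀ < w := self_mem_nhdsWithin
    rcases lt_trichotomy (2 * w₀) (β₁ + β₂ + 4) with h | h | h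
    · have hother : ∀ᶠ w in 𝓝 w₀, w < β₁ + β₂ + 4 - w₀ :=
        eventually_lt_nhds (by linarith)
      have hDl : ∀ᶠ w in 𝓝[<] w₀, 0 < w ^ 2 - (β₁ + β₂ + 4) * w + β₁ * β₂ := by
        filter_upwards [hlt, hother.filter_mono nhdsWithin_le_nhds] with w h1 h2
        rw [hfac]
        exact mul_pos_of_neg_of_neg (by linarith) (by linarith)
      have hDr : ∀ᶠ w in 𝓝[>] w₀, w ^ 2 - (β₁ + β₂ + 4) * w + β₁ * β₂ < 0 := by
        filter_upwards [hgt, hother.filter_mono nhdsWithin_le_nhds] with w h1 h2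
        rw [hfac]
        exact mul_neg_of_pos_of_neg (by linarith) (by linarith)
      -- If 2w₀ = β₁ + β₂, the quadratic at w₀ equals −(w₀ − β₁)² − 4w₀ < 0.
      have hθ : 2 * w₀ - (β₁ + β₂) ≠ 0 := by
        intro h0
        have hβ : β₂ = 2 * w₀ - β₁ := by linarith
        subst hβ
        nlinarith [sq_nonneg (w₀ - β₁)]
      rcases hθ.lt_or_gt with hθ | hθ
      · refine ⟨4, 2, ?_, hDr.mono fun w hw => Or.inl ⟨rfl, hw⟩,
          Or.inr (Or.inr (Or.inr ⟨hD, h, hθ, rfl, rfl⟩))⟩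
        filter_upwards [hDl, (hθneg hθ).filter_mono nhdsWithin_le_nhds] with w h1 h2
        exact Or.inr (Or.inr ⟨rfl, h1, h2⟩)
      · refine ⟨0, 2, ?_, hDr.mono fun w hw => Or.inl ⟨rfl, hw⟩,
          Or.inr (Or.inr (Or.inl ⟨hD, h, hθ, rfl, rfl⟩))⟩
        filter_upwards [hDl, (hθpos hθ).filter_mono nhdsWithin_le_nhds] with w h1 h2
        exact Or.inr (Or.inl ⟨rfl, h1, h2⟩)
    -- A double root: the quadratic is positive on both sides and the index does not change.
    · have hθ := hθpos (by linarith)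
      have hD' : ∀ w, w ≠ w₀ → 0 < w ^ 2 - (β₁ + β₂ + 4) * w + β₁ * β₂ := by
        intro w hw
        rw [hfac, show β₁ + β₂ + 4 - w₀ = w₀ by linarith]
        exact mul_self_pos.2 (sub_ne_zero.2 hw)
      refine ⟨0, 0, ?_, ?_, Or.inl ⟨Or.inr h, rfl⟩⟩
      · filter_upwards [hlt, hθ.filter_mono nhdsWithin_le_nhds] with w h1 h2
        exact Or.inr (Or.inl ⟨rfl, hD' w h1.ne, h2⟩)
      · filter_upwards [hgt, hθ.filter_mono nhdsWithin_le_nhds] with w h1 h2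
        exact Or.inr (Or.inl ⟨rfl, hD' w h1.ne', h2⟩)
    · have hθ := hθpos (by linarith)
      have hother : ∀ᶠ w in 𝓝 w₀, β₁ + β₂ + 4 - w₀ < w :=
        eventually_gt_nhds (by linarith)
      refine ⟨2, 0, ?_, ?_, Or.inr (Or.inl ⟨hD, h, rfl, rfl⟩)⟩
      · filter_upwards [hlt, hother.filter_mono nhdsWithin_le_nhds] with w h1 h2
        refine Or.inl ⟨rfl, ?_⟩
        rw [hfac]
        exact mul_neg_of_neg_of_pos (by linarith) (by linarith)
      · filter_upwards [hgt, hother.filter_mono nhdsWithin_le_nhds,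
          hθ.filter_mono nhdsWithin_le_nhds] with w h1 h2 h3
        refine Or.inr (Or.inl ⟨rfl, ?_, h3⟩)
        rw [hfac]
        exact mul_pos (by linarith) (by linarith)
  · suffices h : ∃ n, ∀ᶠ w in 𝓝 w₀, IsPlanarCount β₁ β₂ w n by
      obtain ⟨n, hn⟩ := h
      exact ⟨n, n, hn.filter_mono nhdsWithin_le_nhds, hn.filter_mono nhdsWithin_le_nhds,
        Or.inl ⟨Or.inl hD, rfl⟩⟩
    rcases lt_or_gt_of_ne hD with hD | hD
    · exact ⟨2, (hDc.continuousAt.eventually_lt_const hD).mono fun w hw => Or.inl ⟨rfl, hw⟩⟩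
    · have hDe := hDc.continuousAt.eventually_const_lt hD
      have hθ : 2 * w₀ - (β₁ + β₂) ≠ 0 := by
        intro h0
        have hβ : β₂ = 2 * w₀ - β₁ := by linarith
        subst hβ
        nlinarith [sq_nonneg (w₀ - β₁)]
      rcases hθ.lt_or_gt with hθ | hθ
      · exact ⟨4, (hDe.and (hθneg hθ)).mono fun w hw => Or.inr (Or.inr ⟨rfl, hw⟩)⟩
      · exact ⟨0, (hDe.and (hθpos hθ)).mono fun w hw => Or.inr (Or.inl ⟨rfl, hw⟩)⟩

/-- The regions in which the period `T₋` is used. -/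
def minusRegion : Set (ℝ × ℝ) :=
  ((region2 ∪ region4) ∪ (region1 ∪ region3)) ∪ (axesC \ frontier region0)

/-- Here `l` belongs to periods just above T and `r` to those just below. The discriminant of the
quadratic is 8X, so T₋ means that w₀ is its larger root and T₊ that it is the smaller one. -/
theorem planarCount_jump {β₁ β₂ T : ℝ} (hT : 0 < T) {l r : ℕ}
    (hlr : let w₀ := (2 * Real.pi / T) ^ 2
      ((w₀ ^ 2 - (β₁ + β₂ + 4) * w₀ + β₁ * β₂ ≠ 0 ∨ 2 * w₀ = β₁ + β₂ + 4) ∧ l = r) ∨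
      (w₀ ^ 2 - (β₁ + β₂ + 4) * w₀ + β₁ * β₂ = 0 ∧ β₁ + β₂ + 4 < 2 * w₀ ∧ l = 2 ∧ r = 0) ∨
      (w₀ ^ 2 - (β₁ + β₂ + 4) * w₀ + β₁ * β₂ = 0 ∧ 2 * w₀ < β₁ + β₂ + 4 ∧
        0 < 2 * w₀ - (β₁ + β₂) ∧ l = 0 ∧ r = 2) ∨
      (w₀ ^ 2 - (β₁ + β₂ + 4) * w₀ + β₁ * β₂ = 0 ∧ 2 * w₀ < β₁ + β₂ + 4 ∧
        2 * w₀ - (β₁ + β₂) < 0 ∧ l = 4 ∧ r = 2)) :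
    ((β₁, β₂) ∈ minusRegion → T = periodMinus (β₁, β₂) → ((l : ℝ) - r) / 2 = 1) ∧
    ((β₁, β₂) ∈ region1 → T = periodPlus (β₁, β₂) → ((l : ℝ) - r) / 2 = 1) ∧
    ((β₁, β₂) ∈ region3 → T = periodPlus (β₁, β₂) → ((l : ℝ) - r) / 2 = -1) ∧
    (¬ ((β₁, β₂) ∈ minusRegion ∧ T = periodMinus (β₁, β₂)) →
      ¬ ((β₁, β₂) ∈ region1 ∧ T = periodPlus (β₁, β₂)) →
      ¬ ((β₁, β₂) ∈ region3 ∧ T = periodPlus (β₁, β₂)) → ((l : ℝ) - r) / 2 = 0) := by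
  have hpi := Real.pi_pos
  set w₀ := (2 * Real.pi / T) ^ 2 with hw₀def
  have hw₀ : 0 < w₀ := by positivity
  set X := β₁ + β₂ + 2 + (β₁ - β₂) ^ 2 / 8 with hX
  set Δ := 2 * √2 * √X with hΔ
  have hΔ0 : 0 ≤ Δ := by positivity
  have hΔsq : 0 ≤ X → Δ ^ 2 = 8 * X := by
    intro h
    rw [hΔ, mul_pow, mul_pow, Real.sq_sqrt h, Real.sq_sqrt (by norm_num)]
    ring
  have h8X : 8 * X = (β₁ + β₂ + 4) ^ 2 - 4 * (β₁ * β₂) := by rw [hX]; ring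
  have hminus : T = periodMinus (β₁, β₂) ↔ β₁ + β₂ + 4 + Δ = 2 * w₀ :=
    eq_mul_rpow_neg_half_iff hT
  have hplus : T = periodPlus (β₁, β₂) ↔ β₁ + β₂ + 4 - Δ = 2 * w₀ :=
    eq_mul_rpow_neg_half_iff hT
  have hΔpos : 0 < X → 0 < Δ := fun h => by positivity
  have hX3 : (β₁, β₂) ∈ region3 → 0 < X := fun h => by
    have := (max_lt_iff.1 h.2.2).2
    simp only at this
    linarith
  have hX1 : (β₁, β₂) ∈ region1 → 0 < X := fun h => by
    have h1 : 0 < β₁ := h.1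
    have h2 : 0 < β₂ := h.2
    positivity
  have hDplus : 0 ≤ X → β₁ + β₂ + 4 - Δ = 2 * w₀ →
      w₀ ^ 2 - (β₁ + β₂ + 4) * w₀ + β₁ * β₂ = 0 := by
    intro hX0 h
    have h1 := hΔsq hX0
    have h2 : Δ = β₁ + β₂ + 4 - 2 * w₀ := by linarith
    rw [h2, h8X] at h1
    linarith
  refine ⟨fun hb hTm => ?_, fun hb hTp => ?_, fun hb hTp => ?_, fun hA hB hC => ?_⟩
  · rw [hminus] at hTm
    have hXpos : 0 < X := by
      rcases hb with (hb | hb) | hb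
      · have : β₁ * β₂ < 0 := by
          rcases hb with hb | hb
          · exact mul_neg_of_neg_of_pos hb.1 hb.2
          · exact mul_neg_of_pos_of_neg hb.1 hb.2
        nlinarith [sq_nonneg (β₁ + β₂ + 4)]
      · exact hb.elim hX1 hX3
      · have h0 : β₁ * β₂ = 0 := by
          rcases hb.1 with h | h
          · exact mul_eq_zero_of_right _ h
          · exact mul_eq_zero_of_left h _
        rw [h0] at h8X
        have hX0 : 0 ≤ X := by nlinarith [sq_nonneg (β₁ + β₂ + 4)]
        -- On the axes X = 0 forces β₁ + β₂ + 4 = 0, and then T₋ would correspond to w₀ = 0.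
        refine lt_of_le_of_ne hX0 fun hz => ?_
        have hs : β₁ + β₂ + 4 = 0 := by
          rw [← hz] at h8X
          exact pow_eq_zero_iff two_ne_zero |>.1 (by linarith)
        rw [hΔ, ← hz, Real.sqrt_zero, mul_zero, hs] at hTm
        linarith
    have h1 := hΔsq hXpos.le
    have h2 : Δ = 2 * w₀ - (β₁ + β₂ + 4) := by linarith
    have hD : w₀ ^ 2 - (β₁ + β₂ + 4) * w₀ + β₁ * β₂ = 0 := by
      rw [h2, h8X] at h1
      linarith
    have h3 := hΔpos hXpos
    rcases hlr with ⟨h | h, -⟩ | ⟨-, -, rfl, rfl⟩ | ⟨-, h, -⟩ | ⟨-, h, -⟩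
    · exact absurd hD h
    · linarith
    · norm_num
    · linarith
    · linarith
  · rw [hplus] at hTp
    have hD := hDplus (hX1 hb).le hTp
    have h3 := hΔpos (hX1 hb)
    have hb1 : 0 < β₁ := hb.1
    have hb2 : 0 < β₂ := hb.2
    -- At βᵢ the quadratic equals −4βᵢ < 0, so both eigenvalues exceed the smaller root and θ is
    -- negative there.
    have hlt1 : w₀ < β₁ := by nlinarith
    have hlt2 : w₀ < β₂ := by nlinarith
    rcases hlr with ⟨h | h, -⟩ | ⟨-, h, -, -⟩ | ⟨-, -, h, -⟩ | ⟨-, -, -, rfl, rfl⟩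
    · exact absurd hD h
    · linarith
    · linarith
    · linarith
    · norm_num
  · rw [hplus] at hTp
    have hD := hDplus (hX3 hb).le hTp
    have h3 := hΔpos (hX3 hb)
    have hb1 : β₁ < 0 := hb.1
    have hb2 : β₂ < 0 := hb.2.1
    rcases hlr with ⟨h | h, -⟩ | ⟨-, h, -, -⟩ | ⟨-, -, -, rfl, rfl⟩ | ⟨-, -, h, -⟩
    · exact absurd hD h
    · linarith
    · linarith
    · norm_num
    · linarith
  · have hquad : w₀ ^ 2 - (β₁ + β₂ + 4) * w₀ + β₁ * β₂ = 0 →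
        8 * X = (2 * w₀ - (β₁ + β₂ + 4)) ^ 2 := fun hD => by
      rw [h8X]; linear_combination (-4 : ℝ) * hD
    have hsame : 0 < X → 0 < β₁ * β₂ → 0 < β₁ + β₂ + 4 →
        (β₁, β₂) ∈ region1 ∨ (β₁, β₂) ∈ region3 := by
      intro hX0 hp hs
      rcases mul_pos_iff.1 hp with ⟨h1, h2⟩ | ⟨h1, h2⟩
      · exact Or.inl ⟨h1, h2⟩
      · refine Or.inr ⟨h1, h2, max_lt (by simp only; linarith) (by simp only; linarith)⟩
    -- If w₀ > 0 is the smaller root, both roots are positive; so are their product β₁β₂ and their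
    -- sum, which places the pair in the first or third region with T = T₊.
    have hfour : w₀ ^ 2 - (β₁ + β₂ + 4) * w₀ + β₁ * β₂ = 0 → 2 * w₀ < β₁ + β₂ + 4 → False := by
      intro hD h
      have hXq := hquad hD
      have hXpos : 0 < X := by nlinarith [mul_pos (sub_pos.2 h) (sub_pos.2 h)]
      have hΔeq : Δ = β₁ + β₂ + 4 - 2 * w₀ := by
        refine (pow_left_inj₀ hΔ0 (by linarith) two_ne_zero).1 ?_
        rw [hΔsq hXpos.le, hXq]; ring
      have hprod : 0 < β₁ * β₂ := by nlinarith
      have hT' : T = periodPlus (β₁, β₂) := hplus.2 (by linarith)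
      rcases hsame hXpos hprod (by linarith) with h1 | h3
      · exact hB ⟨h1, hT'⟩
      · exact hC ⟨h3, hT'⟩
    rcases hlr with ⟨-, rfl⟩ | ⟨hD, h, -⟩ | ⟨hD, h, -⟩ | ⟨hD, h, -⟩
    · simp
    · exfalso
      have hXq := hquad hD
      have hXpos : 0 < X := by nlinarith [mul_pos (sub_pos.2 h) (sub_pos.2 h)]
      have hΔeq : Δ = 2 * w₀ - (β₁ + β₂ + 4) := by
        refine (pow_left_inj₀ hΔ0 (by linarith) two_ne_zero).1 ?_
        rw [hΔsq hXpos.le, hXq]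
      refine hA ⟨?_, hminus.2 (by linarith)⟩
      have hprod : β₁ * β₂ = w₀ * (β₁ + β₂ + 4 - w₀) := by linarith
      rcases lt_trichotomy (β₁ * β₂) 0 with hp | hp | hp
      · refine Or.inl (Or.inl ?_)
        rcases mul_neg_iff.1 hp with ⟨h1, h2⟩ | ⟨h1, h2⟩
        · exact Or.inr ⟨h1, h2⟩
        · exact Or.inl ⟨h1, h2⟩
      · refine Or.inr ⟨?_, fun hf => ?_⟩
        · rcases mul_eq_zero.1 hp with h | h
          · exact Or.inr h
          · exact Or.inl h
        -- On the axes the other root is 0, hence β₁ + β₂ + 4 = w₀ > 0; together with X > 0 this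
        -- excludes the closure of the region.
        · have hs : β₁ + β₂ + 4 - w₀ = 0 := by
            rcases mul_eq_zero.1 (hprod.symm.trans hp) with h | h
            · exact absurd h hw₀.ne'
            · exact h
          obtain ⟨-, -, h | h⟩ := closure_region0_subset (frontier_subset_closure hf)
          · simp only at h; linarith
          · simp only at h; linarith
      · have : 0 < β₁ + β₂ + 4 - w₀ := by
          rw [hprod] at hp
          exact (pos_iff_pos_of_mul_pos hp).1 hw₀
        exact Or.inl (Or.inr (hsame hXpos hp (by linarith)))
    · exact (hfour hD h).elim
    · exact (hfour hD h).elim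

end Frequencies

/-! ### Assembly of index and jump. -/

section BifurcationNumbers

theorem alpha2_transpose : alpha2ᵀ = -alpha2 := by
  ext i j; fin_cases i <;> fin_cases j <;> simp [alpha2]

theorem alpha3_transpose : alpha3ᵀ = -alpha3 := by
  ext i j; fin_cases i <;> fin_cases j <;> simp [alpha3]

theorem IsPlanarCount.morseIndex_eq {B : Matrix (Fin 2) (Fin 2) ℝ} (hB : Bᵀ = B) {β₁ β₂ : ℝ}
    (h : B.charpoly.roots = {β₁, β₂}) {T : ℝ} (hT : 0 < T) {n : ℕ}
    (hn : IsPlanarCount β₁ β₂ ((2 * Real.pi / T) ^ 2) n) :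
    morseIndex (reducedMatrix alpha2 B (T / (2 * Real.pi))) = n := by
  have hpi := Real.pi_pos
  obtain ⟨h1, h2, h3⟩ := morseIndex_reducedMatrix_alpha2 hB h (τ := T / (2 * Real.pi))
    (w := (2 * Real.pi / T) ^ 2) (by positivity) (by field_simp)
  rcases hn with ⟨rfl, hD⟩ | ⟨rfl, hD, hθ⟩ | ⟨rfl, hD, hθ⟩
  · exact h1 hD
  · exact h2 hD hθ
  · exact h3 hD hθ

/-- Near a positive period, the Morse index of the reduced planar matrix is constant on both
sides, with the jump prescribed by the regions. -/
theorem exists_planar_jump {B : Matrix (Fin 2) (Fin 2) ℝ} (hB : Bᵀ = B) {β₁ β₂ : ℝ}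
    (h : B.charpoly.roots = {β₁, β₂}) {T : ℝ} (hT : 0 < T) : ∃ j : ℝ,
    (∀ᶠ ε in 𝓝[>] (0 : ℝ),
      ((morseIndex (reducedMatrix alpha2 B ((T + ε) / (2 * Real.pi))) : ℝ) -
        morseIndex (reducedMatrix alpha2 B ((T - ε) / (2 * Real.pi)))) / 2 = j) ∧
    ((β₁, β₂) ∈ minusRegion → T = periodMinus (β₁, β₂) → j = 1) ∧
    ((β₁, β₂) ∈ region1 → T = periodPlus (β₁, β₂) → j = 1) ∧
    ((β₁, β₂) ∈ region3 → T = periodPlus (β₁, β₂) → j = -1) ∧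
    (¬ ((β₁, β₂) ∈ minusRegion ∧ T = periodMinus (β₁, β₂)) →
      ¬ ((β₁, β₂) ∈ region1 ∧ T = periodPlus (β₁, β₂)) →
      ¬ ((β₁, β₂) ∈ region3 ∧ T = periodPlus (β₁, β₂)) → j = 0) := by
  have hpi := Real.pi_pos
  obtain ⟨l, r, hl, hr, hlr⟩ := exists_isPlanarCount β₁ β₂
    (show 0 < (2 * Real.pi / T) ^ 2 by positivity)
  refine ⟨((l : ℝ) - r) / 2, ?_, planarCount_jump hT hlr⟩
  filter_upwards [(tendsto_frequency_add hT).eventually hl, (tendsto_frequency_sub hT).eventually hr,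
    Ioo_mem_nhdsGT hT] with ε h1 h2 hε
  rw [h1.morseIndex_eq hB h (by linarith [hε.1]), h2.morseIndex_eq hB h (by linarith [hε.2])]

theorem bifurcationNumber_eq {N : ℕ} {H : EuclideanSpace ℝ (Fin N ⊕ Fin N) → ℝ} {T : ℝ}
    {u₀ : EuclideanSpace ℝ (Fin N ⊕ Fin N)} {j : ℝ}
    (h : Tendsto (morseJump H T u₀) (𝓝[>] 0) (𝓝 j)) :
    bifurcationNumber H T u₀ = brouwerIndex u₀ (gradient H) * j := by
  rw [bifurcationNumber, h.limUnder_eq]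

/-- The contribution of the momenta is the same on both sides of T and cancels. -/
theorem tendsto_morseJump_planar {Ω : Set (EuclideanSpace ℝ (Fin 2))}
    {V : EuclideanSpace ℝ (Fin 2) → ℝ} (h : PlanarSystem Ω V) {q₀ : EuclideanSpace ℝ (Fin 2)}
    (hq₀ : q₀ ∈ Ω) {T j : ℝ} (hT : 0 < T)
    (hj : ∀ᶠ ε in 𝓝[>] (0 : ℝ),
      ((morseIndex (reducedMatrix alpha2 (hessianMatrix V q₀) ((T + ε) / (2 * Real.pi))) : ℝ) -
        morseIndex (reducedMatrix alpha2 (hessianMatrix V q₀) ((T - ε) / (2 * Real.pi)))) / 2 = j) :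
    Tendsto (morseJump (coriolisHamiltonian alpha2 V) T (phaseEquilibrium alpha2 q₀))
      (𝓝[>] 0) (𝓝 j) := by
  refine tendsto_const_nhds.congr' ?_
  filter_upwards [hj, Ioo_mem_nhdsGT hT] with ε h1 hε
  have hB := hessianMatrix_transpose h.isOpen h.contDiffOn hq₀
  rw [morseJump, hessianMatrix_coriolisHamiltonian alpha2_transpose h.isOpen h.contDiffOn hq₀,
    morseIndex_szulkinMatrix alpha2_transpose hB (by linarith [hε.1]),
    morseIndex_szulkinMatrix alpha2_transpose hB (by linarith [hε.2]), ← h1]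
  push_cast
  ring

theorem gamma2_eq {Ω : Set (EuclideanSpace ℝ (Fin 2))}
    {V : EuclideanSpace ℝ (Fin 2) → ℝ} (h : PlanarSystem Ω V) {q₀ : EuclideanSpace ℝ (Fin 2)}
    (hq₀ : q₀ ∈ Ω) (hcrit : gradient V q₀ = 0) {T j : ℝ}
    (hj : Tendsto (morseJump (coriolisHamiltonian alpha2 V) T (phaseEquilibrium alpha2 q₀))
      (𝓝[>] 0) (𝓝 j)) :
    gamma2 V T q₀ = brouwerIndex q₀ (gradient V) * j := by
  rw [gamma2, bifurcationNumber_eq hj, brouwerIndex_gradient_coriolisHamiltonian alpha2_transpose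
    h.isOpen h.contDiffOn hq₀ (h.isolated q₀ hq₀ hcrit)]

/-- Off the axes the Hessian is invertible and its determinant is β₁β₂. On the axes the index stays
undetermined, which is why it survives in the final formulas. -/
theorem brouwerIndex_planar {Ω : Set (EuclideanSpace ℝ (Fin 2))}
    {V : EuclideanSpace ℝ (Fin 2) → ℝ} (h : PlanarSystem Ω V) {q₀ : EuclideanSpace ℝ (Fin 2)}
    (hq₀ : q₀ ∈ Ω) (hcrit : gradient V q₀ = 0) {β₁ β₂ : ℝ}
    (hβ : (hessianMatrix V q₀).charpoly.roots = {β₁, β₂}) :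
    ((β₁, β₂) ∈ region2 ∪ region4 → brouwerIndex q₀ (gradient V) = -1) ∧
    ((β₁, β₂) ∈ region1 ∨ (β₁ < 0 ∧ β₂ < 0) → brouwerIndex q₀ (gradient V) = 1) := by
  have hdet := (trace_det_of_charpoly_roots hβ).2
  have key := brouwerIndex_gradient_eq_sign h.isOpen h.contDiffOn hq₀ hcrit
  rw [hdet] at key
  constructor
  · intro hb
    have hneg : β₁ * β₂ < 0 := by
      rcases hb with hb | hb
      · exact mul_neg_of_neg_of_pos hb.1 hb.2
      · exact mul_neg_of_pos_of_neg hb.1 hb.2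
    rw [key hneg.ne, sign_neg hneg]
    rfl
  · intro hb
    have hpos : 0 < β₁ * β₂ := by
      rcases hb with hb | hb
      · exact mul_pos hb.1 hb.2
      · exact mul_pos_of_neg_of_neg hb.1 hb.2
    rw [key hpos.ne', sign_pos hpos]
    rfl

/-- The vertical oscillation contributes a jump at the frequency `√β₃`. -/
theorem eventually_vertical_jump {T β : ℝ} (hT : 0 < T) :
    ∀ᶠ ε in 𝓝[>] (0 : ℝ),
      (((if ((T + ε) / (2 * Real.pi))⁻¹ - (T + ε) / (2 * Real.pi) * β < 0 then 2 else 0 : ℕ) : ℝ) -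
        (if ((T - ε) / (2 * Real.pi))⁻¹ - (T - ε) / (2 * Real.pi) * β < 0 then 2 else 0 : ℕ)) / 2 =
      if (2 * Real.pi / T) ^ 2 = β then 1 else 0 := by
  have hpi := Real.pi_pos
  have hiff : ∀ S : ℝ, 0 < S →
      ((S / (2 * Real.pi))⁻¹ - S / (2 * Real.pi) * β < 0 ↔ (2 * Real.pi / S) ^ 2 < β) := by
    intro S hS
    have hτ : 0 < S / (2 * Real.pi) := by positivity
    have : (S / (2 * Real.pi))⁻¹ - S / (2 * Real.pi) * β =
        S / (2 * Real.pi) * ((2 * Real.pi / S) ^ 2 - β) := by field_simp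
    rw [this, mul_neg_iff]
    constructor
    · rintro (⟨-, h⟩ | ⟨h, -⟩)
      · linarith
      · linarith
    · exact fun h => Or.inl ⟨hτ, by linarith⟩
  have hadd := tendsto_frequency_add hT
  have hsub := tendsto_frequency_sub hT
  set w₀ := (2 * Real.pi / T) ^ 2
  have hlow : ∀ᶠ ε in 𝓝[>] (0 : ℝ), (2 * Real.pi / (T + ε)) ^ 2 < w₀ :=
    hadd.eventually self_mem_nhdsWithin
  have hhigh : ∀ᶠ ε in 𝓝[>] (0 : ℝ), w₀ < (2 * Real.pi / (T - ε)) ^ 2 :=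
    hsub.eventually self_mem_nhdsWithin
  have hadd' := hadd.mono_right nhdsWithin_le_nhds
  have hsub' := hsub.mono_right nhdsWithin_le_nhds
  rcases lt_trichotomy w₀ β with hw | hw | hw
  · filter_upwards [hadd'.eventually_lt_const hw, hsub'.eventually_lt_const hw,
      Ioo_mem_nhdsGT hT] with ε h1 h2 hε
    rw [if_pos ((hiff _ (by linarith [hε.1])).2 h1), if_pos ((hiff _ (by linarith [hε.2])).2 h2),
      if_neg hw.ne]
    simp
  · filter_upwards [hlow, hhigh, Ioo_mem_nhdsGT hT] with ε h1 h2 hε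
    rw [if_pos ((hiff _ (by linarith [hε.1])).2 (hw ▸ h1)),
      if_neg fun h => ((hiff _ (by linarith [hε.2])).1 h).not_gt (hw ▸ h2), if_pos hw]
    norm_num
  · filter_upwards [hadd'.eventually_const_lt hw, hsub'.eventually_const_lt hw,
      Ioo_mem_nhdsGT hT] with ε h1 h2 hε
    rw [if_neg fun h => ((hiff _ (by linarith [hε.1])).1 h).not_gt h1,
      if_neg fun h => ((hiff _ (by linarith [hε.2])).1 h).not_gt h2, if_neg hw.ne']
    simp

theorem tendsto_morseJump_spatial {Ω : Set (EuclideanSpace ℝ (Fin 3))}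
    {V : EuclideanSpace ℝ (Fin 3) → ℝ} (h : SpatialSystem Ω V) {q₀ : EuclideanSpace ℝ (Fin 3)}
    (hq₀ : q₀ ∈ Ω) (hcrit : gradient V q₀ = 0) {T j : ℝ} (hT : 0 < T)
    (hj : ∀ᶠ ε in 𝓝[>] (0 : ℝ),
      ((morseIndex (reducedMatrix alpha2 (hessianMatrix (planarRestriction V) (planeProjection q₀))
          ((T + ε) / (2 * Real.pi))) : ℝ) -
        morseIndex (reducedMatrix alpha2 (hessianMatrix (planarRestriction V) (planeProjection q₀))
          ((T - ε) / (2 * Real.pi)))) / 2 = j) :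
    Tendsto (morseJump (coriolisHamiltonian alpha3 V) T (phaseEquilibrium alpha3 q₀))
      (𝓝[>] 0) (𝓝 (j + if (2 * Real.pi / T) ^ 2 = hessianMatrix V q₀ 2 2 then 1 else 0)) := by
  have hemb := planeEmbedding_planeProjection (h.planar_equilibria q₀ hq₀ hcrit)
  have hwΩ : planeEmbedding (planeProjection q₀) ∈ Ω := hemb.symm ▸ hq₀
  have hB := hessianMatrix_transpose h.isOpen h.contDiffOn hq₀
  have h02 : hessianMatrix V q₀ 0 2 = 0 := by
    have := hessianMatrix_castSucc_two h hwΩ 0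
    rwa [hemb] at this
  have h12 : hessianMatrix V q₀ 1 2 = 0 := by
    have := hessianMatrix_castSucc_two h hwΩ 1
    rwa [hemb] at this
  have h20 : hessianMatrix V q₀ 2 0 = 0 := (congrFun (congrFun hB 0) 2).trans h02
  have h21 : hessianMatrix V q₀ 2 1 = 0 := (congrFun (congrFun hB 1) 2).trans h12
  have hplane : !![hessianMatrix V q₀ 0 0, hessianMatrix V q₀ 0 1; hessianMatrix V q₀ 1 0,
      hessianMatrix V q₀ 1 1] = hessianMatrix (planarRestriction V) (planeProjection q₀) := by
    ext i j
    rw [hessianMatrix_planarRestriction h.isOpen h.contDiffOn hwΩ, hemb]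
    fin_cases i <;> fin_cases j <;> rfl
  refine tendsto_const_nhds.congr' ?_
  filter_upwards [hj, eventually_vertical_jump (β := hessianMatrix V q₀ 2 2) hT,
    Ioo_mem_nhdsGT hT] with ε h1 h2 hε
  rw [morseJump, hessianMatrix_coriolisHamiltonian alpha3_transpose h.isOpen h.contDiffOn hq₀,
    morseIndex_szulkinMatrix alpha3_transpose hB (by linarith [hε.1]),
    morseIndex_szulkinMatrix alpha3_transpose hB (by linarith [hε.2]),
    morseIndex_reducedMatrix_alpha3 h02 h12 h20 h21,
    morseIndex_reducedMatrix_alpha3 h02 h12 h20 h21, hplane, ← h1, ← h2]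
  push_cast
  ring

theorem gamma3_eq {Ω : Set (EuclideanSpace ℝ (Fin 3))}
    {V : EuclideanSpace ℝ (Fin 3) → ℝ} (h : SpatialSystem Ω V) {q₀ : EuclideanSpace ℝ (Fin 3)}
    (hq₀ : q₀ ∈ Ω) (hcrit : gradient V q₀ = 0) {T j : ℝ}
    (hj : Tendsto (morseJump (coriolisHamiltonian alpha3 V) T (phaseEquilibrium alpha3 q₀))
      (𝓝[>] 0) (𝓝 j)) :
    gamma3 V T q₀ =
      brouwerIndex (planeProjection q₀) (gradient (planarRestriction V)) * j := by
  rw [gamma3, bifurcationNumber_eq hj, brouwerIndex_gradient_coriolisHamiltonian alpha3_transpose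
    h.isOpen h.contDiffOn hq₀ (h.isolated q₀ hq₀ hcrit),
    brouwerIndex_gradient_planarRestriction h hq₀ hcrit]

end BifurcationNumbers

theorem mainTheorem10 :
    -- the planar case
    (∀ (Ω : Set (EuclideanSpace ℝ (Fin 2))) (V : EuclideanSpace ℝ (Fin 2) → ℝ),
      PlanarSystem Ω V →
      ∀ q₀ ∈ Ω, gradient V q₀ = 0 →
      ∀ T : ℝ, 0 < T →
      ∀ β₁ β₂ : ℝ, (hessianMatrix V q₀).charpoly.roots = {β₁, β₂} →
        (∃ l : ℝ, Tendsto (morseJump (coriolisHamiltonian alpha2 V) T (phaseEquilibrium alpha2 q₀))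
          (𝓝[>] 0) (𝓝 l)) ∧
        ((β₁, β₂) ∈ region2 ∪ region4 → T = periodMinus (β₁, β₂) → gamma2 V T q₀ = -1) ∧
        ((β₁, β₂) ∈ region1 ∪ region3 → T = periodMinus (β₁, β₂) → gamma2 V T q₀ = 1) ∧
        ((β₁, β₂) ∈ axesC \ frontier region0 → T = periodMinus (β₁, β₂) →
          gamma2 V T q₀ = brouwerIndex q₀ (gradient V)) ∧
        ((β₁, β₂) ∈ region1 → T = periodPlus (β₁, β₂) → gamma2 V T q₀ = 1) ∧
        ((β₁, β₂) ∈ region3 → T = periodPlus (β₁, β₂) → gamma2 V T q₀ = -1) ∧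
        (¬ ((β₁, β₂) ∈ region2 ∪ region4 ∧ T = periodMinus (β₁, β₂)) →
          ¬ ((β₁, β₂) ∈ region1 ∪ region3 ∧ T = periodMinus (β₁, β₂)) →
          ¬ ((β₁, β₂) ∈ axesC \ frontier region0 ∧ T = periodMinus (β₁, β₂)) →
          ¬ ((β₁, β₂) ∈ region1 ∧ T = periodPlus (β₁, β₂)) →
          ¬ ((β₁, β₂) ∈ region3 ∧ T = periodPlus (β₁, β₂)) →
          gamma2 V T q₀ = 0)) ∧
    -- the spatial case
    (∀ (Ω : Set (EuclideanSpace ℝ (Fin 3))) (V : EuclideanSpace ℝ (Fin 3) → ℝ),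
      SpatialSystem Ω V →
      ∀ q₀ ∈ Ω, gradient V q₀ = 0 →
      ∀ T : ℝ, 0 < T →
      ∀ β₁ β₂ β₃ : ℝ,
        (hessianMatrix (planarRestriction V) (planeProjection q₀)).charpoly.roots = {β₁, β₂} →
        β₃ = hessianMatrix V q₀ 2 2 →
        (∃ l : ℝ, Tendsto (morseJump (coriolisHamiltonian alpha3 V) T (phaseEquilibrium alpha3 q₀))
          (𝓝[>] 0) (𝓝 l)) ∧
        ((β₁, β₂) ∈ region2 ∪ region4 → T = 2 * Real.pi / √β₃ →
          gamma3 V T q₀ = gamma2 (planarRestriction V) T (planeProjection q₀) - 1) ∧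
        ((β₁, β₂) ∈ (closure region0 \ axesC) ∪ region1 ∪ region3 → T = 2 * Real.pi / √β₃ →
          gamma3 V T q₀ = gamma2 (planarRestriction V) T (planeProjection q₀) + 1) ∧
        ((β₁, β₂) ∈ axesC → T = 2 * Real.pi / √β₃ →
          gamma3 V T q₀ = gamma2 (planarRestriction V) T (planeProjection q₀)
            + brouwerIndex (planeProjection q₀) (gradient (planarRestriction V))) ∧
        (T ≠ 2 * Real.pi / √β₃ →
          gamma3 V T q₀ = gamma2 (planarRestriction V) T (planeProjection q₀))) := by
  constructor
  · intro Ω V h q₀ hq₀ hcrit T hT β₁ β₂ hβ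
    obtain ⟨j, hev, hm, hp1, hp3, h0⟩ := exists_planar_jump
      (hessianMatrix_transpose h.isOpen h.contDiffOn hq₀) hβ hT
    have hj := tendsto_morseJump_planar h hq₀ hT hev
    rw [gamma2_eq h hq₀ hcrit hj]
    obtain ⟨hneg, hpos⟩ := brouwerIndex_planar h hq₀ hcrit hβ
    have hpos13 : (β₁, β₂) ∈ region1 ∪ region3 → brouwerIndex q₀ (gradient V) = 1 := fun hb =>
      hpos (hb.imp_right fun h3 => ⟨h3.1, h3.2.1⟩)
    refine ⟨⟨j, hj⟩, fun hb hTm => ?_, fun hb hTm => ?_, fun hb hTm => ?_, fun hb hTp => ?_,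
      fun hb hTp => ?_, fun n1 n2 n3 n4 n5 => ?_⟩
    · rw [hneg hb, hm (Or.inl (Or.inl hb)) hTm]; norm_num
    · rw [hpos13 hb, hm (Or.inl (Or.inr hb)) hTm]; norm_num
    · rw [hm (Or.inr hb) hTm, mul_one]
    · rw [hpos13 (Or.inl hb), hp1 hb hTp]; norm_num
    · rw [hpos13 (Or.inr hb), hp3 hb hTp]; norm_num
    · rw [h0 (fun hA => ?_) n4 n5, mul_zero]
      rcases hA with ⟨(hb | hb) | hb, hTm⟩
      · exact n1 ⟨hb, hTm⟩
      · exact n2 ⟨hb, hTm⟩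
      · exact n3 ⟨hb, hTm⟩
  · intro Ω V h q₀ hq₀ hcrit T hT β₁ β₂ β₃ hβ hβ₃
    have hP := PlanarSystem.of_spatialSystem h
    have hemb := planeEmbedding_planeProjection (h.planar_equilibria q₀ hq₀ hcrit)
    have hwΩ : planeProjection q₀ ∈ planeEmbedding ⁻¹' Ω := by
      rw [mem_preimage, hemb]; exact hq₀
    have hcritw : gradient (planarRestriction V) (planeProjection q₀) = 0 := by
      rw [gradient_planarRestriction h.isOpen h.contDiffOn hwΩ, hemb, hcrit]
      exact planeProjectionCLM.map_zero
    obtain ⟨j, hev, -⟩ := exists_planar_jump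
      (hessianMatrix_transpose hP.isOpen hP.contDiffOn hwΩ) hβ hT
    have hj₂ := tendsto_morseJump_planar hP hwΩ hT hev
    have hj₃ := tendsto_morseJump_spatial h hq₀ hcrit hT hev
    -- Now γ₂ = i·j and γ₃ = i·(j + δ), where i is the planar index and δ is 1 at the vertical
    -- period and 0 elsewhere; only the value of i remains to be inserted.
    rw [gamma3_eq h hq₀ hcrit hj₃, gamma2_eq hP hwΩ hcritw hj₂, ← hβ₃]
    have hβpos : 0 < β₃ := hβ₃ ▸ h.vertical_attraction q₀ hq₀ hcrit
    have hper := eq_two_pi_div_sqrt_iff hT hβpos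
    obtain ⟨hneg, hpos⟩ := brouwerIndex_planar hP hwΩ hcritw hβ
    refine ⟨⟨_, hj₃⟩, fun hb hTv => ?_, fun hb hTv => ?_, fun hb hTv => ?_, fun hTv => ?_⟩
    · rw [if_pos (hper.1 hTv), hneg hb]; push_cast; ring
    · have hb' : (β₁, β₂) ∈ region1 ∨ (β₁ < 0 ∧ β₂ < 0) := by
        rcases hb with (⟨hb, hC⟩ | hb) | hb
        · obtain ⟨h1, h2, -⟩ := closure_region0_subset hb
          exact Or.inr ⟨lt_of_le_of_ne h1 fun e => hC (Or.inr e),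
            lt_of_le_of_ne h2 fun e => hC (Or.inl e)⟩
        · exact Or.inl hb
        · exact Or.inr ⟨hb.1, hb.2.1⟩
      rw [if_pos (hper.1 hTv), hpos hb']; push_cast; ring
    · rw [if_pos (hper.1 hTv)]; ring
    · rw [if_neg fun e => hTv (hper.2 e)]; ring
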